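/- Fix an integer $M\ge 1$. An expansion of a real number $x$ in base $q\ge 1$ is a sequence $(c_i)_{i\ge1}$ in $\{0,\dots,M\}$ with $\sum_{i\ge 1} c_i q^{-i}=x$. A sequence is infinite if it has infinitely many nonzero digits or is $0^\infty$; it is doubly infinite if both $(c_i)$ and $(M-c_i)$ are infinite. Let $\mathcal U$ (respectively $\mathcal V$) be the set of $q\in(1,M+1]$ such that $1$ has a unique expansion (respectively a unique doubly infinite expansion) in base $q$. Let $\beta(q)$ be the lexicographically largest expansion of $1$ in base $q$ (so $\beta(1)=1\,0^\infty$). If $q>1$ and $\beta(q)=\beta_1\cdots\beta_N0^\infty$ with $\beta_N\neq 0$, put $a_i=\sum_{k=1}^{N-i+1}\beta_{i+k-1}q^{-k}$ and $b_i=\frac{M}{q-1}-a_i$ for $1\le i\le N$, and $S_q=\bigcup_{j=1}^M\left[\frac jq,\frac{j-1}q+\frac M{q^2-q}\right]$. Let $\mathcal G(q)$ be the labeled directed graph whose vertices are the connected components of $\left(0,\frac M{q-1}\right)\setminus(S_q\cup\{a_1,\dots,a_N,b_1,\dots,b_N\})$ and whose edges are the triples $(I,k,J)$ with $I,J$ vertices,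 $k\in\{0,\dots,M\}$ and $T_k(I)\supset J$, where $T_k(x)=qx-k$. **Theorem 1.4.** Let $(q_0,q_0^*)$ be a connected component of $(1,M+1)\setminus\overline{\mathcal U}$; if $q_0=1$, assume that $M$ is odd. Then $\beta(q_0)$ has a last nonzero digit, say the $n$th one, and the elements of $\mathcal V$ in $(q_0,q_0^*)$ form an infinite increasing sequence $q_1<q_2<\cdots$. Moreover, there exist an infinite directed graph $\hat{\mathcal G}(q_0^*)$ with edges labeled by $\{0,\dots,M\}$ and a partition $V_1,V_2,\dots$ of its vertex set such that 1. $|V_1|=2n+M-1$, and $|V_m|=2^{m-1}n$ for every $m\ge 2$; 2. for every $m\ge2$ the subgraph spanned by $V_m$ is a pure directed cycle, i.e. it consists of a single directed cycle through all elements of $V_m$ and has no further edges; 3. for every $m\ge1$ the subgraph spanned by $V_1\cup\dots\cup V_m$ is isomorphic, as a labeled directed graph, to $\mathcal G(q_m)$; 4. for all $j,k\ge1$ there is a directed path of length at least one from some vertex of $V_j$ to some vertex of $V_k$ if and only if $j\le k$. -/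

import Mathlib

open Set

noncomputable section

namespace Univoque

/-! ### Expansions in a real base `q` over the alphabet `{0, …, M}` -/

/-- Digit sequences; the entry `c i` is the digit `c_{i+1}` in the usual indexing from `1`. -/
abbrev DigitSeq (M : ℕ) : Type := ℕ → Fin (M + 1)

/-- `c` is an expansion of `x` in base `q`: `x = ∑_{i ≥ 1} c_i / q ^ i`. -/
def IsExpansion (M : ℕ) (q x : ℝ) (c : DigitSeq M) : Prop :=
  HasSum (fun i : ℕ => ((c i : ℕ) : ℝ) / q ^ (i + 1)) x

/-- A sequence is infinite if it has infinitely many nonzero digits or is identically zero. -/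
def IsInfiniteSeq {M : ℕ} (c : DigitSeq M) : Prop :=
  (∀ N : ℕ, ∃ i, N ≤ i ∧ c i ≠ 0) ∨ ∀ i, c i = 0

/-- A sequence is doubly infinite if it and its reflection `(M - c_i)` are infinite. -/
def IsDoublyInfiniteSeq {M : ℕ} (c : DigitSeq M) : Prop :=
  IsInfiniteSeq c ∧ IsInfiniteSeq (fun i => Fin.rev (c i))

/-- The set `𝒰` of bases in which `1` has a unique expansion. -/
def basesU (M : ℕ) : Set ℝ :=
  {q | q ∈ Ioc (1 : ℝ) (M + 1) ∧ ∃! c : DigitSeq M, IsExpansion M q 1 c}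

/-- The set `𝒱` of bases in which `1` has a unique doubly infinite expansion. -/
def basesV (M : ℕ) : Set ℝ :=
  {q | q ∈ Ioc (1 : ℝ) (M + 1) ∧
    ∃! c : DigitSeq M, IsExpansion M q 1 c ∧ IsDoublyInfiniteSeq c}

/-- `b` is the greedy (lexicographically largest) expansion of `x` in base `q`. -/
def IsGreedyExpansion (M : ℕ) (q x : ℝ) (b : DigitSeq M) : Prop :=
  IsExpansion M q x b ∧ ∀ c : DigitSeq M, IsExpansion M q x c → toLex c ≤ toLex b

/-- `b = β(q)` is the greedy expansion of `1` in base `q`, and its last nonzero digit is the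
`N`th one.  For `q = 1` this gives the usual convention `β(1) = 1 0^∞`. -/
def IsFiniteBeta (M : ℕ) (q : ℝ) (b : DigitSeq M) (N : ℕ) : Prop :=
  IsGreedyExpansion M q 1 b ∧ 1 ≤ N ∧ b (N - 1) ≠ 0 ∧ ∀ i, N ≤ i → b i = 0

/-! ### Labeled directed graphs -/

/-- A directed graph with vertex type `V` and edges labeled by `L`; an edge is a triple
`(u, k, v)`, so there is at most one edge with given source, label and target. -/
structure LabeledDigraph (V L : Type) where
  Edge : V → L → V → Prop

namespace LabeledDigraph

variable {V W L : Type}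

/-- The subgraph spanned by a set of vertices. -/
def induce (G : LabeledDigraph V L) (s : Set V) : LabeledDigraph s L where
  Edge u k v := G.Edge u k v

/-- Isomorphism of labeled directed graphs, preserving the labels. -/
def Isomorphic (G : LabeledDigraph V L) (H : LabeledDigraph W L) : Prop :=
  ∃ e : V ≃ W, ∀ u k v, G.Edge u k v ↔ H.Edge (e u) k (e v)

/-- There is a directed path of length at least one from `u` to `v`. -/
def HasPath (G : LabeledDigraph V L) (u v : V) : Prop :=
  Relation.TransGen (fun x y => ∃ k, G.Edge x k y) u v

/-- `G` is a finite directed cycle `v_0 → v_1 → ⋯ → v_{p-1} → v_0` on distinct vertices, with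
no further vertices and exactly one (labeled) edge from each `v_i` to `v_{i+1}` and no others. -/
def IsPureCycle (G : LabeledDigraph V L) : Prop :=
  ∃ p : ℕ, 0 < p ∧ ∃ (v : ZMod p ≃ V) (l : ZMod p → L),
    ∀ i k j, G.Edge (v i) k (v j) ↔ j = i + 1 ∧ k = l i

end LabeledDigraph

/-! ### The univoque graph `𝒢(q)` -/

/-- The switch region `⋃_{j=1}^M [j/q, (j-1)/q + M/(q²-q)]`. -/
def switchRegion (M : ℕ) (q : ℝ) : Set ℝ :=
  {x | ∃ j : ℕ, 1 ≤ j ∧ j ≤ M ∧ x ∈ Icc ((j : ℝ) / q) (((j : ℝ) - 1) / q + M / (q ^ 2 - q))}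

/-- The points `a_1, …, a_N`: if `β(q) = β_1 ⋯ β_N 0^∞` with `β_N ≠ 0`, then `a_{i+1}` is the
number with expansion `β_{i+1} ⋯ β_N 0^∞`, for `0 ≤ i < N`. -/
def pointsA (M : ℕ) (q : ℝ) : Set ℝ :=
  {x | ∃ (b : DigitSeq M) (N : ℕ), IsFiniteBeta M q b N ∧
    ∃ i < N, IsExpansion M q x (fun k => b (i + k))}

/-- The points `b_i = M/(q-1) - a_i`. -/
def pointsB (M : ℕ) (q : ℝ) : Set ℝ :=
  {x | ∃ a ∈ pointsA M q, x = (M : ℝ) / (q - 1) - a}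

/-- The open set `(0, M/(q-1)) \ (S_q ∪ {a_1, …, a_N, b_1, …, b_N})`. -/
def graphRegion (M : ℕ) (q : ℝ) : Set ℝ :=
  Ioo 0 ((M : ℝ) / (q - 1)) \ (switchRegion M q ∪ (pointsA M q ∪ pointsB M q))

/-- The vertices of `𝒢(q)`: the connected components of `graphRegion M q`. -/
abbrev GraphVertex (M : ℕ) (q : ℝ) : Type :=
  {I : Set ℝ // ∃ x ∈ graphRegion M q, I = connectedComponentIn (graphRegion M q) x}

/-- The labeled graph `𝒢(q)`: there is an edge `(I, k, J)` if and only if `T_k(I) ⊇ J`, where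
`T_k(x) = q x - k`. -/
def univoqueGraph (M : ℕ) (q : ℝ) : LabeledDigraph (GraphVertex M q) (Fin (M + 1)) where
  Edge I k J := J.1 ⊆ (fun x : ℝ => q * x - ((k : ℕ) : ℝ)) '' I.1

/-- `(q₀, q₁)` is a connected component of `(1, M+1) \ closure 𝒰`. -/
def IsGap (M : ℕ) (q₀ q₁ : ℝ) : Prop :=
  ∃ x ∈ Ioo (1 : ℝ) (M + 1) \ closure (basesU M),
    connectedComponentIn (Ioo (1 : ℝ) (M + 1) \ closure (basesU M)) x = Ioo q₀ q₁

end Univoque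

end

/-!
# Univoque graphs over a gap of the closure of `𝒰`

The quasi-greedy expansions `α` of `1` are the infinite sequences none of whose tails exceeds them
(`Parry`), and they increase with the base. A base below `M + 1` lies in `𝒱` if and only if moreover
no tail is below the reflection `M - α`, and in `𝒰` if and only if these inequalities are strict for
all proper tails. A gap
`(q₀, q₀')` of the closure of `𝒰` is governed by one admissible word `w` of some length `n`
(`Good`, `Parry.exists_gap_word`): `β(q₀)` has length `n`, and the bases of `𝒱` inside the gap are
those whose quasi-greedy expansion is `(w_m⁻)^∞` for some `m ≥ 1`. Here `w_0 = w`, the word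
`w_{m+1}` is `w_m` followed by its reflection with the last digit raised by one, and `⁻` lowers the
last digit by one. The limit of the words gives the right end of the gap, which lies in `𝒰`. This is
`gap_structure`.

For `q = q_{m+1}` put `h = 2 ^ m * n`. The orbit of `1` under the quasi-greedy digits is reflected
after `h` steps, so the points `a_i, b_i` are the `2 * h` points `X i s` with `i < h`, where the
flag `s` tells the orbit from its reflection (`Level`). A vertex of `𝒢(q)` is determined by the digit
of its points and by their position relative to the points `X i s`, and the edges `I → J` with label
`k` are found by pulling back a point `z ∈ J` to `(z + k) / q` (`Level.edge_iff`). Thus the graph is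
determined by the order of the orbit.

Passing from `q_{m+1}` to `q_{m+2}` preserves this order (`LevelPair.mono`), except that each point of
the smaller graph is split into two, `X i s` and `X (i + h) (!s)`. Hence the smaller graph is a full
subgraph of the larger one (`LevelPair.exists_embedding`), and the new vertices are the `2 * h`
intervals between two points that used to coincide. From such an interval the only edge is the one
that follows the orbit, so that the new vertices form a cycle (`LevelPair.exists_cycle`) which
cannot be left. It can be entered from the block before (`LevelPair.exists_edge_into`,
`LevelPair.exists_edge_between`). The graph `𝒢̂` is the union of the resulting tower of graphs
(`GraphTower.limit`), and the vertices are counted in `Level.card_vertices`.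
-/

namespace Univoque

/-! ### Digit sequences, their values and the lexicographic order -/

/-- The tail `c_n c_{n+1} …` of a sequence. -/
def shift (n : ℕ) (c : ℕ → ℕ) : ℕ → ℕ := fun i => c (n + i)

/-- The reflection `(M - c_i)` of a sequence. -/
def reflect (M : ℕ) (c : ℕ → ℕ) : ℕ → ℕ := fun i => M - c i

/-- The value `∑ c_i / q ^ (i + 1)` of a sequence in base `q`. -/
noncomputable def val (q : ℝ) (c : ℕ → ℕ) : ℝ := ∑' i, (c i : ℝ) / q ^ (i + 1)

/-- The digits of `c` are at most `M`. -/
def Digits (M : ℕ) (c : ℕ → ℕ) : Prop := ∀ i, c i ≤ M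

/-- Infinitely many digits are nonzero. Unlike `IsInfiniteSeq`, this excludes `0^∞`. -/
def InfNonzero (c : ℕ → ℕ) : Prop := ∀ n, ∃ i, n ≤ i ∧ c i ≠ 0

theorem lex_lt_iff {c e : ℕ → ℕ} :
    toLex c < toLex e ↔ ∃ t, (∀ i < t, c i = e i) ∧ c t < e t := Iff.rfl

@[simp] theorem shift_zero (c : ℕ → ℕ) : shift 0 c = c := by
  funext i; simp [shift]

theorem shift_shift (m n : ℕ) (c : ℕ → ℕ) : shift m (shift n c) = shift (n + m) c := by
  funext i; simp [shift, add_assoc]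

theorem reflect_shift (M n : ℕ) (c : ℕ → ℕ) : reflect M (shift n c) = shift n (reflect M c) := rfl

theorem reflect_reflect {M : ℕ} {c : ℕ → ℕ} (hc : Digits M c) : reflect M (reflect M c) = c := by
  funext i
  have := hc i
  simp only [reflect]
  omega

theorem Digits.reflect (M : ℕ) (c : ℕ → ℕ) : Digits M (reflect M c) := fun _ => Nat.sub_le _ _

theorem Digits.shift {M : ℕ} {c : ℕ → ℕ} (hc : Digits M c) (n : ℕ) : Digits M (shift n c) :=
  fun _ => hc _

theorem reflect_lt_reflect {M : ℕ} {c e : ℕ → ℕ} (he : Digits M e)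
    (h : toLex c < toLex e) : toLex (reflect M e) < toLex (reflect M c) := by
  obtain ⟨t, h1, h2⟩ := h
  refine ⟨t, fun i hi => ?_, ?_⟩
  · have := h1 i hi
    simp only [Pi.toLex_apply] at this
    simp [Univoque.reflect, this]
  · have := he t
    simp only [Pi.toLex_apply, Univoque.reflect] at h2 ⊢
    omega

theorem reflect_le_reflect {M : ℕ} {c e : ℕ → ℕ} (he : Digits M e)
    (h : toLex c ≤ toLex e) : toLex (reflect M e) ≤ toLex (reflect M c) := by
  rcases h.lt_or_eq with h | h
  · exact (reflect_lt_reflect he h).le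
  · rw [toLex_inj.1 h]

theorem InfNonzero.shift {c : ℕ → ℕ} (h : InfNonzero c) (n : ℕ) : InfNonzero (shift n c) := by
  intro m
  obtain ⟨i, hi, h⟩ := h (n + m)
  refine ⟨i - n, by omega, ?_⟩
  rwa [Univoque.shift, show n + (i - n) = i by omega]

section Val

variable {M : ℕ} {q : ℝ} {c e : ℕ → ℕ}

theorem hasSum_const_digit (M : ℕ) (hq : 1 < q) :
    HasSum (fun i : ℕ => (M : ℝ) / q ^ (i + 1)) (M / (q - 1)) := by
  have hq0 : 0 < q := by linarith
  have h := (hasSum_geometric_of_lt_one (r := q⁻¹) (by positivity)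
    (inv_lt_one_of_one_lt₀ hq)).mul_left (M / q)
  have h1 : (M : ℝ) / q * (1 - q⁻¹)⁻¹ = M / (q - 1) := by
    have : q - 1 ≠ 0 := by linarith
    field_simp
  rw [h1] at h
  have he : (fun i : ℕ => (M : ℝ) / q ^ (i + 1)) = fun i => M / q * q⁻¹ ^ i := by
    funext i
    rw [pow_succ, inv_pow]
    field_simp
  rwa [he]

theorem term_nonneg (hq : 1 < q) (i : ℕ) : 0 ≤ (c i : ℝ) / q ^ (i + 1) := by
  have : 0 < q := by linarith
  positivity

theorem term_le (hq : 1 < q) (hc : Digits M c) (i : ℕ) :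
    (c i : ℝ) / q ^ (i + 1) ≤ (M : ℝ) / q ^ (i + 1) := by
  have : 0 < q := by linarith
  gcongr
  exact hc i

theorem summable_val (hq : 1 < q) (hc : Digits M c) :
    Summable fun i : ℕ => (c i : ℝ) / q ^ (i + 1) :=
  Summable.of_nonneg_of_le (term_nonneg hq) (term_le hq hc) (hasSum_const_digit M hq).summable

theorem hasSum_val (hq : 1 < q) (hc : Digits M c) :
    HasSum (fun i : ℕ => (c i : ℝ) / q ^ (i + 1)) (val q c) := (summable_val hq hc).hasSum

theorem val_nonneg (hq : 1 < q) : 0 ≤ val q c := tsum_nonneg (term_nonneg hq)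

theorem val_le (hq : 1 < q) (hc : Digits M c) : val q c ≤ M / (q - 1) :=
  hasSum_le (term_le hq hc) (hasSum_val hq hc) (hasSum_const_digit M hq)

theorem val_step (hq : 1 < q) (hc : Digits M c) : val q c = (c 0 + val q (shift 1 c)) / q := by
  have hq0 : q ≠ 0 := by linarith
  have h := (summable_val hq hc).tsum_eq_zero_add
  rw [val, h, val, add_div, ← tsum_div_const]
  congr 1
  · simp
  · congr 1
    funext i
    simp only [shift]
    rw [pow_succ q (i + 1), add_comm 1 i]
    field_simp

theorem val_shift_succ (hq : 1 < q) (hc : Digits M c) (n : ℕ) :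
    val q (shift (n + 1) c) = q * val q (shift n c) - c n := by
  have h := val_step hq (hc.shift n)
  rw [shift_shift] at h
  have hq0 : q ≠ 0 := by linarith
  rw [h]
  simp [shift]
  field_simp
  ring

theorem val_reflect (hq : 1 < q) (hc : Digits M c) :
    val q (reflect M c) = M / (q - 1) - val q c := by
  have h := (hasSum_const_digit M hq).sub (hasSum_val hq hc)
  rw [← h.tsum_eq, val]
  congr 1
  funext i
  rw [reflect, Nat.cast_sub (hc i), sub_div]

theorem val_pos (hq : 1 < q) (hc : Digits M c) {i : ℕ} (hi : c i ≠ 0) : 0 < val q c := by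
  have hq0 : 0 < q := by linarith
  have : 0 < (c i : ℝ) := by exact_mod_cast Nat.pos_of_ne_zero hi
  exact (summable_val hq hc).tsum_pos (term_nonneg hq) i (by positivity)

theorem InfNonzero.val_pos (h : InfNonzero c) (hq : 1 < q) (hc : Digits M c) (n : ℕ) :
    0 < val q (Univoque.shift n c) := by
  obtain ⟨i, -, hi⟩ := h.shift n 0
  exact Univoque.val_pos hq (hc.shift n) hi

theorem eq_zero_of_val_eq_zero (hq : 1 < q) (hc : Digits M c) (h : val q c = 0) (i : ℕ) :
    c i = 0 := by
  by_contra hi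
  exact (val_pos hq hc hi).ne' h

/-- Two sequences that agree in the first `t` places: compare values through the tails. -/
theorem val_sub_val (hq : 1 < q) (hc : Digits M c) (he : Digits M e) {t : ℕ}
    (h : ∀ i < t, c i = e i) :
    val q c - val q e = (val q (shift t c) - val q (shift t e)) / q ^ t := by
  have hq0 : q ≠ 0 := by linarith
  induction t with
  | zero => simp
  | succ t ih =>
    rw [ih fun i hi => h i (by omega), val_shift_succ hq hc, val_shift_succ hq he, h t (by omega),
      pow_succ]
    field_simp
    ring

theorem val_sub_val' (hq : 1 < q) (hc : Digits M c) (he : Digits M e) {t : ℕ}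
    (h : ∀ i < t, c i = e i) :
    val q c - val q e =
      ((c t : ℝ) - e t + val q (shift (t + 1) c) - val q (shift (t + 1) e)) / q ^ (t + 1) := by
  have hq0 : q ≠ 0 := by linarith
  rw [val_sub_val hq hc he h, val_shift_succ hq hc, val_shift_succ hq he, pow_succ]
  field_simp
  ring

/-- If every tail of `c` is lexicographically at most an expansion `e` of `1`, then the tails of
`c` have values at most `1`: the excess over `1` of a tail is at most `1 / q` times the excess of
a later one, and excesses are bounded. -/
theorem val_le_one (hq : 1 < q) (hc : Digits M c) (he : Digits M e) (h1 : val q e = 1)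
    (h : ∀ n, toLex (shift n c) ≤ toLex e) (n : ℕ) : val q (shift n c) ≤ 1 := by
  have hq0 : 0 < q := by linarith
  have hM : 0 ≤ (M : ℝ) / (q - 1) := div_nonneg (by positivity) (by linarith)
  have key : ∀ k n, val q (shift n c) - 1 ≤ (M / (q - 1)) / q ^ k := by
    intro k
    induction k with
    | zero => intro n; have := val_le hq (hc.shift n); simp; linarith
    | succ k ih =>
      intro n
      rcases (h n).lt_or_eq with hlt | heq
      · obtain ⟨t, ht, hlt⟩ := lex_lt_iff.1 hlt
        have hs := val_sub_val' hq (hc.shift n) he ht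
        rw [h1] at hs
        rw [hs, shift_shift]
        have h2 := ih (n + (t + 1))
        have h3 : (shift n c t : ℝ) + 1 ≤ e t := by exact_mod_cast hlt
        have h4 : 0 ≤ val q (shift (t + 1) e) := val_nonneg hq
        calc _ ≤ (M / (q - 1)) / q ^ k / q ^ (t + 1) := by gcongr; linarith
          _ ≤ (M / (q - 1)) / q ^ k / q ^ 1 := by
            gcongr
            · exact hq.le
            · omega
          _ = _ := by rw [pow_one, pow_succ, div_div]
      · rw [toLex_inj.1 heq, h1, sub_self]; positivity
  have hlim : Filter.Tendsto (fun k : ℕ => (M / (q - 1)) / q ^ k) Filter.atTop (nhds 0) :=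
    Filter.Tendsto.div_atTop tendsto_const_nhds (tendsto_pow_atTop_atTop_of_one_lt hq)
  have := ge_of_tendsto' hlim fun k => key k n
  linarith

theorem val_lt_one (hq : 1 < q) (hc : Digits M c) (he : Digits M e) (h1 : val q e = 1)
    (hinf : InfNonzero e) (h : ∀ n, toLex (shift n c) ≤ toLex e) (hlt : toLex c < toLex e) :
    val q c < 1 := by
  have hq0 : 0 < q := by linarith
  obtain ⟨t, ht, hlt⟩ := lex_lt_iff.1 hlt
  have hs := val_sub_val' hq hc he ht
  have h2 := val_le_one hq hc he h1 h (t + 1)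
  have h3 : (c t : ℝ) + 1 ≤ e t := by exact_mod_cast hlt
  have h4 := hinf.val_pos hq he (t + 1)
  rw [h1] at hs
  have : ((c t : ℝ) - e t + val q (shift (t + 1) c) - val q (shift (t + 1) e)) / q ^ (t + 1) < 0 :=
    div_neg_of_neg_of_pos (by linarith) (by positivity)
  linarith

/-- The value of a nonzero sequence decreases with the base. -/
theorem val_lt_val {q' : ℝ} (hq : 1 < q) (hqq : q < q') (hc : Digits M c) {i : ℕ} (hi : c i ≠ 0) :
    val q' c < val q c := by
  have hq0 : 0 < q := by linarith
  refine Summable.tsum_lt_tsum (i := i) (fun j => ?_) ?_ (summable_val (hq.trans hqq) hc)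
    (summable_val hq hc)
  · gcongr
  · have : 0 < (c i : ℝ) := by exact_mod_cast Nat.pos_of_ne_zero hi
    gcongr

/-- `c` is an infinite sequence none of whose tails exceeds it. These are the quasi-greedy
expansions of `1`. -/
structure Parry (M : ℕ) (c : ℕ → ℕ) : Prop where
  digits : Digits M c
  inf : InfNonzero c
  shift_le : ∀ n, toLex (shift n c) ≤ toLex c

theorem Parry.base_lt {q' : ℝ} (hc : Parry M c) (he : Parry M e) (hq' : 1 < q')
    (h1 : val q c = 1) (h1' : val q' e = 1) (h : toLex c < toLex e) : q < q' := by
  have h2 := val_lt_one hq' hc.digits he.digits h1' he.inf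
    (fun n => (hc.shift_le n).trans h.le) h
  by_contra! hle
  obtain ⟨i, -, hi⟩ := hc.inf 0
  rcases hle.lt_or_eq with hlt | heq
  · have := val_lt_val hq' hlt hc.digits hi
    linarith
  · rw [heq] at h2; linarith

theorem base_unique {q' : ℝ} (hc : Parry M c) (hq : 1 < q) (hq' : 1 < q')
    (h1 : val q c = 1) (h1' : val q' c = 1) : q = q' := by
  obtain ⟨i, -, hi⟩ := hc.inf 0
  rcases lt_trichotomy q q' with h | h | h
  · have := val_lt_val hq h hc.digits hi; linarith
  · exact h
  · have := val_lt_val hq' h hc.digits hi; linarith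

theorem Parry.lt_of_base_lt {q' : ℝ} (hc : Parry M c) (he : Parry M e) (hq : 1 < q) (hq' : 1 < q')
    (h1 : val q c = 1) (h1' : val q' e = 1) (h : q < q') : toLex c < toLex e := by
  rcases lt_trichotomy (toLex c) (toLex e) with h2 | h2 | h2
  · exact h2
  · rw [← toLex_inj.1 h2] at h1'
    exact absurd (base_unique hc hq hq' h1 h1') h.ne
  · exact absurd (he.base_lt hc hq h1' h1 h2) h.not_gt

end Val

/-! ### Bases and quasi-greedy expansions of `1` -/

theorem continuousOn_val {M : ℕ} {c : ℕ → ℕ} (hc : Digits M c) {a : ℝ} (ha : 1 < a) :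
    ContinuousOn (fun q => val q c) (Ici a) := by
  have ha0 : 0 < a := by linarith
  refine continuousOn_tsum (u := fun i : ℕ => (M : ℝ) / a ^ (i + 1)) (fun i => ?_)
    (hasSum_const_digit M ha).summable fun i q hq => ?_
  · refine continuousOn_const.div (continuousOn_pow _) fun q hq => ?_
    have : 0 < q := ha0.trans_le hq
    positivity
  · have h1 : 0 < q := ha0.trans_le hq
    rw [Real.norm_of_nonneg (by positivity)]
    gcongr
    · exact hc i
    · exact hq

/-- Every quasi-greedy sequence is an expansion of `1` in some base. -/
theorem Parry.exists_base {M : ℕ} {c : ℕ → ℕ} (hc : Parry M c) :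
    ∃ q : ℝ, 1 < q ∧ q ≤ M + 1 ∧ val q c = 1 := by
  obtain ⟨i, -, hi⟩ := hc.inf 0
  obtain ⟨j, hij, hj⟩ := hc.inf (i + 1)
  have hM : 1 ≤ M := (Nat.one_le_iff_ne_zero.2 hi).trans (hc.digits i)
  have hM' : (1 : ℝ) ≤ M := by exact_mod_cast hM
  obtain ⟨a, ha1, haM, ha2⟩ : ∃ a : ℝ, 1 < a ∧ a < M + 1 ∧ a ^ (j + 1) < 2 := by
    have h1 : ∀ᶠ a : ℝ in nhds 1, a ^ (j + 1) < 2 :=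
      (continuous_pow (j + 1)).continuousAt.eventually_lt continuousAt_const (by norm_num)
    have h2 : ∀ᶠ a : ℝ in nhds 1, a < M + 1 := eventually_lt_nhds (by linarith)
    obtain ⟨a, ha, h⟩ := (((h1.and h2).filter_mono nhdsWithin_le_nhds).and
      (self_mem_nhdsWithin (a := (1 : ℝ)) (s := Ioi 1))).exists
    exact ⟨a, h, ha.2, ha.1⟩
  have hge : 1 ≤ val a c := by
    have hterm : ∀ k, k ≤ j → c k ≠ 0 → (1 : ℝ) / 2 ≤ c k / a ^ (k + 1) := by
      intro k hk hck
      have h1 : (1 : ℝ) ≤ c k := by exact_mod_cast Nat.one_le_iff_ne_zero.2 hck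
      have h2 : a ^ (k + 1) ≤ 2 :=
        (pow_le_pow_right₀ ha1.le (by omega : k + 1 ≤ j + 1)).trans ha2.le
      have h3 : 0 < a ^ (k + 1) := by positivity
      rw [div_le_div_iff₀ (by norm_num) h3]
      linarith
    have h := (summable_val ha1 hc.digits).sum_le_tsum {i, j} fun k _ => term_nonneg ha1 k
    rw [Finset.sum_pair (by omega)] at h
    have := hterm i (by omega) hi
    have := hterm j le_rfl hj
    unfold val
    linarith
  have hle : val (M + 1 : ℝ) c ≤ 1 := by
    have h := val_le (q := (M : ℝ) + 1) (by linarith) hc.digits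
    rwa [add_sub_cancel_right, div_self (by linarith)] at h
  obtain ⟨q, hq, h⟩ := intermediate_value_Icc' haM.le
    ((continuousOn_val hc.digits ha1).mono Icc_subset_Ici_self) ⟨hle, hge⟩
  exact ⟨q, ha1.trans_le hq.1, hq.2, h⟩

/-- The base depends continuously on the expansion of `1`. -/
theorem exists_agree_imp_base_close {M : ℕ} {c : ℕ → ℕ} (hc : Parry M c) {q : ℝ} (hq : 1 < q)
    (h1 : val q c = 1) {ε : ℝ} (hε : 0 < ε) :
    ∃ n, ∀ (e : ℕ → ℕ) (q' : ℝ), Parry M e → 1 < q' → val q' e = 1 → (∀ i < n, e i = c i) →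
      |q' - q| < ε := by
  obtain ⟨k, -, hk⟩ := hc.inf 0
  have small : ∀ p : ℝ, 1 < p → ∀ δ : ℝ, 0 < δ → ∃ n, ∀ m, n ≤ m → ∀ e : ℕ → ℕ, Digits M e →
      (∀ i < m, e i = c i) → |val p e - val p c| < δ := by
    intro p hp δ hδ
    have hlim : Filter.Tendsto (fun k : ℕ => (M / (p - 1)) / p ^ k) Filter.atTop (nhds 0) :=
      Filter.Tendsto.div_atTop tendsto_const_nhds (tendsto_pow_atTop_atTop_of_one_lt hp)
    obtain ⟨n, hn⟩ := Filter.eventually_atTop.1 (hlim.eventually_lt_const hδ)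
    refine ⟨n, fun m hm e he hec => ?_⟩
    rw [val_sub_val hp he hc.digits hec, abs_div, abs_of_pos (a := p ^ m) (by positivity)]
    refine lt_of_le_of_lt ?_ (hn m hm)
    have a1 := val_nonneg (c := shift m e) hp
    have a2 := val_nonneg (c := shift m c) hp
    have a3 := val_le hp (he.shift m)
    have a4 := val_le hp (hc.digits.shift m)
    gcongr
    rw [abs_le]
    constructor <;> linarith
  have hup : val (q + ε) c < 1 := h1 ▸ val_lt_val hq (by linarith) hc.digits hk
  set r := q - min ε ((q - 1) / 2) with hr
  have hr0 : 0 < min ε ((q - 1) / 2) := lt_min hε (by linarith)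
  have hr1 : 1 < r := by
    have := min_le_right ε ((q - 1) / 2)
    linarith
  have hrε : q - ε ≤ r := by
    have := min_le_left ε ((q - 1) / 2)
    linarith
  have hlo : 1 < val r c := h1 ▸ val_lt_val hr1 (by linarith) hc.digits hk
  obtain ⟨n, hn⟩ := small (q + ε) (by linarith) (1 - val (q + ε) c) (by linarith)
  obtain ⟨m, hm⟩ := small r hr1 (val r c - 1) (by linarith)
  refine ⟨max n m, fun e q' he hq' h1' hec => ?_⟩
  obtain ⟨l, -, hl⟩ := he.inf 0
  have h2 := abs_lt.1 (hn _ (le_max_left _ _) e he.digits hec)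
  have h3 := abs_lt.1 (hm _ (le_max_right _ _) e he.digits hec)
  rw [abs_lt]
  constructor
  · by_contra! hle
    rcases (show q' ≤ r by linarith).lt_or_eq with hlt | heq
    · have := val_lt_val hq' hlt he.digits hl
      linarith [h3.1]
    · rw [heq] at h1'; linarith [h3.1]
  · by_contra! hle
    rcases (show q + ε ≤ q' by linarith).lt_or_eq with hlt | heq
    · have := val_lt_val (by linarith) hlt he.digits hl
      linarith [h2.2]
    · rw [← heq] at h1'; linarith [h2.2]

/-- A bounded orbit `y (n + 1) = q * y n - c n` consists of the values of the tails of `c`. -/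
theorem val_shift_eq_of_orbit {M : ℕ} {c : ℕ → ℕ} (hc : Digits M c) {q : ℝ} (hq : 1 < q)
    {y : ℕ → ℝ} {B : ℝ} (h0 : ∀ n, 0 ≤ y n) (hB : ∀ n, y n ≤ B)
    (hy : ∀ n, y (n + 1) = q * y n - c n) (n : ℕ) : val q (shift n c) = y n := by
  have hq0 : 0 < q := by linarith
  have hstep : ∀ k, val q (shift (n + k) c) - y (n + k) = q ^ k * (val q (shift n c) - y n) := by
    intro k
    induction k with
    | zero => simp
    | succ k ih =>
      rw [← add_assoc, val_shift_succ hq hc, hy, pow_succ']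
      linear_combination q * ih
  have hb : ∀ k, |val q (shift n c) - y n| ≤ (M / (q - 1) + B) / q ^ k := by
    intro k
    rw [le_div_iff₀ (by positivity), mul_comm, ← abs_of_pos (a := q ^ k) (by positivity),
      ← abs_mul, ← hstep]
    have a1 := val_nonneg (c := shift (n + k) c) hq
    have a2 := val_le hq (hc.shift (n + k))
    have a3 := h0 (n + k)
    have a4 := hB (n + k)
    rw [abs_le]
    constructor <;> linarith
  have hlim : Filter.Tendsto (fun k : ℕ => (M / (q - 1) + B) / q ^ k) Filter.atTop (nhds 0) :=
    Filter.Tendsto.div_atTop tendsto_const_nhds (tendsto_pow_atTop_atTop_of_one_lt hq)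
  have := ge_of_tendsto' hlim hb
  exact sub_eq_zero.1 (abs_nonpos_iff.1 this)

/-- The quasi-greedy digit of `x`: the largest digit `k ≤ M` with `q * x - k > 0` (for `x > 0`). -/
noncomputable def qgDigit (M : ℕ) (q x : ℝ) : ℕ := min M (⌈q * x⌉₊ - 1)

/-- The orbit of `x` under the quasi-greedy algorithm. -/
noncomputable def qgOrbit (M : ℕ) (q x : ℝ) : ℕ → ℝ
  | 0 => x
  | n + 1 => q * qgOrbit M q x n - qgDigit M q (qgOrbit M q x n)

/-- The quasi-greedy expansion of `x`. -/
noncomputable def qgSeq (M : ℕ) (q x : ℝ) (n : ℕ) : ℕ := qgDigit M q (qgOrbit M q x n)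

theorem qgDigit_mono {M : ℕ} {q x y : ℝ} (hq : 1 < q) (h : x ≤ y) :
    qgDigit M q x ≤ qgDigit M q y := by
  have hq0 : 0 < q := by linarith
  have := Nat.ceil_mono (mul_le_mul_of_nonneg_left h hq0.le)
  unfold qgDigit
  omega

theorem qgDigit_bounds {M : ℕ} {q x : ℝ} (hq : 1 < q) (hx : 0 < x) :
    0 < q * x - qgDigit M q x ∧ (q * x - qgDigit M q x ≤ 1 ∨ qgDigit M q x = M) := by
  have hq0 : 0 < q := by linarith
  have hpos : 0 < q * x := by positivity
  have h1 : 0 < ⌈q * x⌉₊ := Nat.ceil_pos.2 hpos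
  have h2 : ((⌈q * x⌉₊ - 1 : ℕ) : ℝ) < q * x := by
    rw [← Nat.lt_ceil]; omega
  constructor
  · have : (qgDigit M q x : ℝ) ≤ ((⌈q * x⌉₊ - 1 : ℕ) : ℝ) := by
      exact_mod_cast min_le_right _ _
    linarith
  · by_cases h : M ≤ ⌈q * x⌉₊ - 1
    · exact Or.inr (min_eq_left h)
    · left
      rw [qgDigit, min_eq_right (by omega), Nat.cast_sub (by omega)]
      have := Nat.le_ceil (q * x)
      push_cast
      linarith

theorem qgSeq_digits (M : ℕ) (q x : ℝ) : Digits M (qgSeq M q x) := fun _ => min_le_left _ _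

theorem qgOrbit_shift (M : ℕ) (q x : ℝ) (m n : ℕ) :
    qgOrbit M q x (m + n) = qgOrbit M q (qgOrbit M q x m) n := by
  induction n with
  | zero => rfl
  | succ n ih => rw [← add_assoc, qgOrbit, ih, qgOrbit]

theorem qgSeq_le_qgSeq {M : ℕ} {q x y : ℝ} (hq : 1 < q) (h : x ≤ y) :
    toLex (qgSeq M q x) ≤ toLex (qgSeq M q y) := by
  by_contra! hlt
  obtain ⟨t, ht, hlt⟩ := lex_lt_iff.1 hlt
  have hle : ∀ i ≤ t, qgOrbit M q x i ≤ qgOrbit M q y i := by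
    intro i
    induction i with
    | zero => intro _; exact h
    | succ i ih =>
      intro hi
      have h1 := ht i (by omega)
      have h2 := ih (by omega)
      simp only [qgSeq] at h1
      rw [qgOrbit, qgOrbit, h1]
      have := mul_le_mul_of_nonneg_left h2 (by linarith : 0 ≤ q)
      linarith
  exact absurd hlt (not_lt.2 (qgDigit_mono hq (hle t le_rfl)))

/-- Existence of the quasi-greedy expansion of `1`. -/
theorem exists_parry {M : ℕ} {q : ℝ} (hq : 1 < q) (hqM : q ≤ M + 1) :
    ∃ c, Parry M c ∧ val q c = 1 := by
  have hb : ∀ n, 0 < qgOrbit M q 1 n ∧ qgOrbit M q 1 n ≤ 1 := by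
    intro n
    induction n with
    | zero => simp [qgOrbit]
    | succ n ih =>
      have h := qgDigit_bounds (M := M) hq ih.1
      refine ⟨h.1, ?_⟩
      rw [qgOrbit]
      rcases h.2 with h2 | h2
      · exact h2
      · rw [h2]
        have := mul_le_mul_of_nonneg_left ih.2 (by linarith : 0 ≤ q)
        linarith
  have hv := val_shift_eq_of_orbit (qgSeq_digits M q 1) hq (fun n => (hb n).1.le)
    (fun n => (hb n).2) fun n => rfl
  refine ⟨qgSeq M q 1, ⟨qgSeq_digits M q 1, fun n => ?_, fun n => ?_⟩, ?_⟩
  · by_contra! h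
    have h0 : val q (shift n (qgSeq M q 1)) = 0 := by
      rw [val]
      convert tsum_zero with i
      simp [shift, h (n + i) (by omega)]
    rw [hv] at h0
    exact (hb n).1.ne' h0
  · have : shift n (qgSeq M q 1) = qgSeq M q (qgOrbit M q 1 n) := by
      funext i
      rw [shift, qgSeq, qgOrbit_shift, qgSeq]
    rw [this]
    exact qgSeq_le_qgSeq hq (hb n).2
  · have := hv 0
    rwa [shift_zero] at this

/-- Below base `M + 1`, every interior point has a doubly infinite expansion. -/
theorem exists_doublyInf {M : ℕ} {q x : ℝ} (hq : 1 < q) (hqM : q < M + 1) (hx : 0 < x)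
    (hxM : x < M / (q - 1)) :
    ∃ c, Digits M c ∧ InfNonzero c ∧ InfNonzero (reflect M c) ∧ val q c = x := by
  have hq1 : 0 < q - 1 := by linarith
  have hθ : 1 < (M : ℝ) / (q - 1) := by rw [lt_div_iff₀ hq1]; linarith
  have hfix : q * (M / (q - 1)) - M = M / (q - 1) := by field_simp; ring
  have hb : ∀ n, 0 < qgOrbit M q x n ∧ qgOrbit M q x n < M / (q - 1) := by
    intro n
    induction n with
    | zero => exact ⟨hx, hxM⟩
    | succ n ih =>
      have h := qgDigit_bounds (M := M) hq ih.1
      refine ⟨h.1, ?_⟩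
      rw [qgOrbit]
      rcases h.2 with h2 | h2
      · linarith
      · rw [h2]
        have := mul_lt_mul_of_pos_left ih.2 (by linarith : 0 < q)
        linarith
  have hv := val_shift_eq_of_orbit (qgSeq_digits M q x) hq (fun n => (hb n).1.le)
    (fun n => (hb n).2.le) fun n => rfl
  have hz : ∀ e : ℕ → ℕ, ∀ n, (∀ i, n ≤ i → e i = 0) → val q (shift n e) = 0 := by
    intro e n h
    rw [val]
    convert tsum_zero with i
    simp [shift, h (n + i) (by omega)]
  refine ⟨qgSeq M q x, qgSeq_digits M q x, fun n => ?_, fun n => ?_, ?_⟩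
  · by_contra! h
    have h0 := hz _ n h
    rw [hv] at h0
    exact (hb n).1.ne' h0
  · by_contra! h
    have h0 := hz _ n h
    rw [← reflect_shift, val_reflect hq ((qgSeq_digits M q x).shift n), hv] at h0
    linarith [(hb n).2]
  · have := hv 0
    rwa [shift_zero] at this

/-! ### Lexicographic criteria for membership in `𝒰` and `𝒱` -/

/-- The underlying sequence of natural numbers. -/
def toNatSeq {M : ℕ} (c : DigitSeq M) : ℕ → ℕ := fun i => (c i : ℕ)

/-- A bounded sequence as a digit sequence. -/
def Digits.toSeq {M : ℕ} {c : ℕ → ℕ} (hc : Digits M c) : DigitSeq M :=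
  fun i => ⟨c i, Nat.lt_succ_of_le (hc i)⟩

theorem toNatSeq_digits {M : ℕ} (c : DigitSeq M) : Digits M (toNatSeq c) :=
  fun i => Nat.le_of_lt_succ (c i).2

theorem toNatSeq_injective {M : ℕ} : Function.Injective (toNatSeq (M := M)) := by
  intro c e h
  funext i
  exact Fin.ext (congrFun h i)

theorem isExpansion_iff {M : ℕ} {q x : ℝ} (hq : 1 < q) {c : DigitSeq M} :
    IsExpansion M q x c ↔ val q (toNatSeq c) = x :=
  ⟨fun h => h.tsum_eq, fun h => h ▸ hasSum_val hq (toNatSeq_digits c)⟩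

theorem isExpansion_toSeq {M : ℕ} {q x : ℝ} (hq : 1 < q) {c : ℕ → ℕ} (hc : Digits M c) :
    IsExpansion M q x hc.toSeq ↔ val q c = x := isExpansion_iff hq

theorem toNatSeq_rev {M : ℕ} (c : DigitSeq M) :
    toNatSeq (fun i => Fin.rev (c i)) = reflect M (toNatSeq c) := by
  funext i
  simp [toNatSeq, reflect, Fin.val_rev]

theorem isInfiniteSeq_iff {M : ℕ} {c : DigitSeq M} :
    IsInfiniteSeq c ↔ InfNonzero (toNatSeq c) ∨ ∀ i, toNatSeq c i = 0 := by
  have h0 : ∀ i, toNatSeq c i = 0 ↔ c i = 0 := fun i => Fin.val_eq_zero_iff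
  simp only [IsInfiniteSeq, InfNonzero, ne_eq, h0]

theorem isDoublyInfiniteSeq_toSeq {M : ℕ} {c : ℕ → ℕ} (hc : Digits M c) (h1 : InfNonzero c)
    (h2 : InfNonzero (reflect M c)) : IsDoublyInfiniteSeq hc.toSeq := by
  refine ⟨isInfiniteSeq_iff.2 (Or.inl h1), isInfiniteSeq_iff.2 (Or.inl ?_)⟩
  rw [toNatSeq_rev]
  exact h2

theorem exists_first_ne {c e : ℕ → ℕ} (h : c ≠ e) : ∃ t, (∀ i < t, c i = e i) ∧ c t ≠ e t := by
  have h1 : ∃ t, c t ≠ e t := by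
    by_contra! h2
    exact h (funext h2)
  classical
  exact ⟨Nat.find h1, fun i hi => not_not.1 (Nat.find_min h1 hi), Nat.find_spec h1⟩

section

variable {M : ℕ} {q : ℝ} {α : ℕ → ℕ}

/-- If the orbit of `1` along `α` stays strictly between `M / (q - 1) - 1` and `1`, no other digit
can ever be chosen. -/
theorem mem_basesU_of_val (hq : 1 < q) (hqM : q ≤ M + 1) (hα : Digits M α) (h1 : val q α = 1)
    (hlt : ∀ n, val q (shift (n + 1) α) < 1)
    (hgt : ∀ n, M / (q - 1) - 1 < val q (shift (n + 1) α)) : q ∈ basesU M := by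
  refine ⟨⟨hq, hqM⟩, hα.toSeq, (isExpansion_toSeq hq hα).2 h1, fun c hc => ?_⟩
  replace hc := (isExpansion_iff hq).1 hc
  by_contra hne
  have hne' : toNatSeq c ≠ α := fun h => hne (toNatSeq_injective h)
  obtain ⟨t, ht, hne'⟩ := exists_first_ne hne'
  have hcd := toNatSeq_digits c
  have h := val_sub_val' hq hcd hα ht
  have hq0 : 0 < q ^ (t + 1) := by positivity
  rw [hc, h1, sub_self, eq_comm, div_eq_zero_iff, or_iff_left hq0.ne'] at h
  have a1 := val_nonneg (c := shift (t + 1) (toNatSeq c)) hq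
  have a2 := val_le hq (hcd.shift (t + 1))
  rcases Nat.lt_or_gt_of_ne hne' with h2 | h2
  · have : (toNatSeq c t : ℝ) + 1 ≤ α t := by exact_mod_cast h2
    linarith [hgt t]
  · have : (α t : ℝ) + 1 ≤ toNatSeq c t := by exact_mod_cast h2
    linarith [hlt t]

theorem mem_basesV_of_val (hq : 1 < q) (hqM : q ≤ M + 1) (hα : Digits M α) (h1 : val q α = 1)
    (hinf : InfNonzero α) (hinf' : InfNonzero (reflect M α))
    (hle : ∀ n, val q (shift (n + 1) α) ≤ 1)
    (hge : ∀ n, M / (q - 1) - 1 ≤ val q (shift (n + 1) α)) : q ∈ basesV M := by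
  refine ⟨⟨hq, hqM⟩, hα.toSeq, ⟨(isExpansion_toSeq hq hα).2 h1,
    isDoublyInfiniteSeq_toSeq hα hinf hinf'⟩, fun c ⟨hc, hc2⟩ => ?_⟩
  replace hc := (isExpansion_iff hq).1 hc
  by_contra hne
  have hne' : toNatSeq c ≠ α := fun h => hne (toNatSeq_injective h)
  obtain ⟨t, ht, hne'⟩ := exists_first_ne hne'
  have hcd := toNatSeq_digits c
  have h := val_sub_val' hq hcd hα ht
  have hq0 : 0 < q ^ (t + 1) := by positivity
  rw [hc, h1, sub_self, eq_comm, div_eq_zero_iff, or_iff_left hq0.ne'] at h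
  have a1 := val_nonneg (c := shift (t + 1) (toNatSeq c)) hq
  have a2 := val_le hq (hcd.shift (t + 1))
  rcases Nat.lt_or_gt_of_ne hne' with h2 | h2
  · have h3 : (toNatSeq c t : ℝ) + 1 ≤ α t := by exact_mod_cast h2
    have h4 := val_reflect hq (hcd.shift (t + 1))
    have h5 := eq_zero_of_val_eq_zero hq (Digits.reflect M (shift (t + 1) (toNatSeq c)))
      (by linarith [hge t])
    rcases isInfiniteSeq_iff.1 hc2.2 with h6 | h6
    · rw [toNatSeq_rev] at h6
      obtain ⟨i, hi, h7⟩ := h6 (t + 1)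
      have := h5 (i - (t + 1))
      rw [reflect_shift, shift, show t + 1 + (i - (t + 1)) = i by omega] at this
      exact h7 this
    · have h7 := h6 t
      rw [toNatSeq_rev, reflect] at h7
      have := hα t
      omega
  · have h3 : (α t : ℝ) + 1 ≤ toNatSeq c t := by exact_mod_cast h2
    have h5 := eq_zero_of_val_eq_zero hq (hcd.shift (t + 1)) (by linarith [hle t])
    rcases isInfiniteSeq_iff.1 hc2.1 with h6 | h6
    · obtain ⟨i, hi, h7⟩ := h6 (t + 1)
      have := h5 (i - (t + 1))
      rw [shift, show t + 1 + (i - (t + 1)) = i by omega] at this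
      exact h7 this
    · have h7 := h6 t
      omega

theorem Parry.val_shift_le (hα : Parry M α) (hq : 1 < q) (h1 : val q α = 1) (n : ℕ) :
    val q (shift n α) ≤ 1 :=
  val_le_one hq hα.digits hα.digits h1 hα.shift_le n

theorem Parry.val_shift_lt (hα : Parry M α) (hq : 1 < q) (h1 : val q α = 1) {n : ℕ}
    (hlt : toLex (shift n α) < toLex α) : val q (shift n α) < 1 :=
  val_lt_one hq (hα.digits.shift n) hα.digits h1 hα.inf
    (fun k => by rw [shift_shift]; exact hα.shift_le _) hlt

theorem reflect_shift_le (hα : Digits M α) (h : ∀ n, toLex (reflect M α) ≤ toLex (shift n α))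
    (n : ℕ) : toLex (reflect M (shift n α)) ≤ toLex α := by
  have := reflect_le_reflect (hα.shift n) (h n)
  rwa [reflect_reflect hα] at this

theorem Parry.le_val_shift (hα : Parry M α) (hq : 1 < q) (h1 : val q α = 1)
    (h : ∀ n, toLex (reflect M α) ≤ toLex (shift n α)) (n : ℕ) :
    M / (q - 1) - 1 ≤ val q (shift n α) := by
  have h2 := val_le_one hq (Digits.reflect M α) hα.digits h1
    (fun k => by rw [← reflect_shift]; exact reflect_shift_le hα.digits h k) n
  rw [← reflect_shift, val_reflect hq (hα.digits.shift n)] at h2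
  linarith

theorem Parry.lt_val_shift (hα : Parry M α) (hq : 1 < q) (h1 : val q α = 1)
    (h : ∀ n, toLex (reflect M α) ≤ toLex (shift n α)) {n : ℕ}
    (hlt : toLex (reflect M α) < toLex (shift n α)) :
    M / (q - 1) - 1 < val q (shift n α) := by
  have h2 := val_lt_one hq (Digits.reflect M (shift n α)) hα.digits h1 hα.inf
    (fun k => by
      rw [← reflect_shift, shift_shift]; exact reflect_shift_le hα.digits h _)
    (by
      have := reflect_lt_reflect (hα.digits.shift n) hlt
      rwa [reflect_reflect hα.digits] at this)
  rw [val_reflect hq (hα.digits.shift n)] at h2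
  linarith

theorem Parry.mem_basesU (hα : Parry M α) (hq : 1 < q) (hqM : q ≤ M + 1) (h1 : val q α = 1)
    (h0 : toLex (reflect M α) < toLex α)
    (hlt : ∀ n, toLex (shift (n + 1) α) < toLex α)
    (hgt : ∀ n, toLex (reflect M α) < toLex (shift (n + 1) α)) : q ∈ basesU M := by
  have hge : ∀ n, toLex (reflect M α) ≤ toLex (shift n α) := by
    rintro (_ | n)
    · rw [shift_zero]; exact h0.le
    · exact (hgt n).le
  exact mem_basesU_of_val hq hqM hα.digits h1 (fun n => hα.val_shift_lt hq h1 (hlt n))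
    fun n => hα.lt_val_shift hq h1 hge (hgt n)

theorem Parry.infNonzero_reflect (hα : Parry M α) (hq : 1 < q) (hqM : q < M + 1)
    (h1 : val q α = 1) : InfNonzero (reflect M α) := by
  intro n
  by_contra! h
  have h2 : val q (reflect M (shift n α)) = 0 := by
    rw [val]
    convert tsum_zero with i
    have := h (n + i) (by omega)
    rw [reflect_shift, shift, this]
    simp
  rw [val_reflect hq (hα.digits.shift n)] at h2
  have h3 := hα.val_shift_le hq h1 n
  have : 1 < (M : ℝ) / (q - 1) := by rw [lt_div_iff₀ (by linarith)]; linarith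
  linarith

theorem Parry.mem_basesV (hα : Parry M α) (hq : 1 < q) (hqM : q < M + 1) (h1 : val q α = 1)
    (hge : ∀ n, toLex (reflect M α) ≤ toLex (shift n α)) : q ∈ basesV M :=
  mem_basesV_of_val hq hqM.le hα.digits h1 hα.inf (hα.infNonzero_reflect hq hqM h1)
    (fun _ => hα.val_shift_le hq h1 _) fun _ => hα.le_val_shift hq h1 hge _

/-- The sequence obtained from `α` by lowering the digit `n` by one and replacing the tail after
it by `d`. -/
def lower (α : ℕ → ℕ) (n : ℕ) (d : ℕ → ℕ) : ℕ → ℕ :=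
  fun i => if i < n then α i else if i = n then α n - 1 else d (i - (n + 1))

theorem lower_digits (hα : Digits M α) {d : ℕ → ℕ} (hd : Digits M d) (n : ℕ) :
    Digits M (lower α n d) := by
  intro i
  unfold lower
  have := hα i
  have := hα n
  have := hd (i - (n + 1))
  split_ifs <;> omega

theorem shift_lower (α : ℕ → ℕ) (n : ℕ) (d : ℕ → ℕ) : shift (n + 1) (lower α n d) = d := by
  funext i
  simp only [shift, lower]
  rw [if_neg (by omega), if_neg (by omega), show n + 1 + i - (n + 1) = i by omega]

theorem InfNonzero.of_shift {c : ℕ → ℕ} {n : ℕ} (h : InfNonzero (Univoque.shift n c)) :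
    InfNonzero c := by
  intro m
  obtain ⟨i, hi, h⟩ := h m
  exact ⟨n + i, by omega, h⟩

theorem val_lower (hq : 1 < q) (hα : Digits M α) {d : ℕ → ℕ} (hd : Digits M d) {n : ℕ}
    (hn : α n ≠ 0) (hdv : val q d = val q (shift (n + 1) α) + 1) :
    val q (lower α n d) = val q α := by
  have h := val_sub_val' hq (lower_digits hα hd n) hα (t := n)
    (fun i hi => by simp [lower, hi])
  rw [shift_lower, hdv] at h
  have h2 : (lower α n d n : ℝ) = α n - 1 := by
    simp only [lower, lt_irrefl, if_false, if_true]
    rw [Nat.cast_sub (by omega)]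
    simp
  rw [h2, show (α n : ℝ) - 1 - α n + (val q (shift (n + 1) α) + 1) - val q (shift (n + 1) α) = 0 by
    ring, zero_div] at h
  linarith

theorem lower_ne (hn : α n ≠ 0) (d : ℕ → ℕ) : lower α n d ≠ α := by
  intro h
  have := congrFun h n
  simp only [lower, lt_irrefl, if_false, if_true] at this
  omega

/-- For a base in `𝒱`, after a nonzero digit of the quasi-greedy expansion the tail is at least
the reflection; otherwise that digit could be lowered to obtain a second expansion. -/
theorem reflect_le_shift_of_mem_basesV (hα : Parry M α) (hqM : q < M + 1) (h1 : val q α = 1)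
    (hV : q ∈ basesV M) {n : ℕ} (hn : α n ≠ 0) :
    toLex (reflect M α) ≤ toLex (shift (n + 1) α) := by
  have hq : 1 < q := hV.1.1
  have hinf' := hα.infNonzero_reflect hq hqM h1
  by_contra! hlt
  have hge : M / (q - 1) - 1 ≤ val q (shift (n + 1) α) := by
    by_contra! hlt'
    obtain ⟨d, hd, hd1, hd2, hdv⟩ := exists_doublyInf (x := val q (shift (n + 1) α) + 1) hq hqM
      (by linarith [val_nonneg (c := shift (n + 1) α) hq]) (by linarith)
    have hv := val_lower hq hα.digits hd hn hdv
    have hdig := lower_digits hα.digits hd n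
    have := hV.2.unique (y₁ := hdig.toSeq) (y₂ := hα.digits.toSeq)
      ⟨(isExpansion_toSeq hq _).2 (hv.trans h1), isDoublyInfiniteSeq_toSeq _
        (InfNonzero.of_shift (n := n + 1) (by rwa [shift_lower]))
        (InfNonzero.of_shift (n := n + 1) (by rwa [← reflect_shift, shift_lower]))⟩
      ⟨(isExpansion_toSeq hq _).2 h1, isDoublyInfiniteSeq_toSeq _ hα.inf hinf'⟩
    exact lower_ne hn d (congrArg toNatSeq this)
  have h2 := reflect_lt_reflect (Digits.reflect M α) hlt
  rw [reflect_reflect hα.digits] at h2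
  obtain ⟨t, ht, h3⟩ := lex_lt_iff.1 h2
  have hdig := Digits.reflect M (shift (n + 1) α)
  have h4 := val_sub_val' hq hα.digits hdig ht
  rw [h1, val_reflect hq (hα.digits.shift _)] at h4
  have h5 : 0 < val q (shift (t + 1) (reflect M (shift (n + 1) α))) := by
    rw [reflect_shift, shift_shift]
    exact hinf'.val_pos hq (Digits.reflect M α) _
  have h6 := hα.val_shift_le hq h1 (t + 1)
  have h7 : (α t : ℝ) + 1 ≤ reflect M (shift (n + 1) α) t := by exact_mod_cast h3
  have h8 : 0 < q ^ (t + 1) := by positivity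
  have h9 : ((α t : ℝ) - reflect M (shift (n + 1) α) t + val q (shift (t + 1) α) -
      val q (shift (t + 1) (reflect M (shift (n + 1) α)))) / q ^ (t + 1) < 0 :=
    div_neg_of_neg_of_pos (by linarith) h8
  linarith

theorem basesU_subset_basesV (hU : q ∈ basesU M) (hqM : q < M + 1) : q ∈ basesV M := by
  have hq : 1 < q := hU.1.1
  obtain ⟨α, hα, h1⟩ := exists_parry hq hU.1.2
  refine ⟨hU.1, hα.digits.toSeq, ⟨(isExpansion_toSeq hq _).2 h1, isDoublyInfiniteSeq_toSeq _ hα.inf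
    (hα.infNonzero_reflect hq hqM h1)⟩, fun c hc => ?_⟩
  exact hU.2.unique hc.1 ((isExpansion_toSeq hq hα.digits).2 h1)

theorem reflect_lt_shift_of_mem_basesU (hα : Parry M α) (hqM : q < M + 1) (h1 : val q α = 1)
    (hU : q ∈ basesU M) {n : ℕ} (hn : α n ≠ 0) :
    toLex (reflect M α) < toLex (shift (n + 1) α) := by
  have hq : 1 < q := hU.1.1
  refine (reflect_le_shift_of_mem_basesV hα hqM h1 (basesU_subset_basesV hU hqM) hn).lt_of_ne ?_
  intro heq
  have h2 := val_reflect hq hα.digits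
  rw [toLex_inj.1 heq, h1] at h2
  have hd : Digits M fun _ => M := fun _ => le_rfl
  have hv := val_lower hq hα.digits hd hn (by
    rw [h2, sub_add_cancel]
    exact (hasSum_const_digit M hq).tsum_eq)
  have := hU.2.unique (y₁ := (lower_digits hα.digits hd n).toSeq) (y₂ := hα.digits.toSeq)
    ((isExpansion_toSeq hq _).2 (hv.trans h1)) ((isExpansion_toSeq hq _).2 h1)
  exact lower_ne hn (fun _ => M) (congrArg toNatSeq this)

end

/-! ### Admissible words, doubling and the Thue–Morse type limit -/

/-- The first `n` digits of `c` form an admissible word `v`: no proper suffix of `v` exceeds the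
prefix of the same length, and every suffix, `v` itself included, is strictly larger than the
reflection of that prefix. -/
structure Good (M : ℕ) (c : ℕ → ℕ) (n : ℕ) : Prop where
  pos : 0 < n
  digits : Digits M c
  upper : ∀ j < n, (∀ s, j + s < n → c (j + s) = c s) ∨
    ∃ t, j + t < n ∧ (∀ s < t, c (j + s) = c s) ∧ c (j + t) < c t
  lower : ∀ j < n, ∃ t, j + t < n ∧ (∀ s < t, c (j + s) = M - c s) ∧ M - c t < c (j + t)

/-- The periodic sequence `(c_0 ⋯ c_{n-2} (c_{n-1} - 1))^∞`. -/
def per (c : ℕ → ℕ) (n : ℕ) : ℕ → ℕ := fun i => if i % n = n - 1 then c (n - 1) - 1 else c (i % n)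

/-- The word of length `2 * n` consisting of the first `n` digits of `c` followed by their
reflection with the last digit raised by one, continued by zeros. -/
def dbl (M : ℕ) (c : ℕ → ℕ) (n : ℕ) : ℕ → ℕ := fun i =>
  if i < n then c i else if i < 2 * n - 1 then M - c (i - n)
  else if i = 2 * n - 1 then M - c (n - 1) + 1 else 0

theorem lt_of_agree {c e : ℕ → ℕ} {n : ℕ} (h : ∀ i < n, c i = e i)
    (hlt : toLex (shift n c) < toLex (shift n e)) : toLex c < toLex e := by
  obtain ⟨t, h1, h2⟩ := lex_lt_iff.1 hlt
  refine lex_lt_iff.2 ⟨n + t, fun i hi => ?_, h2⟩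
  by_cases hin : i < n
  · exact h i hin
  · have := h1 (i - n) (by omega)
    rwa [shift, shift, show n + (i - n) = i by omega] at this

theorem le_prefix {x y : ℕ → ℕ} (h : toLex x ≤ toLex y) (k : ℕ) :
    (∀ s < k, x s = y s) ∨ ∃ t < k, (∀ s < t, x s = y s) ∧ x t < y t := by
  rcases h.lt_or_eq with h | h
  · obtain ⟨t, h1, h2⟩ := lex_lt_iff.1 h
    by_cases hk : t < k
    · exact Or.inr ⟨t, hk, h1, h2⟩
    · exact Or.inl fun s hs => h1 s (by omega)
  · rw [toLex_inj.1 h]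
    exact Or.inl fun _ _ => rfl

namespace Good

variable {M : ℕ} {c : ℕ → ℕ} {n : ℕ}

theorem le_first (h : Good M c n) {j : ℕ} (hj : j < n) : c j ≤ c 0 := by
  rcases h.upper j hj with h1 | ⟨t, -, h1, h2⟩
  · exact (h1 0 hj).le
  · rcases Nat.eq_zero_or_pos t with rfl | ht
    · exact h2.le
    · exact (h1 0 ht).le

theorem first (h : Good M c n) : M - c 0 < c 0 := by
  obtain ⟨t, h1, h2, h3⟩ := h.lower 0 h.pos
  rcases Nat.eq_zero_or_pos t with rfl | ht
  · exact h3
  · have a1 := h2 0 ht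
    have a2 := h.le_first (j := t) (by omega)
    rw [zero_add] at h3
    simp only [add_zero] at a1
    omega

theorem last (h : Good M c n) : M - c 0 < c (n - 1) := by
  have hp := h.pos
  obtain ⟨t, h1, -, h3⟩ := h.lower (n - 1) (by omega)
  obtain rfl : t = 0 := by omega
  exact h3

theorem congr (h : Good M c n) {e : ℕ → ℕ} (he : Digits M e) (hce : ∀ i < n, e i = c i) :
    Good M e n where
  pos := h.pos
  digits := he
  upper j hj := by
    rcases h.upper j hj with h1 | ⟨t, h1, h2, h3⟩
    · exact Or.inl fun s hs => by rw [hce _ hs, hce _ (by omega), h1 s hs]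
    · exact Or.inr ⟨t, h1, fun s hs => by
        rw [hce _ (by omega), hce _ (by omega), h2 s hs], by
        rwa [hce _ (by omega), hce _ (by omega)]⟩
  lower j hj := by
    obtain ⟨t, h1, h2, h3⟩ := h.lower j hj
    exact ⟨t, h1, fun s hs => by rw [hce _ (by omega), hce _ (by omega), h2 s hs], by
      rwa [hce _ (by omega), hce _ (by omega)]⟩

theorem dbl_digits (h : Good M c n) : Digits M (dbl M c n) := by
  intro i
  have h1 := h.last
  have h2 := h.digits i
  have h3 := h.digits (n - 1)
  simp only [dbl]
  split_ifs <;> omega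

theorem dbl_lower (h : Good M c n) (j : ℕ) (hj : j < 2 * n) :
    ∃ t, j + t < 2 * n ∧ (∀ s < t, dbl M c n (j + s) = M - dbl M c n s) ∧
      M - dbl M c n t < dbl M c n (j + t) := by
  have hp := h.pos
  by_cases hjn : j < n
  · obtain ⟨t, h1, h2, h3⟩ := h.lower j hjn
    refine ⟨t, by omega, fun s hs => ?_, ?_⟩
    · simp only [dbl, show j + s < n by omega, show s < n by omega, if_true]
      exact h2 s hs
    · simp only [dbl, show j + t < n by omega, show t < n by omega, if_true]
      exact h3
  · -- the suffix is the reflection of a suffix of the word, with its last digit raised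
    rcases h.upper (j - n) (by omega) with h1 | ⟨t, h1, h2, h3⟩
    · refine ⟨2 * n - 1 - j, by omega, fun s hs => ?_, ?_⟩
      · have := h1 s (by omega)
        simp only [dbl, show ¬ j + s < n by omega, show j + s < 2 * n - 1 by omega,
          show s < n by omega, if_true, if_false]
        rw [show j + s - n = j - n + s by omega, this]
      · have := h1 (2 * n - 1 - j) (by omega)
        rw [show j - n + (2 * n - 1 - j) = n - 1 by omega] at this
        rw [show j + (2 * n - 1 - j) = 2 * n - 1 by omega]
        simp only [dbl, show ¬ 2 * n - 1 < n by omega, show ¬ 2 * n - 1 < 2 * n - 1 by omega,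
          show 2 * n - 1 - j < n by omega, if_true, if_false]
        omega
    · refine ⟨t, by omega, fun s hs => ?_, ?_⟩
      · have := h2 s hs
        simp only [dbl, show ¬ j + s < n by omega, show j + s < 2 * n - 1 by omega,
          show s < n by omega, if_true, if_false]
        rw [show j + s - n = j - n + s by omega, this]
      · have h4 := h.digits t
        simp only [dbl, show ¬ j + t < n by omega, show t < n by omega, if_true, if_false]
        split_ifs with a b
        · rw [show j + t - n = j - n + t by omega]
          omega
        · rw [show n - 1 = j - n + t by omega]
          omega
        · omega

theorem dbl_upper_strict (h : Good M c n) {j : ℕ} (hj0 : 0 < j) (hj : j < n) :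
    ∃ t, j + t < 2 * n ∧ (∀ s < t, dbl M c n (j + s) = dbl M c n s) ∧
      dbl M c n (j + t) < dbl M c n t := by
  rcases h.upper j hj with h1 | ⟨t, h1, h2, h3⟩
  · obtain ⟨t, a1, a2, a3⟩ := h.lower (n - j) (by omega)
    refine ⟨n - j + t, by omega, fun s hs => ?_, ?_⟩
    · by_cases hsn : j + s < n
      · simp only [dbl, hsn, show s < n by omega, if_true]
        exact h1 s hsn
      · have := a2 (s - (n - j)) (by omega)
        rw [show n - j + (s - (n - j)) = s by omega] at this
        simp only [dbl, hsn, show j + s < 2 * n - 1 by omega, show s < n by omega, if_true,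
          if_false]
        rw [this, show j + s - n = s - (n - j) by omega]
    · simp only [dbl, show ¬ j + (n - j + t) < n by omega,
        show j + (n - j + t) < 2 * n - 1 by omega, show n - j + t < n by omega, if_true, if_false]
      rwa [show j + (n - j + t) - n = t by omega]
  · refine ⟨t, by omega, fun s hs => ?_, ?_⟩
    · simp only [dbl, show j + s < n by omega, show s < n by omega, if_true]
      exact h2 s hs
    · simp only [dbl, show j + t < n by omega, show t < n by omega, if_true]
      exact h3

theorem dbl (h : Good M c n) : Good M (dbl M c n) (2 * n) where
  pos := by have := h.pos; omega
  digits := h.dbl_digits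
  lower := h.dbl_lower
  upper j hj := by
    have hp := h.pos
    rcases Nat.eq_zero_or_pos j with rfl | hj0
    · exact Or.inl fun s _ => by rw [zero_add]
    by_cases hjn : j < n
    · exact Or.inr (h.dbl_upper_strict hj0 hjn)
    · obtain ⟨t, h1, h2, h3⟩ := h.lower (j - n) (by omega)
      have key : ∀ s, j + s < 2 * n - 1 → Univoque.dbl M c n (j + s) = M - c (j - n + s) := by
        intro s hs
        simp only [Univoque.dbl, show ¬ j + s < n by omega, hs, if_true, if_false]
        rw [show j + s - n = j - n + s by omega]
      have key2 : ∀ s, j + s < 2 * n → Univoque.dbl M c n s = c s := by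
        intro s hs
        simp only [Univoque.dbl, show s < n by omega, if_true]
      have hag : ∀ s < t, Univoque.dbl M c n (j + s) = Univoque.dbl M c n s := by
        intro s hs
        rw [key s (by omega), key2 s (by omega), h2 s hs]
        have := h.digits s
        omega
      have hd := h.digits t
      by_cases ht : j + t < 2 * n - 1
      · refine Or.inr ⟨t, by omega, hag, ?_⟩
        rw [key t ht, key2 t (by omega)]
        have := h.digits (j - n + t)
        omega
      · have hlast : Univoque.dbl M c n (j + t) = M - c (n - 1) + 1 := by
          rw [show j + t = 2 * n - 1 by omega]
          simp [Univoque.dbl, show ¬ 2 * n - 1 < n by omega]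
        rw [show j - n + t = n - 1 by omega] at h3
        by_cases heq : M - c (n - 1) + 1 = c t
        · refine Or.inl fun s hs => ?_
          rcases Nat.lt_or_ge s t with hst | hst
          · exact hag s hst
          · obtain rfl : s = t := by omega
            rw [hlast, key2 _ hs, heq]
        · refine Or.inr ⟨t, by omega, hag, ?_⟩
          rw [hlast, key2 t (by omega)]
          have := h.digits (n - 1)
          omega

theorem per_shift_lt (h : Good M c n) {j : ℕ} (hj0 : 0 < j) (hj : j < n) :
    ∃ t, j + t < n ∧ (∀ s < t, per c n (j + s) = per c n s) ∧ per c n (j + t) < per c n t := by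
  have key : ∀ s, s < n - 1 → per c n s = c s := by
    intro s hs
    simp only [per, Nat.mod_eq_of_lt (show s < n by omega), show ¬ s = n - 1 by omega, if_false]
  have hl : per c n (n - 1) = c (n - 1) - 1 := by
    simp [per, Nat.mod_eq_of_lt (show n - 1 < n by omega)]
  have hlast := h.last
  rcases h.upper j hj with h1 | ⟨t, h1, h2, h3⟩
  · refine ⟨n - 1 - j, by omega, fun s hs => ?_, ?_⟩
    · rw [key _ (by omega), key _ (by omega), h1 s (by omega)]
    · have := h1 (n - 1 - j) (by omega)
      rw [show j + (n - 1 - j) = n - 1 by omega] at this ⊢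
      rw [hl, key _ (by omega)]
      omega
  · refine ⟨t, h1, fun s hs => ?_, ?_⟩
    · rw [key _ (by omega), key _ (by omega), h2 s hs]
    · rw [key t (by omega)]
      rcases Nat.lt_or_ge (j + t) (n - 1) with h4 | h4
      · rwa [key _ h4]
      · rw [show j + t = n - 1 by omega] at h3 ⊢
        rw [hl]
        omega

end Good

theorem per_add (c : ℕ → ℕ) (n i : ℕ) : per c n (n + i) = per c n i := by
  simp [per]

theorem shift_per (c : ℕ → ℕ) (n : ℕ) : shift n (per c n) = per c n := funext (per_add c n)

theorem per_mod (c : ℕ → ℕ) (n i : ℕ) : per c n (i % n) = per c n i := by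
  simp [per]

theorem shift_mod_per (c : ℕ → ℕ) (n j : ℕ) : shift (j % n) (per c n) = shift j (per c n) := by
  funext i
  rw [shift, shift, ← per_mod, Nat.mod_add_mod, per_mod]

theorem per_digits {M : ℕ} {c : ℕ → ℕ} (hc : Digits M c) (n : ℕ) : Digits M (per c n) := by
  intro i
  have := hc (n - 1)
  have := hc (i % n)
  unfold per
  split_ifs <;> omega

namespace Good

variable {M : ℕ} {c : ℕ → ℕ} {n : ℕ}

theorem shift_per_lt (h : Good M c n) {j : ℕ} (hj : j % n ≠ 0) :
    toLex (shift j (per c n)) < toLex (per c n) := by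
  rw [← shift_mod_per]
  obtain ⟨t, -, h1, h2⟩ := h.per_shift_lt (Nat.pos_of_ne_zero hj) (Nat.mod_lt _ h.pos)
  exact lex_lt_iff.2 ⟨t, h1, h2⟩

theorem shift_per_le (h : Good M c n) (j : ℕ) : toLex (shift j (per c n)) ≤ toLex (per c n) := by
  by_cases hj : j % n = 0
  · rw [← shift_mod_per, hj, shift_zero]
  · exact (h.shift_per_lt hj).le

theorem parry_per (h : Good M c n) (h0 : per c n 0 ≠ 0) : Parry M (per c n) where
  digits := per_digits h.digits n
  inf m := ⟨n * m, Nat.le_mul_of_pos_left m h.pos, by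
    rwa [← per_mod, Nat.mul_mod_right]⟩
  shift_le := h.shift_per_le

theorem per_eq (_ : Good M c n) {i : ℕ} (hi : i < n - 1) : per c n i = c i := by
  simp only [per, Nat.mod_eq_of_lt (show i < n by omega), show ¬ i = n - 1 by omega, if_false]

theorem per_last (h : Good M c n) : per c n (n - 1) = c (n - 1) - 1 := by
  have := h.pos
  simp [per, Nat.mod_eq_of_lt (show n - 1 < n by omega)]

theorem per_lt_of_agree (h : Good M c n) {e : ℕ → ℕ} (he : ∀ i < n, e i = c i) :
    toLex (per c n) < toLex e := by
  have := h.pos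
  refine lex_lt_iff.2 ⟨n - 1, fun i hi => ?_, ?_⟩
  · rw [h.per_eq hi, he i (by omega)]
  · rw [h.per_last, he _ (by omega)]
    have := h.last
    omega

theorem per_dbl_add (h : Good M c n) (i : ℕ) :
    per (Univoque.dbl M c n) (2 * n) (n + i) = M - per (Univoque.dbl M c n) (2 * n) i := by
  have hp := h.pos
  have hlast := h.last
  have key : ∀ r < n, per (Univoque.dbl M c n) (2 * n) r = c r := by
    intro r hr
    rw [h.dbl.per_eq (by omega)]
    simp [Univoque.dbl, hr]
  have key2 : ∀ r < n, per (Univoque.dbl M c n) (2 * n) (n + r) = M - c r := by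
    intro r hr
    rcases Nat.lt_or_ge (n + r) (2 * n - 1) with h1 | h1
    · rw [h.dbl.per_eq h1]
      simp [Univoque.dbl, h1]
    · rw [show n + r = 2 * n - 1 by omega, h.dbl.per_last, show r = n - 1 by omega]
      simp [Univoque.dbl, show ¬ 2 * n - 1 < n by omega]
  rw [← per_mod _ _ (n + i), ← per_mod _ _ i, ← Nat.add_mod_mod]
  have hr : i % (2 * n) < 2 * n := Nat.mod_lt _ (by omega)
  generalize i % (2 * n) = r at hr
  rcases Nat.lt_or_ge r n with h1 | h1
  · rw [Nat.mod_eq_of_lt (by omega), key2 r h1, key r h1]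
  · obtain ⟨s, rfl⟩ := Nat.exists_eq_add_of_le h1
    rw [show n + (n + s) = 2 * n + s by ring, Nat.add_mod_left, Nat.mod_eq_of_lt (by omega),
      key s (by omega), key2 s (by omega)]
    have := h.digits s
    omega

theorem reflect_per_dbl (h : Good M c n) :
    reflect M (per (Univoque.dbl M c n) (2 * n)) = shift n (per (Univoque.dbl M c n) (2 * n)) := by
  funext i
  rw [shift, h.per_dbl_add, reflect]

theorem parry_per_dbl (h : Good M c n) : Parry M (per (Univoque.dbl M c n) (2 * n)) := by
  refine h.dbl.parry_per ?_
  have := h.pos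
  rw [h.dbl.per_eq (by omega), Univoque.dbl, if_pos h.pos]
  have := h.first
  omega

theorem reflect_per_dbl_le (h : Good M c n) (j : ℕ) :
    toLex (reflect M (per (Univoque.dbl M c n) (2 * n))) ≤
      toLex (shift j (per (Univoque.dbl M c n) (2 * n))) := by
  have hd := per_digits h.dbl_digits (2 * n)
  have h1 := reflect_le_reflect hd (h.dbl.shift_per_le (n + j))
  rwa [← shift_shift, ← h.reflect_per_dbl, ← reflect_shift, reflect_reflect (hd.shift j)] at h1

end Good

/-- The words obtained by iterated doubling; the `m`th one has length `2 ^ m * n`. -/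
def words (M : ℕ) (c : ℕ → ℕ) (n : ℕ) : ℕ → ℕ → ℕ
  | 0 => c
  | m + 1 => dbl M (words M c n m) (2 ^ m * n)

/-- The limit of the iterated doublings of a word. -/
def tau (M : ℕ) (c : ℕ → ℕ) (n : ℕ) : ℕ → ℕ := fun i => words M c n i i

theorem words_add (M : ℕ) (c : ℕ → ℕ) (n m r : ℕ) {i : ℕ} (hi : i < 2 ^ m * n) :
    words M c n (m + r) i = words M c n m i := by
  induction r with
  | zero => rfl
  | succ r ih =>
    rw [← ih, ← add_assoc, words, dbl, if_pos]
    refine hi.trans_le (Nat.mul_le_mul_right _ (Nat.pow_le_pow_right (by norm_num) (by omega)))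

theorem lt_two_pow_mul {n : ℕ} (hn : 0 < n) (i : ℕ) : i < 2 ^ i * n :=
  Nat.lt_two_pow_self.trans_le (Nat.le_mul_of_pos_right _ hn)

theorem tau_eq {M : ℕ} {c : ℕ → ℕ} {n m : ℕ} (hn : 0 < n) {i : ℕ} (hi : i < 2 ^ m * n) :
    tau M c n i = words M c n m i := by
  rw [tau, ← words_add M c n i m (lt_two_pow_mul hn i), ← words_add M c n m i hi, add_comm]

/-- Doubling a word does not change the limit. -/
theorem words_dbl (M : ℕ) (c : ℕ → ℕ) (n m : ℕ) :
    words M (dbl M c n) (2 * n) m = words M c n (m + 1) := by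
  induction m with
  | zero => simp [words]
  | succ m ih =>
    change dbl M (words M (dbl M c n) (2 * n) m) (2 ^ m * (2 * n)) =
      dbl M (words M c n (m + 1)) (2 ^ (m + 1) * n)
    rw [ih, pow_succ, mul_assoc]

theorem tau_dbl {M : ℕ} {c : ℕ → ℕ} {n : ℕ} (hn : 0 < n) :
    tau M (dbl M c n) (2 * n) = tau M c n := by
  funext i
  rw [tau, words_dbl, tau_eq hn (m := i + 1)]
  exact (lt_two_pow_mul hn i).trans_le
    (Nat.mul_le_mul_right _ (Nat.pow_le_pow_right (by norm_num) (by omega)))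

theorem words_congr {M : ℕ} {c e : ℕ → ℕ} {n : ℕ} (h : ∀ i < n, c i = e i) (m : ℕ) :
    ∀ i < 2 ^ m * n, words M c n m i = words M e n m i := by
  induction m with
  | zero => simpa [words] using h
  | succ m ih =>
    intro i hi
    have h2 : 2 ^ (m + 1) * n = 2 * (2 ^ m * n) := by rw [pow_succ]; ring
    rw [h2] at hi
    simp only [words, dbl]
    split_ifs with a1 a2 a3
    · exact ih i a1
    · rw [ih _ (by omega)]
    · rw [ih _ (by omega)]
    · rfl

theorem tau_congr {M : ℕ} {c e : ℕ → ℕ} {n : ℕ} (hn : 0 < n) (h : ∀ i < n, c i = e i) :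
    tau M c n = tau M e n :=
  funext fun i => words_congr h i i (lt_two_pow_mul hn i)

namespace Good

variable {M : ℕ} {c : ℕ → ℕ} {n : ℕ}

theorem words (h : Good M c n) (m : ℕ) : Good M (words M c n m) (2 ^ m * n) := by
  induction m with
  | zero => simpa [Univoque.words] using h
  | succ m ih => rw [pow_succ', mul_assoc]; exact ih.dbl

theorem tau_digits (h : Good M c n) : Digits M (tau M c n) := fun i => (h.words i).digits i

theorem shift_tau_lt (h : Good M c n) {j : ℕ} (hj : 0 < j) :
    toLex (shift j (tau M c n)) < toLex (tau M c n) := by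
  obtain ⟨t, h1, h2, h3⟩ := (h.words j).dbl_upper_strict hj (lt_two_pow_mul h.pos j)
  have key : ∀ i, i < 2 * (2 ^ j * n) →
      tau M c n i = Univoque.dbl M (Univoque.words M c n j) (2 ^ j * n) i :=
    fun i hi => tau_eq h.pos (m := j + 1) (by rw [pow_succ', mul_assoc]; exact hi)
  refine lex_lt_iff.2 ⟨t, fun s hs => ?_, ?_⟩
  · rw [shift, key _ (by omega), key _ (by omega), h2 s hs]
  · rw [shift, key _ (by omega), key _ (by omega)]
    exact h3

theorem reflect_tau_lt (h : Good M c n) (j : ℕ) :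
    toLex (reflect M (tau M c n)) < toLex (shift j (tau M c n)) := by
  obtain ⟨t, h1, h2, h3⟩ := (h.words j).lower j (lt_two_pow_mul h.pos j)
  have key : ∀ i, i < 2 ^ j * n → tau M c n i = Univoque.words M c n j i :=
    fun i hi => tau_eq h.pos hi
  refine lex_lt_iff.2 ⟨t, fun s hs => ?_, ?_⟩
  · rw [shift, reflect, key _ (by omega), key _ (by omega), h2 s hs]
  · rw [shift, reflect, key _ (by omega), key _ (by omega)]
    exact h3

theorem parry_tau (h : Good M c n) : Parry M (tau M c n) where
  digits := h.tau_digits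
  inf j := by
    obtain ⟨t, -, h1⟩ := lex_lt_iff.1 (h.reflect_tau_lt j)
    exact ⟨j + t, by omega, Nat.ne_of_gt (Nat.zero_lt_of_lt h1)⟩
  shift_le j := by
    rcases Nat.eq_zero_or_pos j with rfl | hj
    · rw [shift_zero]
    · exact (h.shift_tau_lt hj).le

theorem tau_agree (h : Good M c n) {i : ℕ} (hi : i < n) : tau M c n i = c i :=
  tau_eq h.pos (m := 0) (by simpa using hi)

/-- The base of the limit sequence belongs to `𝒰`; it is a de Vries–Komornik number. -/
theorem base_tau_mem (h : Good M c n) {q : ℝ} (hq : 1 < q) (hqM : q ≤ M + 1)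
    (h1 : val q (tau M c n) = 1) : q ∈ basesU M :=
  h.parry_tau.mem_basesU hq hqM h1 (by simpa using h.reflect_tau_lt 0)
    (fun _ => h.shift_tau_lt (by omega)) fun _ => h.reflect_tau_lt _

/-- A sequence that starts with the word and continues with at most its own reflection lies below
the limit of the doublings. -/
theorem lt_tau (h : Good M c n) {α : ℕ → ℕ} (hα : Digits M α) (hag : ∀ i < n, α i = c i)
    (hle : toLex (shift n α) ≤ toLex (reflect M α)) : toLex α < toLex (tau M c n) := by
  by_contra hge
  replace hge := not_lt.1 hge
  refine absurd hge (not_le.2 (lt_of_agree (n := n)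
    (fun i hi => (hag i hi).trans (h.tau_agree hi).symm) ?_))
  exact hle.trans_lt ((reflect_le_reflect hα hge).trans_lt (h.reflect_tau_lt n))

end Good

namespace Parry

variable {M : ℕ} {α : ℕ → ℕ}

theorem upper (hα : Parry M α) (n : ℕ) : ∀ j < n, (∀ s, j + s < n → α (j + s) = α s) ∨
    ∃ t, j + t < n ∧ (∀ s < t, α (j + s) = α s) ∧ α (j + t) < α t := by
  intro j hj
  rcases le_prefix (hα.shift_le j) (n - j) with h | ⟨t, h1, h2, h3⟩
  · exact Or.inl fun s hs => h s (by omega)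
  · exact Or.inr ⟨t, by omega, h2, h3⟩

/-- Cutting a quasi-greedy sequence at the first place where the tail drops to its reflection
gives an admissible word. -/
theorem good_of_first (hα : Parry M α) {n : ℕ} (hn : 0 < n)
    (hlt : ∀ j < n, toLex (reflect M α) < toLex (shift j α))
    (hle : toLex (shift n α) ≤ toLex (reflect M α)) : Good M α n where
  pos := hn
  digits := hα.digits
  upper := hα.upper n
  lower j hj := by
    obtain ⟨t, h1, h2⟩ := lex_lt_iff.1 (hlt j hj)
    by_cases ht : j + t < n
    · exact ⟨t, ht, fun s hs => (h1 s hs).symm, h2⟩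
    · exfalso
      have h3 : toLex (shift (n - j) (reflect M α)) < toLex (shift n α) := by
        refine lex_lt_iff.2 ⟨t - (n - j), fun s hs => ?_, ?_⟩
        · have := h1 (n - j + s) (by omega)
          rw [shift, shift, this, shift, ← add_assoc, show j + (n - j) = n by omega]
        · rw [shift, shift, show n - j + (t - (n - j)) = t by omega,
            show n + (t - (n - j)) = j + t by omega]
          exact h2
      have h4 := reflect_le_reflect hα.digits (hα.shift_le (n - j))
      rw [reflect_shift] at h4
      exact absurd (h4.trans_lt (h3.trans_le hle)) (lt_irrefl _)

theorem exists_good_prefix (hα : Parry M α)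
    (hlt : ∀ j, toLex (reflect M α) < toLex (shift j α)) (m : ℕ) : ∃ n, m < n ∧ Good M α n := by
  choose t ht1 ht2 using fun j => lex_lt_iff.1 (hlt j)
  simp only [reflect, shift] at ht1 ht2
  obtain ⟨N, hN⟩ : ∃ N, ∀ j ≤ m, j + t j < N := by
    refine ⟨(Finset.range (m + 1)).sup (fun j => j + t j) + 1, fun j hj => ?_⟩
    have := Finset.le_sup (f := fun j => j + t j) 
      (Finset.mem_range.2 (by omega : j < m + 1))
    omega
  have hmN : m < N := by have := hN m le_rfl; omega
  by_cases hg : ∀ j < N, j + t j < N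
  · exact ⟨N, hmN, by omega, hα.digits, hα.upper N,
      fun j hj => ⟨t j, hg j hj, fun s hs => (ht1 j s hs).symm, ht2 j⟩⟩
  · -- cut at the first suffix that is a reflected prefix up to the place `N`
    push Not at hg
    classical
    obtain ⟨hjN, hj⟩ := Nat.find_spec hg
    have hmin : ∀ i < Nat.find hg, i + t i < N := by
      intro i hi
      by_contra hcon
      exact Nat.find_min hg hi ⟨by omega, by omega⟩
    set j := Nat.find hg
    have hjm : m < j := by
      by_contra hcon
      have := hN j (by omega)
      omega
    refine ⟨j, hjm, by omega, hα.digits, hα.upper j, fun i hi => ⟨t i, ?_,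
      fun s hs => (ht1 i s hs).symm, ht2 i⟩⟩
    by_contra hcon
    have hiN := hmin i hi
    refine absurd (hα.shift_le (j - i)) (not_le.2 (lex_lt_iff.2 ⟨i + t i - j, fun s hs => ?_, ?_⟩))
    · have a1 := ht1 i (j - i + s) (by omega)
      have a2 := ht1 j s (by omega)
      rw [show i + (j - i + s) = j + s by omega] at a1
      have a3 := hα.digits s
      have a4 := hα.digits (j - i + s)
      rw [shift]
      omega
    · have a1 := ht2 i
      have a2 := ht1 j (i + t i - j) (by omega)
      rw [show j + (i + t i - j) = i + t i by omega] at a2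
      have a3 := hα.digits (t i)
      have a4 := hα.digits (i + t i - j)
      rw [shift, show j - i + (i + t i - j) = t i by omega]
      omega

theorem mem_closure_basesU (hα : Parry M α) {q : ℝ} (hq : 1 < q) (h1 : val q α = 1)
    (hlt : ∀ j, toLex (reflect M α) < toLex (shift j α)) : q ∈ closure (basesU M) := by
  rw [Metric.mem_closure_iff]
  intro ε hε
  obtain ⟨n, hn⟩ := exists_agree_imp_base_close hα hq h1 hε
  obtain ⟨k, hk, hg⟩ := hα.exists_good_prefix hlt n
  obtain ⟨q', h2, h3, h4⟩ := hg.parry_tau.exists_base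
  refine ⟨q', hg.base_tau_mem h2 h3 h4, ?_⟩
  rw [dist_comm, Real.dist_eq]
  exact hn _ q' hg.parry_tau h2 h4 fun i hi => hg.tau_agree (by omega)

end Parry

/-! ### The bases of `𝒱` in a gap of `closure 𝒰` -/

theorem shift_le_of_agree {c e : ℕ → ℕ} {n : ℕ} (h : ∀ i < n, c i = e i)
    (hle : toLex c ≤ toLex e) : toLex (shift n c) ≤ toLex (shift n e) := by
  by_contra hcon
  exact absurd hle (not_le.2 (lt_of_agree (fun i hi => (h i hi).symm) (not_le.1 hcon)))

theorem eq_of_agree {c e : ℕ → ℕ} {n : ℕ} (h : ∀ i < n, c i = e i)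
    (heq : shift n c = shift n e) : c = e := by
  funext i
  by_cases hi : i < n
  · exact h i hi
  · have := congrFun heq (i - n)
    rwa [shift, shift, show n + (i - n) = i by omega] at this

section

variable {M : ℕ} {c α : ℕ → ℕ} {n : ℕ}

/-- A quasi-greedy sequence whose prefix of length `n` is below the word is at most the periodic
continuation of the word with its last digit lowered. -/
theorem Parry.le_per (hα : Parry M α) (h : Good M c n) {t : ℕ} (ht : t < n)
    (hag : ∀ i < t, α i = c i) (hlt : α t < c t) : toLex α ≤ toLex (per c n) := by
  by_contra hcon
  obtain ⟨r, h1, h2⟩ := lex_lt_iff.1 (not_le.1 hcon)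
  have hγ : ∀ i < t, per c n i = α i := fun i hi => by rw [h.per_eq (by omega), hag i hi]
  have hγt : α t ≤ per c n t := by
    by_cases htn : t = n - 1
    · rw [htn, h.per_last, ← htn]; omega
    · rw [h.per_eq (by omega)]; exact hlt.le
  have hrn : n ≤ r := by
    by_contra hrn
    rcases lt_trichotomy r t with h3 | h3 | h3
    · have := hγ r h3; omega
    · subst h3; omega
    · have h4 := h1 t h3
      by_cases htn : t = n - 1
      · omega
      · rw [h.per_eq (by omega)] at h4; omega
  -- the first excess over the periodic sequence moves `n` places to the left
  refine absurd (hα.shift_le n) (not_le.2 (lex_lt_iff.2 ⟨r - n, fun s hs => ?_, ?_⟩))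
  · rw [shift, ← h1 s (by omega), ← h1 (n + s) (by omega), per_add]
  · have := h.pos
    rw [shift, ← h1 (r - n) (by omega), ← per_add, show n + (r - n) = r by omega]
    exact h2

theorem Parry.exists_block (hα : Parry M α) (h : Good M c n) (hag : ∀ i < n, α i = c i)
    (hlt : toLex α < toLex (tau M c n)) :
    ∃ m, (∀ i < 2 ^ m * n, α i = words M c n m i) ∧
      toLex α ≤ toLex (per (words M c n (m + 1)) (2 ^ (m + 1) * n)) := by
  obtain ⟨t, h1, h2⟩ := lex_lt_iff.1 hlt
  have htn : n ≤ t := by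
    by_contra htn
    rw [h.tau_agree (by omega), hag t (by omega)] at h2
    exact lt_irrefl _ h2
  obtain ⟨m, hm1, hm2⟩ : ∃ m, 2 ^ m * n ≤ t ∧ t < 2 ^ (m + 1) * n := by
    have hex : ∃ k, t < 2 ^ k * n := ⟨t, lt_two_pow_mul h.pos t⟩
    classical
    have hs := Nat.find_spec hex
    rcases hk : Nat.find hex with _ | m
    · rw [hk] at hs; simp at hs; omega
    · exact ⟨m, not_lt.1 (Nat.find_min hex (by omega)), by rwa [hk] at hs⟩
  refine ⟨m, fun i hi => ?_, hα.le_per (h.words (m + 1)) hm2 (fun i hi => ?_) ?_⟩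
  · rw [h1 i (by omega), tau_eq h.pos hi]
  · rw [h1 i hi, tau_eq h.pos (m := m + 1) (by omega)]
  · rwa [← tau_eq h.pos hm2]

theorem words_succ (M : ℕ) (c : ℕ → ℕ) (n m : ℕ) :
    words M c n (m + 1) = dbl M (words M c n m) (2 ^ m * n) := rfl

theorem Good.reflect_per_words (h : Good M c n) (m : ℕ) :
    reflect M (per (Univoque.words M c n (m + 1)) (2 ^ (m + 1) * n)) =
      shift (2 ^ m * n) (per (Univoque.words M c n (m + 1)) (2 ^ (m + 1) * n)) := by
  rw [words_succ, show 2 ^ (m + 1) * n = 2 * (2 ^ m * n) by ring]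
  exact (h.words m).reflect_per_dbl

theorem Good.parry_words (h : Good M c n) (m : ℕ) :
    Parry M (per (Univoque.words M c n (m + 1)) (2 ^ (m + 1) * n)) := by
  rw [words_succ, show 2 ^ (m + 1) * n = 2 * (2 ^ m * n) by ring]
  exact (h.words m).parry_per_dbl

theorem Good.reflect_words_le (h : Good M c n) (m j : ℕ) :
    toLex (reflect M (per (Univoque.words M c n (m + 1)) (2 ^ (m + 1) * n))) ≤
      toLex (shift j (per (Univoque.words M c n (m + 1)) (2 ^ (m + 1) * n))) := by
  rw [words_succ, show 2 ^ (m + 1) * n = 2 * (2 ^ m * n) by ring]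
  exact (h.words m).reflect_per_dbl_le j

theorem Good.per_words_agree (h : Good M c n) {m k : ℕ} (hmk : m < k) :
    ∀ i < 2 ^ m * n, per (Univoque.words M c n k) (2 ^ k * n) i = Univoque.words M c n m i := by
  intro i hi
  obtain ⟨r, rfl⟩ := Nat.exists_eq_add_of_lt hmk
  have h1 : 2 * 2 ^ m * n ≤ 2 ^ (m + r + 1) * n := by
    refine Nat.mul_le_mul_right _ ?_
    rw [← pow_succ']
    exact Nat.pow_le_pow_right (by norm_num) (by omega)
  rw [mul_assoc] at h1
  rw [(h.words _).per_eq (by omega), add_assoc, words_add _ _ _ _ _ hi]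

theorem Good.per_words_lt (h : Good M c n) {m k : ℕ} (hmk : m < k) :
    toLex (per (Univoque.words M c n m) (2 ^ m * n)) <
      toLex (per (Univoque.words M c n k) (2 ^ k * n)) :=
  (h.words m).per_lt_of_agree (h.per_words_agree hmk)

theorem Good.per_words_lt_tau (h : Good M c n) (m : ℕ) :
    toLex (per (Univoque.words M c n m) (2 ^ m * n)) < toLex (tau M c n) :=
  (h.words m).per_lt_of_agree fun _ hi => tau_eq h.pos hi

theorem shift_block_le (h : Good M c n) {m : ℕ} (h1 : ∀ i < 2 ^ m * n, α i = words M c n m i)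
    (h2 : toLex α ≤ toLex (per (words M c n (m + 1)) (2 ^ (m + 1) * n))) :
    toLex (shift (2 ^ m * n) α) ≤
      toLex (reflect M (per (words M c n (m + 1)) (2 ^ (m + 1) * n))) ∧
    toLex (reflect M (per (words M c n (m + 1)) (2 ^ (m + 1) * n))) ≤ toLex (reflect M α) := by
  constructor
  · rw [h.reflect_per_words]
    refine shift_le_of_agree (fun i hi => ?_) h2
    rw [h1 i hi, h.per_words_agree (Nat.lt_succ_self m) i hi]
  · exact reflect_le_reflect (per_digits (h.words (m + 1)).digits _) h2

theorem block_last_ne (h : Good M c n) {m : ℕ} (h1 : ∀ i < 2 ^ m * n, α i = words M c n m i) :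
    α (2 ^ m * n - 1) ≠ 0 := by
  have := (h.words m).pos
  rw [h1 _ (by omega)]
  have := (h.words m).last
  omega

theorem notMem_basesU (hα : Parry M α) (h : Good M c n) (hag : ∀ i < n, α i = c i)
    (hlt : toLex α < toLex (tau M c n)) {y : ℝ} (hy : y < M + 1) (hv : val y α = 1) :
    y ∉ basesU M := by
  intro hU
  obtain ⟨m, h1, h2⟩ := hα.exists_block h hag hlt
  have h3 := reflect_lt_shift_of_mem_basesU hα hy hv hU (block_last_ne h h1)
  rw [Nat.sub_add_cancel (h.words m).pos] at h3
  obtain ⟨h4, h5⟩ := shift_block_le h h1 h2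
  exact absurd (h3.trans_le (h4.trans h5)) (lt_irrefl _)

theorem eq_per_of_mem_basesV (hα : Parry M α) (h : Good M c n) (hag : ∀ i < n, α i = c i)
    (hlt : toLex α < toLex (tau M c n)) {y : ℝ} (hy : y < M + 1) (hv : val y α = 1)
    (hV : y ∈ basesV M) : ∃ m, α = per (words M c n (m + 1)) (2 ^ (m + 1) * n) := by
  obtain ⟨m, h1, h2⟩ := hα.exists_block h hag hlt
  have h3 := reflect_le_shift_of_mem_basesV hα hy hv hV (block_last_ne h h1)
  rw [Nat.sub_add_cancel (h.words m).pos] at h3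
  obtain ⟨h4, h5⟩ := shift_block_le h h1 h2
  refine ⟨m, eq_of_agree (n := 2 ^ m * n) (fun i hi => ?_) ?_⟩
  · rw [h1 i hi, h.per_words_agree (Nat.lt_succ_self m) i hi]
  · rw [← h.reflect_per_words]
    exact toLex_inj.1 (le_antisymm h4 (h5.trans h3))

theorem agree_of_per_lt (hα : Parry M α) (h : Good M c n) (hgt : toLex (per c n) < toLex α)
    (hlt : toLex α < toLex (tau M c n)) : ∀ i < n, α i = c i := by
  obtain ⟨t, h1, h2⟩ := lex_lt_iff.1 hlt
  have htn : n ≤ t := by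
    by_contra htn
    rw [h.tau_agree (by omega)] at h2
    refine absurd hgt (not_lt.2 (hα.le_per h (t := t) (by omega) (fun i hi => ?_) h2))
    rw [h1 i hi, h.tau_agree (by omega)]
  intro i hi
  rw [h1 i (by omega), h.tau_agree hi]

theorem Parry.le_first (hα : Parry M α) (i : ℕ) : α i ≤ α 0 := by
  have := Pi.apply_le_of_toLex (i := 0) (hα.shift_le i) (by simp)
  simpa [shift] using this

theorem Parry.first_ne (hα : Parry M α) : α 0 ≠ 0 := by
  obtain ⟨i, -, hi⟩ := hα.inf 0
  have := hα.le_first i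
  omega

theorem notMem_basesU_of_first (hα : Parry M α) (h0 : 2 * α 0 ≤ M) {y : ℝ} (hy : y < M + 1)
    (hv : val y α = 1) : y ∉ basesU M := by
  intro hU
  obtain ⟨t, -, h1⟩ := lex_lt_iff.1 (reflect_lt_shift_of_mem_basesU hα hy hv hU hα.first_ne)
  have h2 := hα.le_first t
  have h3 := hα.le_first (1 + t)
  simp only [reflect, shift, zero_add] at h1
  omega

theorem notMem_basesV_of_first (hα : Parry M α) (h0 : 2 * α 0 < M) {y : ℝ} (hy : y < M + 1)
    (hv : val y α = 1) : y ∉ basesV M := by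
  intro hV
  have h1 := Pi.apply_le_of_toLex (i := 0) (reflect_le_shift_of_mem_basesV hα hy hv hV hα.first_ne)
    (by simp)
  have h3 := hα.le_first 1
  simp only [reflect, shift, zero_add, add_zero] at h1
  omega

/-- If lowering the last digit of an admissible word makes a tail drop to the reflection, then
the suffix concerned is exactly a reflected prefix. -/
theorem Good.reflect_suffix (h : Good M c n) {j : ℕ} (hj0 : 0 < j) (hj : j < n)
    (hle : toLex (shift j (per c n)) ≤ toLex (reflect M (per c n))) :
    ∀ s, j + s < n → per c n (j + s) = M - per c n s := by
  obtain ⟨t, h1, h2, h3⟩ := h.lower j hj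
  have hγ : ∀ s < t, per c n (j + s) = M - per c n s := by
    intro s hs
    rw [h.per_eq (by omega), h.per_eq (by omega), h2 s hs]
  have h4 := Pi.apply_le_of_toLex (i := t) hle hγ
  have htn : j + t = n - 1 := by
    by_contra htn
    simp only [shift, reflect] at h4
    rw [h.per_eq (by omega), h.per_eq (by omega)] at h4
    omega
  intro s hs
  rcases Nat.lt_or_ge s t with hst | hst
  · exact hγ s hst
  · obtain rfl : s = t := by omega
    simp only [shift, reflect] at h4
    rw [htn, h.per_last, h.per_eq (by omega)] at h4 ⊢
    rw [htn] at h3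
    omega

/-- Every admissible prefix comes by iterated doubling from one whose periodic continuation is
strictly above its reflection, except for the one-letter words around the middle of the
alphabet. -/
theorem Good.descend (h : Good M c n) :
    ∃ k, Good M c k ∧ k ≤ n ∧ tau M c k = tau M c n ∧
      ((∀ j, toLex (reflect M (per c k)) < toLex (shift j (per c k))) ∨
        (k = 1 ∧ 2 * c 0 ≤ M + 2)) := by
  induction n using Nat.strong_induction_on with
  | _ n ih =>
  by_cases hex : ∃ j, toLex (shift j (per c n)) ≤ toLex (reflect M (per c n))
  swap
  · push Not at hex
    exact ⟨n, h, le_rfl, rfl, Or.inl hex⟩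
  have hp := h.pos
  have hf := h.first
  classical
  have hj := Nat.find_spec hex
  have hmin : ∀ i < Nat.find hex, toLex (reflect M (per c n)) < toLex (shift i (per c n)) :=
    fun i hi => not_le.1 (Nat.find_min hex hi)
  have hmin' : ∀ i, toLex (shift i (per c n)) ≤ toLex (reflect M (per c n)) → Nat.find hex ≤ i :=
    fun i hi => Nat.find_min' hex hi
  set j := Nat.find hex
  have hjn : j < n := (hmin' (j % n) (by rwa [shift_mod_per])).trans_lt (Nat.mod_lt _ hp)
  rcases Nat.eq_zero_or_pos j with hj0 | hj0
  · rw [hj0] at hj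
    have h1 := Pi.apply_le_of_toLex (i := 0) hj (by simp)
    simp only [shift, reflect, zero_add] at h1
    by_cases hn1 : n = 1
    · subst hn1
      have h2 := h.per_last
      simp only [Nat.sub_self] at h2
      exact ⟨1, h, le_rfl, rfl, Or.inr ⟨rfl, by omega⟩⟩
    · rw [h.per_eq (by omega)] at h1
      omega
  · have h0 : per c n 0 = c 0 := h.per_eq (by omega)
    have hP := h.parry_per (by omega)
    have hgj : Good M c j := (hP.good_of_first hj0 hmin hj).congr h.digits
      fun i hi => (h.per_eq (by omega)).symm
    have e1 := h.reflect_suffix hj0 hjn hj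
    have hj' : toLex (shift (n - j) (per c n)) ≤ toLex (reflect M (per c n)) := by
      have h1 := shift_le_of_agree (c := shift j (per c n)) (e := reflect M (per c n))
        (n := n - j) (fun i hi => e1 i (by omega)) hj
      rw [shift_shift, show j + (n - j) = n by omega, shift_per] at h1
      have h2 := reflect_le_reflect (Digits.shift (Digits.reflect M _) _) h1
      rwa [← reflect_shift, reflect_reflect (hP.digits.shift _)] at h2
    have e2 := h.reflect_suffix (j := n - j) (by omega) (by omega) hj'
    have hjle := hmin' _ hj'
    have hlast := h.last
    rcases hjle.lt_or_eq with hlt | heq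
    · -- the word would end in a reflected prefix preceded by a prefix, and so exceed its prefix
      exfalso
      have e3 : ∀ s < 2 * j, per c n (n - 2 * j + s) = per c n s := by
        intro s hs
        by_cases hsj : s < j
        · have a1 := e1 (n - 2 * j + s) (by omega)
          have a2 := e2 s (by omega)
          rw [show j + (n - 2 * j + s) = n - j + s by omega] at a1
          have a3 := hP.digits s
          have a4 := hP.digits (n - 2 * j + s)
          omega
        · have a1 := e1 (s - j) (by omega)
          have a2 := e2 (s - j) (by omega)
          rw [show j + (s - j) = s by omega] at a1
          rw [show n - j + (s - j) = n - 2 * j + s by omega] at a2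
          omega
      have e4 : ∀ s < 2 * j - 1, c (n - 2 * j + s) = c s := by
        intro s hs
        have := e3 s (by omega)
        rwa [h.per_eq (by omega), h.per_eq (by omega)] at this
      have e5 : c (n - 1) - 1 = c (2 * j - 1) := by
        have := e3 (2 * j - 1) (by omega)
        rwa [show n - 2 * j + (2 * j - 1) = n - 1 by omega, h.per_last, h.per_eq (by omega)] at this
      rcases h.upper (n - 2 * j) (by omega) with h1 | ⟨t, h1, h2, h3⟩
      · have := h1 (2 * j - 1) (by omega)
        rw [show n - 2 * j + (2 * j - 1) = n - 1 by omega] at this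
        omega
      · by_cases ht : t < 2 * j - 1
        · have := e4 t ht
          omega
        · rw [show n - 2 * j + t = n - 1 by omega, show t = 2 * j - 1 by omega] at h3
          omega
    · obtain ⟨k, h1, h2, h3, h4⟩ := ih j hjn hgj
      refine ⟨k, h1, h2.trans hjn.le, h3.trans ?_, h4⟩
      rw [← tau_dbl hj0, show 2 * j = n by omega]
      refine tau_congr hp fun i hi => ?_
      simp only [Univoque.dbl]
      split_ifs with a1 a2 a3
      · rfl
      · have := e1 (i - j) (by omega)
        rwa [show j + (i - j) = i by omega, h.per_eq (by omega), h.per_eq (by omega),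
          eq_comm] at this
      · have := e1 (j - 1) (by omega)
        rw [show j + (j - 1) = n - 1 by omega, h.per_last, h.per_eq (by omega)] at this
        rw [show i = n - 1 by omega]
        omega
      · omega

/-- The word that governs the gap containing the base of `α`. -/
theorem Parry.exists_gap_word (hM : 1 ≤ M) (hα : Parry M α) {q : ℝ} (hq : 1 < q)
    (hv : val q α = 1) (hx : q ∉ closure (basesU M)) :
    ∃ c n, Good M c n ∧ toLex α < toLex (tau M c n) ∧
      (((∀ i < n, α i = c i) ∧ ∀ j, toLex (reflect M (per c n)) < toLex (shift j (per c n))) ∨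
        (n = 1 ∧ 2 * c 0 ≤ M + 2)) := by
  have hex : ∃ j, toLex (shift j α) ≤ toLex (reflect M α) := by
    by_contra! hcon
    exact hx (hα.mem_closure_basesU hq hv hcon)
  classical
  have hj := Nat.find_spec hex
  have hmin : ∀ i < Nat.find hex, toLex (reflect M α) < toLex (shift i α) :=
    fun i hi => not_le.1 (Nat.find_min hex hi)
  rcases Nat.eq_zero_or_pos (Nat.find hex) with hj0 | hj0
  · rw [hj0] at hj
    have h1 := Pi.apply_le_of_toLex (i := 0) hj (by simp)
    simp only [shift, reflect, zero_add] at h1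
    have hg : Good M (fun _ => M / 2 + 1) 1 := by
      refine ⟨one_pos, fun i => by omega, fun j hj => Or.inl fun s _ => rfl, fun j hj => ?_⟩
      exact ⟨0, by omega, by simp, by omega⟩
    refine ⟨_, 1, hg, lex_lt_iff.2 ⟨0, by simp, ?_⟩, Or.inr ⟨rfl, by omega⟩⟩
    rw [hg.tau_agree one_pos]
    omega
  · have hg := hα.good_of_first hj0 hmin hj
    obtain ⟨k, h1, h2, h3, h4⟩ := hg.descend
    refine ⟨α, k, h1, ?_, h4.imp (fun h => ⟨fun _ _ => rfl, h⟩) id⟩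
    rw [h3]
    exact hg.lt_tau hα.digits (fun _ _ => rfl) hj

end

/-! ### Finite greedy expansions -/

section

variable {M : ℕ} {c : ℕ → ℕ} {n : ℕ} {q : ℝ}

/-- The first `n` digits of `c` followed by zeros. -/
def cut (c : ℕ → ℕ) (n : ℕ) : ℕ → ℕ := fun i => if i < n then c i else 0

theorem cut_digits (hc : Digits M c) (n : ℕ) : Digits M (cut c n) := by
  intro i
  have := hc i
  unfold cut
  split_ifs <;> omega

theorem val_shift_cut_of_le {i : ℕ} (hi : n ≤ i) : val q (shift i (cut c n)) = 0 := by
  rw [val]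
  convert tsum_zero with k
  simp [shift, cut, show ¬ i + k < n by omega]

theorem Good.val_shift_cut (h : Good M c n) (hq : 1 < q) (h1 : val q (per c n) = 1) {i : ℕ}
    (hi : i < n) : val q (shift i (cut c n)) = val q (shift i (per c n)) := by
  have hd := (cut_digits h.digits n).shift i
  have hd' := (per_digits h.digits n).shift i
  have hs := val_sub_val' hq hd hd' (t := n - 1 - i) (fun k hk => by
    rw [shift, shift, h.per_eq (by omega), cut, if_pos (by omega)])
  rw [shift_shift, shift_shift, show i + (n - 1 - i + 1) = n by omega, shift_per, h1,
    val_shift_cut_of_le le_rfl, shift, shift, show i + (n - 1 - i) = n - 1 by omega, h.per_last,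
    cut, if_pos (by omega)] at hs
  have hl := h.last
  rw [Nat.cast_sub (by omega)] at hs
  have : val q (shift i (cut c n)) - val q (shift i (per c n)) = 0 := by
    rw [hs]; push_cast; ring
  linarith

/-- The greedy expansion of `1` is the finite word whose lowered periodic continuation is the
quasi-greedy one. -/
theorem Good.isFiniteBeta (h : Good M c n) (hq : 1 < q) (h0 : per c n 0 ≠ 0)
    (h1 : val q (per c n) = 1) : IsFiniteBeta M q (cut_digits h.digits n).toSeq n := by
  have hP := h.parry_per h0
  have hp := h.pos
  have hl := h.last
  have hd := cut_digits h.digits n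
  have hv1 : val q (cut c n) = 1 := by
    have := h.val_shift_cut hq h1 hp
    rwa [shift_zero, shift_zero, h1] at this
  refine ⟨⟨(isExpansion_toSeq hq _).2 hv1, fun e he => ?_⟩, hp, fun hz => ?_, fun i hi => ?_⟩
  · by_contra hcon
    obtain ⟨t, h2, h3⟩ : ∃ t, (∀ i < t, hd.toSeq i = e i) ∧ hd.toSeq t < e t := not_le.1 hcon
    rw [isExpansion_iff hq] at he
    have hs := val_sub_val' hq (toNatSeq_digits e) hd (t := t)
      (fun i hi => (congrArg Fin.val (h2 i hi)).symm)
    have hq0 : 0 < q ^ (t + 1) := by positivity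
    rw [he, hv1, sub_self, eq_comm, div_eq_zero_iff, or_iff_left hq0.ne'] at hs
    have h4 : (cut c n t : ℝ) + 1 ≤ toNatSeq e t := by exact_mod_cast h3
    have h5 := val_nonneg (c := shift (t + 1) (toNatSeq e)) hq
    have h6 : val q (shift (t + 1) (cut c n)) < 1 := by
      by_cases ht : t + 1 < n
      · rw [h.val_shift_cut hq h1 ht]
        exact hP.val_shift_lt hq h1 (h.shift_per_lt (by rw [Nat.mod_eq_of_lt ht]; omega))
      · rw [val_shift_cut_of_le (by omega)]; exact one_pos
    linarith
  · have := congrArg Fin.val hz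
    simp only [Digits.toSeq, cut, show n - 1 < n by omega, if_true] at this
    simp at this
    omega
  · refine Fin.ext ?_
    simp [Digits.toSeq, cut, show ¬ i < n by omega]

theorem isFiniteBeta_one (hM : 1 ≤ M) : ∃ b, IsFiniteBeta M 1 b 1 := by
  have hd : Digits M (fun i => if i = 0 then 1 else 0) := fun i => by
    show (if i = 0 then 1 else 0) ≤ M
    split_ifs <;> omega
  refine ⟨hd.toSeq, ⟨?_, fun e he => ?_⟩, le_rfl, ?_, fun i hi => ?_⟩
  · have := hasSum_ite_eq (0 : ℕ) (1 : ℝ)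
    unfold IsExpansion
    convert this using 2 with i
    simp only [Digits.toSeq]
    split_ifs <;> simp
  · by_contra hcon
    obtain ⟨t, h2, h3⟩ : ∃ t, (∀ i < t, hd.toSeq i = e i) ∧ hd.toSeq t < e t := not_le.1 hcon
    have hs : ∀ s : Finset ℕ, ∑ i ∈ s, ((e i : ℕ) : ℝ) ≤ 1 := by
      intro s
      have := sum_le_hasSum s (fun i _ => by positivity) he
      simpa using this
    have h4 : (hd.toSeq t : ℕ) < e t := h3
    rcases Nat.eq_zero_or_pos t with rfl | ht
    · have := hs {0}
      rw [Finset.sum_singleton] at this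
      have h5 : (e 0 : ℕ) ≤ 1 := by exact_mod_cast this
      simp only [Digits.toSeq, if_true] at h4
      omega
    · have := hs {0, t}
      rw [Finset.sum_pair ht.ne] at this
      have h5 : (e 0 : ℕ) + (e t : ℕ) ≤ 1 := by exact_mod_cast this
      have h6 : (hd.toSeq 0 : ℕ) = e 0 := congrArg Fin.val (h2 0 ht)
      simp only [Digits.toSeq, if_true] at h6
      omega
  · intro hz
    have := congrArg Fin.val hz
    simp [Digits.toSeq] at this
  · refine Fin.ext ?_
    simp [Digits.toSeq, show i ≠ 0 by omega]

end

/-! ### The structure of a gap -/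

theorem connectedComponentIn_eq_Ioo {F : Set ℝ} {p r x : ℝ} (hx : x ∈ Ioo p r)
    (hsub : Ioo p r ⊆ F) (hp : p ∉ F) (hr : r ∉ F) : connectedComponentIn F x = Ioo p r := by
  apply Subset.antisymm
  · intro y hy
    have hord := (isPreconnected_connectedComponentIn (F := F) (x := x)).ordConnected
    have hxm := mem_connectedComponentIn (hsub hx)
    constructor
    · by_contra! hyp
      exact hp (connectedComponentIn_subset _ _ (hord.out hy hxm ⟨hyp, hx.1.le⟩))
    · by_contra! hyr
      exact hr (connectedComponentIn_subset _ _ (hord.out hxm hy ⟨hx.2.le, hyr⟩))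
  · exact isPreconnected_Ioo.subset_connectedComponentIn hx hsub

/-- A gap of `closure 𝒰` is governed by one admissible word: its left end has a greedy expansion
of the length of the word, and the elements of `𝒱` in the gap are the bases belonging to the
iterated doublings of the word. -/
theorem gap_structure {M : ℕ} (hM : 1 ≤ M) {q₀ q₀' : ℝ} (hgap : IsGap M q₀ q₀')
    (hodd : q₀ = 1 → Odd M) :
    ∃ c n, Good M c n ∧ (∃ b, IsFiniteBeta M q₀ b n) ∧ ∃ q : ℕ → ℝ,
      StrictMonoOn q (Ici 1) ∧ q '' Ici 1 = basesV M ∩ Ioo q₀ q₀' ∧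
      ∀ m, 1 ≤ m → 1 < q m ∧ q m < M + 1 ∧ val (q m) (per (words M c n m) (2 ^ m * n)) = 1 := by
  obtain ⟨x, ⟨⟨hx1, hxM⟩, hxU⟩, hcomp⟩ := hgap
  obtain ⟨α, hα, hαv⟩ := exists_parry hx1 hxM.le
  obtain ⟨c, n, hg, hlt, hcase⟩ := hα.exists_gap_word hM hx1 hαv hxU
  obtain ⟨r, hr1, hrM, hrv⟩ := hg.parry_tau.exists_base
  have hxr : x < r := hα.base_lt hg.parry_tau hr1 hαv hrv hlt
  have hrU : r ∈ basesU M := hg.base_tau_mem hr1 hrM hrv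
  -- the left end of the gap, with what is needed of it
  obtain ⟨p, hp1, hpx, hpF, hbeta, hsplit, hgtp⟩ : ∃ p : ℝ, 1 ≤ p ∧ p < x ∧
      (p = 1 ∨ p ∈ closure (basesU M)) ∧ ((p = 1 → Odd M) → ∃ b, IsFiniteBeta M p b n) ∧
      (∀ e : ℕ → ℕ, ∀ y, Parry M e → p < y → y < r → 1 < y → val y e = 1 →
        (∀ i < n, e i = c i) ∨ (p = 1 ∧ 2 * e 0 ≤ M)) ∧
      ∀ e : ℕ → ℕ, ∀ y, Parry M e → toLex (per c n) < toLex e → 1 < y → val y e = 1 → p < y := by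
    rcases hcase with ⟨hag, hγ⟩ | ⟨rfl, hc0⟩
    · have h0 : per c n 0 ≠ 0 := by
        have h1 := Pi.apply_le_of_toLex (i := 0) (hγ 0).le (by simp)
        simp only [shift, reflect, zero_add] at h1
        omega
      have hP := hg.parry_per h0
      obtain ⟨p, hp1, hpM, hpv⟩ := hP.exists_base
      refine ⟨p, hp1.le, hP.base_lt hα hx1 hpv hαv (hg.per_lt_of_agree hag),
        Or.inr (hP.mem_closure_basesU hp1 hpv hγ), fun _ => ⟨_, hg.isFiniteBeta hp1 h0 hpv⟩,
        fun e y he hpy hyr hy1 hev => Or.inl ?_,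
        fun e y he hlt hy1 hev => hP.base_lt he hy1 hpv hev hlt⟩
      exact agree_of_per_lt he hg (hP.lt_of_base_lt he hp1 hy1 hpv hev hpy)
        (he.lt_of_base_lt hg.parry_tau hy1 hr1 hev hrv hyr)
    · refine ⟨1, le_rfl, hx1, Or.inl rfl, fun _ => isFiniteBeta_one hM,
        fun e y he hpy hyr hy1 hev => ?_, fun _ _ _ _ hy1 _ => hy1⟩
      have h1 := Pi.apply_le_of_toLex (i := 0)
        (he.lt_of_base_lt hg.parry_tau hy1 hr1 hev hrv hyr).le (by simp)
      rw [hg.tau_agree one_pos] at h1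
      by_cases h2 : e 0 = c 0
      · left
        intro i hi
        obtain rfl : i = 0 := by omega
        exact h2
      · right
        exact ⟨rfl, by omega⟩
  have hnoU : ∀ y ∈ Ioo p r, y ∉ basesU M := by
    rintro y ⟨hpy, hyr⟩
    have hy1 : 1 < y := hp1.trans_lt hpy
    have hyM : y < M + 1 := hyr.trans_le hrM
    obtain ⟨e, he, hev⟩ := exists_parry hy1 hyM.le
    rcases hsplit e y he hpy hyr hy1 hev with h1 | ⟨-, h1⟩
    · exact notMem_basesU he hg h1 (he.lt_of_base_lt hg.parry_tau hy1 hr1 hev hrv hyr) hyM hev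
    · exact notMem_basesU_of_first he h1 hyM hev
  have hnoU' : Disjoint (Ioo p r) (closure (basesU M)) :=
    (Set.disjoint_left.2 hnoU).closure_right isOpen_Ioo
  have hIoo := connectedComponentIn_eq_Ioo (F := Ioo (1 : ℝ) (M + 1) \ closure (basesU M))
    (p := p) (r := r) ⟨hpx, hxr⟩
    (fun y hy => ⟨⟨hp1.trans_lt hy.1, hy.2.trans_le hrM⟩, Set.disjoint_left.1 hnoU' hy⟩)
    (fun h => hpF.elim (fun h1 => absurd h.1.1 (by rw [h1]; exact lt_irrefl _)) h.2)
    (fun h => h.2 (subset_closure hrU))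
  rw [hcomp] at hIoo
  have hne : q₀ < q₀' := by
    rw [← nonempty_Ioo, hIoo]
    exact ⟨x, hpx, hxr⟩
  obtain rfl : q₀ = p := by
    rw [← csInf_Ioo hne, hIoo, csInf_Ioo (hpx.trans hxr)]
  obtain rfl : q₀' = r := by
    rw [← csSup_Ioo hne, hIoo, csSup_Ioo (hpx.trans hxr)]
  have hbase : ∀ m, ∃ q : ℝ, 1 ≤ m →
      1 < q ∧ q ≤ M + 1 ∧ val q (per (words M c n m) (2 ^ m * n)) = 1 := by
    rintro (_ | m)
    · exact ⟨0, by omega⟩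
    · obtain ⟨q, h⟩ := (hg.parry_words m).exists_base
      exact ⟨q, fun _ => h⟩
  choose q hq using hbase
  have hPw : ∀ m, 1 ≤ m → Parry M (per (words M c n m) (2 ^ m * n)) := by
    rintro (_ | m) hm
    · omega
    · exact hg.parry_words m
  have hqr : ∀ m, 1 ≤ m → q m < q₀' := fun m hm =>
    (hPw m hm).base_lt hg.parry_tau hr1 (hq m hm).2.2 hrv (hg.per_words_lt_tau m)
  have hqp : ∀ m, 1 ≤ m → q₀ < q m := by
    intro m hm
    refine hgtp _ _ (hPw m hm) ?_ (hq m hm).1 (hq m hm).2.2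
    simpa [words] using hg.per_words_lt (m := 0) hm
  refine ⟨c, n, hg, hbeta hodd, q, ?_, ?_, fun m hm =>
    ⟨(hq m hm).1, (hqr m hm).trans_le hrM, (hq m hm).2.2⟩⟩
  · intro m hm k hk hmk
    exact (hPw m hm).base_lt (hPw k hk) (hq k hk).1 (hq m hm).2.2 (hq k hk).2.2
      (hg.per_words_lt hmk)
  · apply Subset.antisymm
    · rintro _ ⟨m, hm, rfl⟩
      refine ⟨?_, hqp m hm, hqr m hm⟩
      obtain ⟨k, rfl⟩ := Nat.exists_eq_add_of_le' (show 1 ≤ m from hm)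
      exact (hPw _ hm).mem_basesV (hq _ hm).1 ((hqr _ hm).trans_le hrM) (hq _ hm).2.2
        (hg.reflect_words_le k)
    · rintro y ⟨hyV, hpy, hyr⟩
      have hy1 : 1 < y := hyV.1.1
      have hyM : y < M + 1 := hyr.trans_le hrM
      obtain ⟨e, he, hev⟩ := exists_parry hy1 hyM.le
      rcases hsplit e y he hpy hyr hy1 hev with h1 | ⟨h2, h1⟩
      · obtain ⟨m, hm⟩ := eq_per_of_mem_basesV he hg h1
          (he.lt_of_base_lt hg.parry_tau hy1 hr1 hev hrv hyr) hyM hev hyV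
        refine ⟨m + 1, Nat.le_add_left 1 m, ?_⟩
        have h3 := hq (m + 1) (Nat.le_add_left 1 m)
        rw [← hm] at h3
        exact base_unique he h3.1 hy1 h3.2.2 hev
      · obtain ⟨k, hk⟩ := hodd h2
        exact absurd hyV (notMem_basesV_of_first he (by omega) hyM hev)

/-! ### The vertices and edges of a single graph -/

/-- The right end `M / (q - 1)` of the interval carrying the expansions in base `q`. -/
noncomputable def theta (M : ℕ) (q : ℝ) : ℝ := M / (q - 1)

/-- The data that determine the graph `𝒢(q)` for a base `q ∈ 𝒱` with `β(q)` of length `2 * h`.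
The points `X i true` are the orbit of `1` under the digits `D i true`, and `X i false` is the
reflection of `X i true`; after `h` steps the orbit is reflected, so that the points with `i < h`
exhaust the orbit. -/
structure Level (M : ℕ) (q : ℝ) (h : ℕ) (X : ℕ → Bool → ℝ) (D : ℕ → Bool → ℕ) : Prop where
  one_lt : 1 < q
  lt : q < M + 1
  theta_lt : theta M q < 2
  pos : 0 < h
  step : ∀ i s, X (i + 1) s = q * X i s - D i s
  le_one : ∀ i s, X i s ≤ 1
  flip : ∀ i s, X i (!s) = theta M q - X i s
  digit_flip : ∀ i s, D i (!s) = M - D i s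
  digit_le : ∀ i s, D i s ≤ M
  add_half : ∀ i s, X (i + h) s = X i (!s)
  digit_add_half : ∀ i s, D (i + h) s = D i (!s)
  zero : X 0 true = 1
  top : ∀ i < h, ∀ s, X i s = 1 → i = 0 ∧ s = true
  pts : pointsA M q ∪ pointsB M q = {x | ∃ i < h, ∃ s, x = X i s}

/-- The `k`th component of `(0, M / (q - 1))` minus the switch region: the points whose first
digit is necessarily `k`. -/
def InPiece (M : ℕ) (q : ℝ) (k : ℕ) (z : ℝ) : Prop :=
  k ≤ M ∧ 0 < z ∧ z < theta M q ∧ (k < M → q * z < k + 1) ∧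
    (0 < k → (k : ℝ) - 1 + theta M q < q * z)

namespace Level

variable {M : ℕ} {q : ℝ} {h : ℕ} {X : ℕ → Bool → ℝ} {D : ℕ → Bool → ℕ}

theorem theta_eq (A : Level M q h X D) : q * theta M q = theta M q + M := by
  have : q - 1 ≠ 0 := by linarith [A.one_lt]
  rw [theta]
  field_simp
  ring

theorem one_lt_theta (A : Level M q h X D) : 1 < theta M q := by
  rw [theta, lt_div_iff₀ (by linarith [A.one_lt])]
  linarith [A.lt]

theorem ge (A : Level M q h X D) (i : ℕ) (s : Bool) : theta M q - 1 ≤ X i s := by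
  have h1 := A.le_one i (!s)
  rw [A.flip] at h1
  linarith

theorem point_pos (A : Level M q h X D) (i : ℕ) (s : Bool) : 0 < X i s := by
  linarith [A.ge i s, A.one_lt_theta]

theorem zero_false (A : Level M q h X D) : X 0 false = theta M q - 1 := by
  have := A.flip 0 true
  rwa [A.zero] at this

theorem half_true (A : Level M q h X D) : X h true = theta M q - 1 := by
  have := A.add_half 0 true
  rw [zero_add] at this
  rw [this, ← A.zero_false]; rfl

theorem half_false (A : Level M q h X D) : X h false = 1 := by
  have := A.add_half 0 false
  rw [zero_add] at this
  rw [this, ← A.zero]; rfl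

theorem add_period (A : Level M q h X D) (i : ℕ) (s : Bool) : X (i + 2 * h) s = X i s := by
  rw [two_mul, ← add_assoc, A.add_half, A.add_half, Bool.not_not]

theorem bot (A : Level M q h X D) {i : ℕ} (hi : i < h) {s : Bool} (hX : X i s = theta M q - 1) :
    i = 0 ∧ s = false := by
  have h1 := A.top i hi (!s) (by rw [A.flip, hX]; ring)
  exact ⟨h1.1, by simpa using h1.2⟩

theorem lt_one (A : Level M q h X D) {i : ℕ} (hi : i < h) (hi0 : i ≠ 0) (s : Bool) : X i s < 1 :=
  (A.le_one i s).lt_of_ne fun hX => hi0 (A.top i hi s hX).1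

theorem gt_bot (A : Level M q h X D) {i : ℕ} (hi : i < h) (hi0 : i ≠ 0) (s : Bool) :
    theta M q - 1 < X i s :=
  (A.ge i s).lt_of_ne fun hX => hi0 (A.bot hi hX.symm).1

theorem mul_eq (A : Level M q h X D) (i : ℕ) (s : Bool) : q * X i s = D i s + X (i + 1) s := by
  rw [A.step]; ring

theorem lt_iff_mul_lt (A : Level M q h X D) {x y : ℝ} : x < y ↔ q * x < q * y :=
  (mul_lt_mul_iff_right₀ (by linarith [A.one_lt])).symm

theorem lt_of_digit (A : Level M q h X D) {i j : ℕ} {s t : Bool} (hD : D i s < D j t) :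
    X i s < X j t := by
  rw [A.lt_iff_mul_lt, A.mul_eq, A.mul_eq]
  have h1 : (D i s : ℝ) + 1 ≤ D j t := by exact_mod_cast hD
  linarith [A.le_one (i + 1) s, A.ge (j + 1) t, A.one_lt_theta]

theorem lt_of_digit_eq (A : Level M q h X D) {i j : ℕ} {s t : Bool} (hD : D i s = D j t)
    (hX : X (i + 1) s < X (j + 1) t) : X i s < X j t := by
  rw [A.lt_iff_mul_lt, A.mul_eq, A.mul_eq, hD]
  linarith

theorem lt_cases (A : Level M q h X D) {i j : ℕ} {s t : Bool} (hX : X i s < X j t) :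
    D i s < D j t ∨ (D i s = D j t ∧ X (i + 1) s < X (j + 1) t) := by
  rcases lt_trichotomy (D i s) (D j t) with h1 | h1 | h1
  · exact Or.inl h1
  · rw [A.lt_iff_mul_lt, A.mul_eq, A.mul_eq, h1] at hX
    exact Or.inr ⟨h1, by linarith⟩
  · exact absurd (A.lt_of_digit h1) hX.not_gt

theorem eq_cases (A : Level M q h X D) {i j : ℕ} {s t : Bool} (hX : X i s = X j t) :
    D i s = D j t ∧ X (i + 1) s = X (j + 1) t := by
  rcases lt_trichotomy (D i s) (D j t) with h1 | h1 | h1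
  · exact absurd hX (A.lt_of_digit h1).ne
  · refine ⟨h1, ?_⟩
    rw [A.step, A.step, h1, hX]
  · exact absurd hX (A.lt_of_digit h1).ne'

/-- The points with index below `h` are distinct: otherwise follow both orbits until the first
arrives at `1`. -/
theorem inj (A : Level M q h X D) {i j : ℕ} (hi : i < h) (hj : j < h) {s t : Bool}
    (hX : X i s = X j t) : i = j ∧ s = t := by
  wlog hij : i ≤ j generalizing i j s t
  · have := this hj hi hX.symm (by omega)
    exact ⟨this.1.symm, this.2.symm⟩
  have key : ∀ k, X (i + k) s = X (j + k) t := by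
    intro k
    induction k with
    | zero => exact hX
    | succ k ih => exact (A.eq_cases ih).2
  cases s with
  | true =>
    have h1 := key (2 * h - i)
    rw [show i + (2 * h - i) = 0 + 2 * h by omega,
      show j + (2 * h - i) = (j - i) + 2 * h by omega, A.add_period, A.add_period, A.zero] at h1
    have := A.top (j - i) (by omega) t h1.symm
    exact ⟨by omega, this.2.symm⟩
  | false =>
    have h1 := key (h - i)
    rw [show i + (h - i) = h by omega, show j + (h - i) = (j - i) + h by omega, A.half_false,
      A.add_half] at h1
    have := A.top (j - i) (by omega) _ h1.symm
    exact ⟨by omega, by simpa using this.2⟩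

theorem piece_unique (A : Level M q h X D) {k l : ℕ} {z : ℝ} (hk : InPiece M q k z)
    (hl : InPiece M q l z) : k = l := by
  have hθ := A.one_lt_theta
  have key : ∀ {k l : ℕ}, InPiece M q k z → InPiece M q l z → ¬ k < l := by
    intro k l hk hl hkl
    have h1 := hk.2.2.2.1 (hkl.trans_le hl.1)
    have h2 := hl.2.2.2.2 (by omega)
    have : (k : ℝ) + 1 ≤ l := by exact_mod_cast hkl
    linarith
  exact le_antisymm (not_lt.1 (key hl hk)) (not_lt.1 (key hk hl))

theorem switch_iff (A : Level M q h X D) {z : ℝ} :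
    z ∈ switchRegion M q ↔ ∃ j : ℕ, 1 ≤ j ∧ j ≤ M ∧ (j : ℝ) ≤ q * z ∧
      q * z ≤ j - 1 + theta M q := by
  have hq : 0 < q := by linarith [A.one_lt]
  have hq1 : 0 < q - 1 := by linarith [A.one_lt]
  have e : (M : ℝ) / (q ^ 2 - q) = theta M q / q := by
    rw [theta, div_div]; congr 1; ring
  unfold switchRegion
  simp only [mem_ofPred_eq, mem_Icc, e, ← add_div, div_le_iff₀ hq, le_div_iff₀ hq, mul_comm z q]

/-- The complement of the switch region consists of the pieces. -/
theorem exists_piece_iff (A : Level M q h X D) {z : ℝ} (h0 : 0 < z) (hz : z < theta M q) :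
    z ∉ switchRegion M q ↔ ∃ k, InPiece M q k z := by
  rw [A.switch_iff]
  constructor
  · intro hS
    have hex : ∃ k ≤ M, k = 0 ∨ (k : ℝ) - 1 + theta M q < q * z := ⟨0, Nat.zero_le _, Or.inl rfl⟩
    classical
    let P : ℕ → Prop := fun k => k = 0 ∨ (k : ℝ) - 1 + theta M q < q * z
    set k := Nat.findGreatest P M with hk
    have hkM : k ≤ M := Nat.findGreatest_le M
    have hPk : P k := Nat.findGreatest_spec (P := P) (Nat.zero_le M) (Or.inl rfl)
    refine ⟨k, hkM, h0, hz, fun hlt => ?_, fun hpos => ?_⟩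
    · have hP : ¬ P (k + 1) := Nat.findGreatest_is_greatest (P := P) (Nat.lt_succ_self k) hlt
      have h1 : q * z ≤ ((k + 1 : ℕ) : ℝ) - 1 + theta M q := by
        by_contra hcon
        exact hP (Or.inr (not_le.1 hcon))
      by_contra hcon
      exact hS ⟨k + 1, by omega, hlt, by push_cast; linarith, h1⟩
    · rcases hPk with h1 | h1
      · omega
      · exact h1
  · rintro ⟨k, hkM, -, -, h1, h2⟩ ⟨j, hj1, hjM, h3, h4⟩
    rcases Nat.lt_or_ge k j with hkj | hkj
    · have := h1 (by omega)
      have : (k : ℝ) + 1 ≤ j := by exact_mod_cast hkj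
      linarith
    · have := h2 (by omega)
      have : (j : ℝ) ≤ k := by exact_mod_cast hkj
      linarith

theorem mem_region_iff (A : Level M q h X D) {z : ℝ} :
    z ∈ graphRegion M q ↔ (∃ k, InPiece M q k z) ∧ ∀ i < h, ∀ s, z ≠ X i s := by
  unfold graphRegion
  rw [A.pts]
  constructor
  · rintro ⟨⟨h0, h1⟩, h2⟩
    rw [mem_union, not_or] at h2
    exact ⟨(A.exists_piece_iff h0 h1).1 h2.1, fun i hi s hX => h2.2 ⟨i, hi, s, hX⟩⟩
  · rintro ⟨⟨k, hk⟩, h2⟩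
    refine ⟨⟨hk.2.1, hk.2.2.1⟩, ?_⟩
    rw [mem_union, not_or]
    refine ⟨(A.exists_piece_iff hk.2.1 hk.2.2.1).2 ⟨k, hk⟩, ?_⟩
    rintro ⟨i, hi, s, hX⟩
    exact h2 i hi s hX

theorem ne_point (A : Level M q h X D) {z : ℝ} (hz : z ∈ graphRegion M q) (i : ℕ) :
    ∀ s, z ≠ X i s := by
  induction i using Nat.strong_induction_on with
  | _ i ih =>
  intro s
  rcases Nat.lt_or_ge i h with hi | hi
  · exact (A.mem_region_iff.1 hz).2 i hi s
  · obtain ⟨j, rfl⟩ := Nat.exists_eq_add_of_le' hi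
    rw [A.add_half]
    exact ih j (by have := A.pos; omega) _

theorem lt_point (A : Level M q h X D) {z : ℝ} (hz : z ∈ graphRegion M q) {i : ℕ} {s : Bool}
    (hi : ¬ X i s < z) : z < X i s :=
  (not_lt.1 hi).lt_of_ne (A.ne_point hz i s)

/-- Two points have the same code if they lie in the same piece and on the same side of every
point of the orbit. -/
def Code (M : ℕ) (q : ℝ) (h : ℕ) (X : ℕ → Bool → ℝ) (z w : ℝ) : Prop :=
  (∃ k, InPiece M q k z ∧ InPiece M q k w) ∧ ∀ i < h, ∀ s, X i s < z ↔ X i s < w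

theorem InPiece.between {k : ℕ} {z w t : ℝ} (hq : 1 < q) (hz : InPiece M q k z)
    (hw : InPiece M q k w) (h1 : z ≤ t) (h2 : t ≤ w) : InPiece M q k t := by
  have hq0 : 0 ≤ q := by linarith
  have h3 := mul_le_mul_of_nonneg_left h1 hq0
  have h4 := mul_le_mul_of_nonneg_left h2 hq0
  exact ⟨hz.1, hz.2.1.trans_le h1, h2.trans_lt hw.2.2.1,
    fun h => h4.trans_lt (hw.2.2.2.1 h), fun h => (hz.2.2.2.2 h).trans_le h3⟩

theorem not_lt_of_component (A : Level M q h X D) {z w : ℝ}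
    (hsub : uIcc z w ⊆ graphRegion M q) {k l : ℕ} (hk : InPiece M q k z) (hl : InPiece M q l w) :
    ¬ k < l := by
  intro hkl
  have hq : 0 < q := by linarith [A.one_lt]
  have hθ := A.one_lt_theta
  have h1 := hk.2.2.2.1 (hkl.trans_le hl.1)
  have h2 := hl.2.2.2.2 (by omega)
  have hkl' : (k : ℝ) + 1 ≤ l := by exact_mod_cast hkl
  have h3 : q * (((k : ℝ) + 1) / q) = k + 1 := by field_simp
  have hm : ((k : ℝ) + 1) / q ∈ uIcc z w := by
    rw [mem_uIcc]
    left
    constructor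
    · refine (A.lt_iff_mul_lt.2 ?_).le
      rwa [h3]
    · refine (A.lt_iff_mul_lt.2 ?_).le
      rw [h3]
      linarith
  have hr := (hsub hm).2
  refine hr (Or.inl (A.switch_iff.2 ⟨k + 1, by omega, by have := hl.1; omega, ?_, ?_⟩))
  · rw [h3]; push_cast; exact le_rfl
  · rw [h3]; push_cast; linarith

theorem mem_component_iff (A : Level M q h X D) {z w : ℝ} (hz : z ∈ graphRegion M q)
    (hw : w ∈ graphRegion M q) :
    w ∈ connectedComponentIn (graphRegion M q) z ↔ Code M q h X z w := by
  constructor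
  · intro hc
    have hord := (isPreconnected_connectedComponentIn (F := graphRegion M q) (x := z)).ordConnected
    have hsub : uIcc z w ⊆ graphRegion M q :=
      (hord.uIcc_subset (mem_connectedComponentIn hz) hc).trans (connectedComponentIn_subset _ _)
    obtain ⟨k, hk⟩ := (A.mem_region_iff.1 hz).1
    obtain ⟨l, hl⟩ := (A.mem_region_iff.1 hw).1
    have hkl : k = l := le_antisymm
      (not_lt.1 (A.not_lt_of_component (by rwa [uIcc_comm]) hl hk))
      (not_lt.1 (A.not_lt_of_component hsub hk hl))
    subst hkl
    refine ⟨⟨k, hk, hl⟩, fun i hi s => ?_⟩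
    have hX : X i s ∉ uIcc z w := fun hm => A.ne_point (hsub hm) i s rfl
    rw [mem_uIcc, not_or, not_and, not_and] at hX
    constructor
    · intro h1
      by_contra h2
      exact hX.2 (not_lt.1 h2) h1.le
    · intro h1
      by_contra h2
      exact hX.1 (not_lt.1 h2) h1.le
  · rintro ⟨⟨k, hk, hl⟩, hcut⟩
    refine isPreconnected_uIcc.subset_connectedComponentIn left_mem_uIcc (fun t ht => ?_)
      right_mem_uIcc
    rw [A.mem_region_iff]
    rcases mem_uIcc.1 ht with ⟨h1, h2⟩ | ⟨h1, h2⟩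
    · refine ⟨⟨k, InPiece.between A.one_lt hk hl h1 h2⟩, ?_⟩
      rintro i hi s rfl
      exact h1.not_gt ((hcut i hi s).2 (h2.lt_of_ne (A.ne_point hw i s).symm))
    · refine ⟨⟨k, InPiece.between A.one_lt hl hk h1 h2⟩, ?_⟩
      rintro i hi s rfl
      exact h1.not_gt ((hcut i hi s).1 (h2.lt_of_ne (A.ne_point hz i s).symm))

end Level

/-- The vertex containing a point of the region. -/
def vtx {M : ℕ} {q z : ℝ} (hz : z ∈ graphRegion M q) : GraphVertex M q :=
  ⟨connectedComponentIn (graphRegion M q) z, z, hz, rfl⟩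

theorem mem_vtx {M : ℕ} {q z : ℝ} (hz : z ∈ graphRegion M q) : z ∈ (vtx hz).1 :=
  mem_connectedComponentIn hz

theorem GraphVertex.exists_mem {M : ℕ} {q : ℝ} (I : GraphVertex M q) : ∃ z, z ∈ I.1 := by
  obtain ⟨I, z, hz, rfl⟩ := I
  exact ⟨z, mem_connectedComponentIn hz⟩

theorem GraphVertex.subset {M : ℕ} {q : ℝ} (I : GraphVertex M q) : I.1 ⊆ graphRegion M q := by
  obtain ⟨I, z, hz, rfl⟩ := I
  exact connectedComponentIn_subset _ _

theorem GraphVertex.eq_component {M : ℕ} {q z : ℝ} (I : GraphVertex M q) (hz : z ∈ I.1) :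
    I.1 = connectedComponentIn (graphRegion M q) z := by
  obtain ⟨I, w, hw, rfl⟩ := I
  exact connectedComponentIn_eq hz

namespace Level

variable {M : ℕ} {q : ℝ} {h : ℕ} {X : ℕ → Bool → ℝ} {D : ℕ → Bool → ℕ}

theorem mem_vertex_iff (A : Level M q h X D) {I : GraphVertex M q} {z w : ℝ} (hz : z ∈ I.1)
    (hw : w ∈ graphRegion M q) : w ∈ I.1 ↔ Code M q h X z w := by
  rw [I.eq_component hz, A.mem_component_iff (I.subset hz) hw]

theorem vertex_eq_iff (A : Level M q h X D) {I J : GraphVertex M q} {z w : ℝ} (hz : z ∈ I.1)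
    (hw : w ∈ J.1) : I = J ↔ Code M q h X z w := by
  rw [← A.mem_vertex_iff hz (J.subset hw)]
  constructor
  · rintro rfl; exact hw
  · intro hwI
    exact Subtype.ext ((I.eq_component hwI).trans (J.eq_component hw).symm)

/-- Which inverse branches `z ↦ (z + k) / q` stay in the region. -/
theorem pull_mem_iff (A : Level M q h X D) {z : ℝ} (hz : z ∈ graphRegion M q) {k : ℕ}
    (hk : k ≤ M) : (z + k) / q ∈ graphRegion M q ↔
      (k < M → z < 1) ∧ (0 < k → theta M q - 1 < z) := by
  have hq : 0 < q := by linarith [A.one_lt]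
  have hθ := A.one_lt_theta
  have hqθ := A.theta_eq
  have hmul : q * ((z + k) / q) = z + k := by field_simp
  obtain ⟨⟨l, hl⟩, -⟩ := A.mem_region_iff.1 hz
  have hz0 := hl.2.1
  have hzθ := hl.2.2.1
  constructor
  · intro hw
    obtain ⟨⟨j, hj⟩, -⟩ := A.mem_region_iff.1 hw
    have hjk : j = k := by
      rcases lt_trichotomy j k with h1 | h1 | h1
      · have h2 := hj.2.2.2.1 (by omega)
        have : (j : ℝ) + 1 ≤ k := by exact_mod_cast h1
        rw [hmul] at h2
        linarith
      · exact h1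
      · have h2 := hj.2.2.2.2 (by omega)
        have : (k : ℝ) + 1 ≤ j := by exact_mod_cast h1
        rw [hmul] at h2
        linarith
    subst hjk
    constructor
    · intro h1
      have := hj.2.2.2.1 h1
      rw [hmul] at this
      linarith
    · intro h1
      have := hj.2.2.2.2 h1
      rw [hmul] at this
      linarith
  · rintro ⟨h1, h2⟩
    have hkM : (k : ℝ) ≤ M := by exact_mod_cast hk
    refine A.mem_region_iff.2 ⟨⟨k, hk, by positivity, ?_, fun h3 => ?_, fun h3 => ?_⟩, ?_⟩
    · rw [div_lt_iff₀ hq, mul_comm, hqθ]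
      linarith
    · rw [hmul]; linarith [h1 h3]
    · rw [hmul]; linarith [h2 h3]
    · intro i hi s hX
      have h3 := A.mul_eq i s
      rw [← hX, hmul] at h3
      have h4 := A.le_one (i + 1) s
      have h5 := A.ge (i + 1) s
      have hD : D i s = k := by
        rcases lt_trichotomy (D i s) k with h6 | h6 | h6
        · have : (D i s : ℝ) + 1 ≤ k := by exact_mod_cast h6
          linarith
        · exact h6
        · have : (k : ℝ) + 1 ≤ D i s := by exact_mod_cast h6
          linarith
      rw [hD] at h3
      exact A.ne_point hz (i + 1) s (by linarith)

theorem piece_pull (A : Level M q h X D) {z : ℝ} (hz : z ∈ graphRegion M q) {k : ℕ}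
    (hk : k ≤ M) (hw : (z + k) / q ∈ graphRegion M q) : InPiece M q k ((z + k) / q) := by
  have hq : 0 < q := by linarith [A.one_lt]
  obtain ⟨h1, h2⟩ := (A.pull_mem_iff hz hk).1 hw
  have hmul : q * ((z + k) / q) = z + k := by field_simp
  obtain ⟨⟨j, hj⟩, -⟩ := A.mem_region_iff.1 hw
  exact ⟨hk, hj.2.1, hj.2.2.1, fun h3 => by rw [hmul]; linarith [h1 h3],
    fun h3 => by rw [hmul]; linarith [h2 h3]⟩

theorem pull_cut (A : Level M q h X D) {z : ℝ} (hz : z ∈ graphRegion M q) (k i : ℕ) (s : Bool) :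
    X i s < (z + k) / q ↔ D i s < k ∨ (D i s = k ∧ X (i + 1) s < z) := by
  have hq : 0 < q := by linarith [A.one_lt]
  have hmul : q * ((z + k) / q) = z + k := by field_simp
  obtain ⟨⟨l, hl⟩, -⟩ := A.mem_region_iff.1 hz
  rw [A.lt_iff_mul_lt, A.mul_eq, hmul]
  have h4 := A.le_one (i + 1) s
  have h5 := A.ge (i + 1) s
  rcases lt_trichotomy (D i s) k with h6 | h6 | h6
  · have : (D i s : ℝ) + 1 ≤ k := by exact_mod_cast h6
    simp only [h6, true_or, iff_true]
    linarith [hl.2.1]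
  · subst h6
    simp only [lt_irrefl, true_and, false_or]
    constructor <;> intro <;> linarith
  · have : (k : ℝ) + 1 ≤ D i s := by exact_mod_cast h6
    simp only [h6.not_gt, h6.ne', false_and, or_self, iff_false, not_lt]
    linarith [hl.2.2.1]

/-- An edge `I → J` with label `k` exists if and only if `I` contains `(z + k) / q`, for any
chosen `z ∈ J`. In particular `J` and `k` determine `I`. -/
theorem edge_iff (A : Level M q h X D) {I J : GraphVertex M q} {z : ℝ} (hz : z ∈ J.1)
    (k : Fin (M + 1)) :
    (univoqueGraph M q).Edge I k J ↔ (z + ((k : ℕ) : ℝ)) / q ∈ I.1 := by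
  have hq : 0 < q := by linarith [A.one_lt]
  have hk : (k : ℕ) ≤ M := Nat.le_of_lt_succ k.2
  constructor
  · intro hE
    obtain ⟨w, hw, hwz⟩ := hE hz
    simp only at hwz
    rwa [← hwz, sub_add_cancel, mul_div_cancel_left₀ _ hq.ne']
  · intro hw y hy
    refine ⟨(y + ((k : ℕ) : ℝ)) / q, ?_, by field_simp; ring⟩
    have hzF := J.subset hz
    have hyF := J.subset hy
    obtain ⟨-, hcut⟩ := (A.mem_vertex_iff hz hyF).1 hy
    have hwF := I.subset hw
    have hcond := (A.pull_mem_iff hzF hk).1 hwF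
    have htop := hcut 0 A.pos true
    have hbot := hcut 0 A.pos false
    rw [A.zero] at htop
    rw [A.zero_false] at hbot
    have hy1 := A.ne_point hyF 0 true
    rw [A.zero] at hy1
    have hyw : (y + ((k : ℕ) : ℝ)) / q ∈ graphRegion M q := by
      refine (A.pull_mem_iff hyF hk).2 ⟨fun h1 => ?_, fun h1 => hbot.1 (hcond.2 h1)⟩
      exact lt_of_le_of_ne (not_lt.1 fun h2 => (htop.2 h2).not_gt (hcond.1 h1)) hy1
    refine (A.mem_vertex_iff hw hyw).2 ⟨⟨k, A.piece_pull hzF hk hwF, A.piece_pull hyF hk hyw⟩,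
      fun i hi s => ?_⟩
    rw [A.pull_cut hzF, A.pull_cut hyF]
    have : X (i + 1) s < z ↔ X (i + 1) s < y := by
      rcases Nat.lt_or_ge (i + 1) h with h1 | h1
      · exact hcut _ h1 s
      · rw [show i + 1 = 0 + h by omega, A.add_half]
        exact hcut 0 A.pos _
    rw [this]

theorem cut_lt (A : Level M q h X D) {z : ℝ} {k : ℕ} (hk : InPiece M q k z) {i : ℕ} {s : Bool}
    (hX : X i s < z) : D i s < k ∨ (D i s = k ∧ X (i + 1) s < 1) := by
  have h0 := hk.1
  rw [A.lt_iff_mul_lt, A.mul_eq] at hX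
  have h4 := A.point_pos (i + 1) s
  rcases lt_trichotomy (D i s) k with h6 | h6 | h6
  · exact Or.inl h6
  · refine Or.inr ⟨h6, (A.le_one _ _).lt_of_ne fun h7 => ?_⟩
    rcases hk.1.lt_or_eq with h8 | h8
    · have := hk.2.2.2.1 h8
      rw [h6, h7] at hX
      linarith
    · have h9 := A.mul_eq i s
      rw [h6, h7, h8] at h9
      have h10 := mul_le_mul_of_nonneg_left (A.le_one i s) (by linarith [A.one_lt] : 0 ≤ q)
      linarith [A.lt]
  · have h7 : (k : ℝ) + 1 ≤ D i s := by exact_mod_cast h6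
    have := hk.2.2.2.1 (h6.trans_le (A.digit_le i s))
    linarith

theorem cut_gt (A : Level M q h X D) {z : ℝ} {k : ℕ} (hk : InPiece M q k z) {i : ℕ} {s : Bool}
    (hX : z < X i s) : k < D i s ∨ (D i s = k ∧ theta M q - 1 < X (i + 1) s) := by
  have hθ := A.one_lt_theta
  have hX' := hX
  rw [A.lt_iff_mul_lt, A.mul_eq] at hX
  have h4 := A.le_one (i + 1) s
  rcases lt_trichotomy (D i s) k with h6 | h6 | h6
  · have h7 : (D i s : ℝ) + 1 ≤ k := by exact_mod_cast h6
    have := hk.2.2.2.2 (by omega)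
    linarith
  · refine Or.inr ⟨h6, (A.ge _ _).lt_of_ne fun h7 => ?_⟩
    rcases Nat.eq_zero_or_pos k with h8 | h8
    · have h9 := A.mul_eq i s
      rw [h6, ← h7, h8] at h9
      have h10 := A.ge i s
      have h11 : 0 < X i s := A.point_pos i s
      have h12 : X i s < q * X i s := by
        have := mul_lt_mul_of_pos_right A.one_lt h11
        linarith
      push_cast at h9
      linarith
    · have := hk.2.2.2.2 h8
      rw [h6, ← h7] at hX
      linarith
  · exact Or.inl h6

theorem exists_mem_Ioo (A : Level M q h X D) {lo hi : ℝ} (hlt : lo < hi) {k : ℕ}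
    (hp : ∀ z ∈ Ioo lo hi, InPiece M q k z) : ∃ z ∈ graphRegion M q, lo < z ∧ z < hi := by
  have hfin : {x | ∃ i < h, ∃ s, x = X i s}.Finite := by
    refine ((Set.finite_Iio h).biUnion fun i _ => Set.finite_range (X i)).subset ?_
    rintro x ⟨i, hi, s, rfl⟩
    exact mem_biUnion hi ⟨s, rfl⟩
  obtain ⟨z, hz, hzn⟩ := ((Ioo_infinite hlt).sdiff hfin).nonempty
  exact ⟨z, A.mem_region_iff.2 ⟨⟨k, hp z hz⟩, fun i hi s hX => hzn ⟨i, hi, s, hX⟩⟩, hz.1, hz.2⟩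

/-- Every consistent choice of a piece and of a side for each point of the orbit is realized. -/
theorem exists_point (A : Level M q h X D) {k : ℕ} (hk : k ≤ M) (L : ℕ → Bool → Prop)
    (h1 : ∀ i < h, ∀ s, ∀ j < h, ∀ t, L i s → ¬ L j t → X i s < X j t)
    (h2 : ∀ i < h, ∀ s, L i s → D i s < k ∨ (D i s = k ∧ X (i + 1) s < 1))
    (h3 : ∀ i < h, ∀ s, ¬ L i s → k < D i s ∨ (D i s = k ∧ theta M q - 1 < X (i + 1) s)) :
    ∃ z ∈ graphRegion M q, InPiece M q k z ∧ ∀ i < h, ∀ s, X i s < z ↔ L i s := by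
  classical
  have hq : 0 < q := by linarith [A.one_lt]
  have hθ := A.one_lt_theta
  have hqθ := A.theta_eq
  have hkM : (k : ℝ) ≤ M := by exact_mod_cast hk
  set lf : ℝ := if k = 0 then 0 else ((k : ℝ) - 1 + theta M q) / q with hlf
  set rt : ℝ := if k = M then theta M q else ((k : ℝ) + 1) / q with hrt
  have hpiece : ∀ z, lf < z → z < rt → InPiece M q k z := by
    intro z hz1 hz2
    have hz0 : 0 < z := by
      refine lt_of_le_of_lt ?_ hz1
      rw [hlf]
      split_ifs with h0
      · exact le_rfl
      · have : (1 : ℝ) ≤ k := by exact_mod_cast Nat.one_le_iff_ne_zero.2 h0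
        exact div_nonneg (by linarith) hq.le
    refine ⟨hk, hz0, hz2.trans_le ?_, fun h0 => ?_, fun h0 => ?_⟩
    · rw [hrt]
      split_ifs with h0
      · exact le_rfl
      · have : (k : ℝ) + 1 ≤ M := by exact_mod_cast lt_of_le_of_ne hk h0
        rw [div_le_iff₀ hq, mul_comm, hqθ]
        linarith
    · rw [hrt, if_neg h0.ne, lt_div_iff₀ hq, mul_comm] at hz2
      exact hz2
    · rw [hlf, if_neg h0.ne', div_lt_iff₀ hq, mul_comm] at hz1
      exact hz1
  have hLr : ∀ i < h, ∀ s, L i s → X i s < rt := by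
    intro i hi s hL
    rw [hrt]
    split_ifs with h0
    · linarith [A.le_one i s]
    · rw [lt_div_iff₀ hq, mul_comm, A.mul_eq]
      rcases h2 i hi s hL with h4 | ⟨h4, h5⟩
      · have : (D i s : ℝ) + 1 ≤ k := by exact_mod_cast h4
        linarith [A.le_one (i + 1) s]
      · rw [h4]; linarith
  have hLl : ∀ i < h, ∀ s, ¬ L i s → lf < X i s := by
    intro i hi s hL
    rw [hlf]
    split_ifs with h0
    · exact A.point_pos i s
    · rw [div_lt_iff₀ hq, mul_comm, A.mul_eq]
      rcases h3 i hi s hL with h4 | ⟨h4, h5⟩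
      · have : (k : ℝ) + 1 ≤ D i s := by exact_mod_cast h4
        linarith [A.ge (i + 1) s]
      · rw [h4]; linarith
  have hlr : lf < rt := by
    rw [hlf, hrt]
    split_ifs with h4 h5 h5
    · linarith
    · positivity
    · rw [div_lt_iff₀ hq, mul_comm, hqθ, h5]
      linarith
    · exact div_lt_div_of_pos_right (by linarith [A.theta_lt]) hq
  let S : Finset (ℕ × Bool) := Finset.range h ×ˢ Finset.univ
  obtain ⟨lo, hlo1, hlo2⟩ : ∃ lo, (∀ i < h, ∀ s, L i s → X i s ≤ lo) ∧ lf ≤ lo ∧ lo < rt ∧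
      ∀ i < h, ∀ s, ¬ L i s → lo < X i s := by
    let T := insert lf ((S.filter fun p => L p.1 p.2).image fun p => X p.1 p.2)
    have hT : T.Nonempty := ⟨lf, Finset.mem_insert_self _ _⟩
    refine ⟨T.max' hT, fun i hi s hL => T.le_max' _ ?_, T.le_max' _ (Finset.mem_insert_self _ _),
      ?_, ?_⟩
    · refine Finset.mem_insert_of_mem (Finset.mem_image.2 ⟨(i, s), ?_, rfl⟩)
      simp [S, hi, hL]
    · rw [Finset.max'_lt_iff]
      intro y hy
      rcases Finset.mem_insert.1 hy with rfl | hy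
      · exact hlr
      · obtain ⟨⟨i, s⟩, hp, rfl⟩ := Finset.mem_image.1 hy
        simp only [S, Finset.mem_filter, Finset.mem_product, Finset.mem_range] at hp
        exact hLr i hp.1.1 s hp.2
    · intro j hj t hLj
      rw [Finset.max'_lt_iff]
      intro y hy
      rcases Finset.mem_insert.1 hy with rfl | hy
      · exact hLl j hj t hLj
      · obtain ⟨⟨i, s⟩, hp, rfl⟩ := Finset.mem_image.1 hy
        simp only [S, Finset.mem_filter, Finset.mem_product, Finset.mem_range] at hp
        exact h1 i hp.1.1 s j hj t hp.2 hLj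
  obtain ⟨hi, hhi1, hhi2, hhi3⟩ : ∃ hi, (∀ i < h, ∀ s, ¬ L i s → hi ≤ X i s) ∧ hi ≤ rt ∧
      lo < hi := by
    let T := insert rt ((S.filter fun p => ¬ L p.1 p.2).image fun p => X p.1 p.2)
    have hT : T.Nonempty := ⟨rt, Finset.mem_insert_self _ _⟩
    refine ⟨T.min' hT, fun i hi s hL => T.min'_le _ ?_, T.min'_le _ (Finset.mem_insert_self _ _),
      ?_⟩
    · refine Finset.mem_insert_of_mem (Finset.mem_image.2 ⟨(i, s), ?_, rfl⟩)
      simp [S, hi, hL]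
    · rw [Finset.lt_min'_iff]
      intro y hy
      rcases Finset.mem_insert.1 hy with rfl | hy
      · exact hlo2.2.1
      · obtain ⟨⟨i, s⟩, hp, rfl⟩ := Finset.mem_image.1 hy
        simp only [S, Finset.mem_filter, Finset.mem_product, Finset.mem_range] at hp
        exact hlo2.2.2 i hp.1.1 s hp.2
  obtain ⟨z, hzF, hz1, hz2⟩ := A.exists_mem_Ioo hhi3 fun z hz =>
    hpiece z (hlo2.1.trans_lt hz.1) (hz.2.trans_le hhi2)
  refine ⟨z, hzF, hpiece z (hlo2.1.trans_lt hz1) (hz2.trans_le hhi2), fun i hi s => ⟨fun h4 => ?_,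
    fun h4 => (hlo1 i hi s h4).trans_lt hz1⟩⟩
  by_contra h5
  exact (h4.trans hz2).not_ge (hhi1 i hi s h5)

end Level

namespace Level

variable {M : ℕ} {q : ℝ} {h : ℕ} {X : ℕ → Bool → ℝ} {D : ℕ → Bool → ℕ}

/-- The left end of a vertex: either the left end of a piece (shifted below the first point of the
orbit for the piece with digit `0`), or a point of the orbit in the interior of a piece. -/
noncomputable def leftEnd (M : ℕ) (q : ℝ) (h : ℕ) (X : ℕ → Bool → ℝ) :
    Fin (M + 1) ⊕ (Fin (h - 1) × Bool) → ℝ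
  | .inl k => (((k : ℕ) : ℝ) - 1 + theta M q) / q
  | .inr p => X p.1 p.2

/-- The digit of the piece in which `leftEnd` lies. -/
def leftDigit (M h : ℕ) (D : ℕ → Bool → ℕ) : Fin (M + 1) ⊕ (Fin (h - 1) × Bool) → ℕ
  | .inl k => k
  | .inr p => D p.1 p.2

theorem exists_right_of_leftEnd (A : Level M q h X D) (c : Fin (M + 1) ⊕ (Fin (h - 1) × Bool)) :
    ∃ z ∈ graphRegion M q, InPiece M q (leftDigit M h D c) z ∧
      ∀ i < h, ∀ s, X i s < z ↔ X i s ≤ leftEnd M q h X c := by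
  have hq : 0 < q := by linarith [A.one_lt]
  have hθ := A.one_lt_theta
  have hθ2 := A.theta_lt
  refine A.exists_point ?_ (fun i s => X i s ≤ leftEnd M q h X c)
    (fun i _ s j _ t h1 h2 => h1.trans_lt (not_le.1 h2)) ?_ ?_
  · rcases c with k | p
    · exact Nat.le_of_lt_succ k.2
    · exact A.digit_le _ _
  · rcases c with k | ⟨i, s⟩
    · intro j hj t hle
      simp only [leftEnd, leftDigit] at hle ⊢
      rw [le_div_iff₀ hq, mul_comm, A.mul_eq] at hle
      have h1 := A.ge (j + 1) t
      have h2 : (D j t : ℝ) ≤ (k : ℕ) := by linarith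
      have h3 : D j t ≤ k := by exact_mod_cast h2
      rcases h3.lt_or_eq with h4 | h4
      · exact Or.inl h4
      · rw [h4] at hle
        exact Or.inr ⟨h4, by linarith⟩
    · intro j hj t hle
      have hi := i.2
      simp only [leftEnd, leftDigit] at hle ⊢
      have h5 : X (i + 1) s < 1 := A.lt_one (by omega) (by omega) s
      rcases hle.lt_or_eq with h1 | h1
      · exact (A.lt_cases h1).imp_right fun h2 => ⟨h2.1, h2.2.trans h5⟩
      · have h2 := A.eq_cases h1
        exact Or.inr ⟨h2.1, by rw [h2.2]; exact h5⟩
  · rcases c with k | ⟨i, s⟩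
    · intro j hj t hle
      simp only [leftEnd, leftDigit, not_le] at hle ⊢
      rw [div_lt_iff₀ hq, mul_comm (X j t), A.mul_eq] at hle
      have h1 := A.le_one (j + 1) t
      have h2 : ((k : ℕ) : ℝ) < D j t + 1 := by linarith
      have h3 : (k : ℕ) < D j t + 1 := by exact_mod_cast h2
      rcases (Nat.lt_succ_iff.1 h3).lt_or_eq with h4 | h4
      · exact Or.inl h4
      · rw [h4] at hle
        exact Or.inr ⟨h4.symm, by linarith⟩
    · intro j hj t hle
      simp only [leftEnd, leftDigit, not_le] at hle ⊢
      exact (A.lt_cases hle).imp_right fun h2 => ⟨h2.1.symm, (A.ge _ _).trans_lt h2.2⟩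

/-- The number of vertices: `M + 1` pieces, cut by the `2 * h - 2` points of the orbit that lie in
their interior; the remaining two points are ends of pieces. -/
theorem card_vertices (A : Level M q h X D) :
    Nonempty (Fin (M + 1) ⊕ (Fin (h - 1) × Bool) ≃ GraphVertex M q) := by
  have hq : 0 < q := by linarith [A.one_lt]
  have hθ := A.one_lt_theta
  have hpos := A.pos
  choose z hzF hzp hzc using A.exists_right_of_leftEnd
  -- the left end of a piece is not a point with index below `h - 1`
  have hne : ∀ (i : Fin (h - 1)) s, ¬ X i s ≤ ((D i s : ℝ) - 1 + theta M q) / q := by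
    intro i s hle
    have hi := i.2
    rw [le_div_iff₀ hq, mul_comm, A.mul_eq] at hle
    have := A.gt_bot (i := i + 1) (by omega) (by omega) s
    linarith
  refine ⟨Equiv.ofBijective (fun c => vtx (hzF c)) ⟨fun c e hce => ?_, fun J => ?_⟩⟩
  · obtain ⟨⟨k, hk1, hk2⟩, hcut⟩ := (A.vertex_eq_iff (mem_vtx (hzF c)) (mem_vtx (hzF e))).1 hce
    have hd : leftDigit M h D c = leftDigit M h D e :=
      (A.piece_unique (hzp c) hk1).trans (A.piece_unique hk2 (hzp e))
    have hcut' : ∀ i < h, ∀ s, X i s ≤ leftEnd M q h X c ↔ X i s ≤ leftEnd M q h X e := by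
      intro i hi s
      rw [← hzc c i hi s, ← hzc e i hi s]
      exact hcut i hi s
    rcases c with k | ⟨i, s⟩ <;> rcases e with l | ⟨j, t⟩
    · exact congrArg Sum.inl (Fin.ext hd)
    · have hj := j.2
      have h1 := (hcut' j (by omega) t).2 le_rfl
      simp only [leftEnd, leftDigit] at h1 hd
      rw [hd] at h1
      exact absurd h1 (hne j t)
    · have hi := i.2
      have h1 := (hcut' i (by omega) s).1 le_rfl
      simp only [leftEnd, leftDigit] at h1 hd
      rw [← hd] at h1
      exact absurd h1 (hne i s)
    · have hi := i.2
      have hj := j.2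
      have h1 := (hcut' i (by omega) s).1 le_rfl
      have h2 := (hcut' j (by omega) t).2 le_rfl
      obtain ⟨h3, h4⟩ := A.inj (by omega) (by omega) (le_antisymm h1 h2)
      exact congrArg Sum.inr (Prod.ext (Fin.ext h3) h4)
  · obtain ⟨y, hy⟩ := J.exists_mem
    have hyF := J.subset hy
    obtain ⟨⟨k, hk⟩, -⟩ := A.mem_region_iff.1 hyF
    suffices hs : ∃ c, leftDigit M h D c = k ∧
        ∀ i < h, ∀ s, X i s ≤ leftEnd M q h X c ↔ X i s < y by
      obtain ⟨c, hc1, hc2⟩ := hs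
      refine ⟨c, (A.vertex_eq_iff (mem_vtx (hzF c)) hy).2 ⟨⟨k, hc1 ▸ hzp c, hk⟩, fun i hi s => ?_⟩⟩
      rw [hzc c i hi s, hc2 i hi s]
    have hhalf : ∀ j < h, ¬ j < h - 1 → ∀ t, X (j + 1) t < 1 → X (j + 1) t = theta M q - 1 := by
      intro j hj hj' t hlt
      rw [show j + 1 = h by omega] at hlt ⊢
      cases t with
      | true => exact A.half_true
      | false => rw [A.half_false] at hlt; exact absurd hlt (lt_irrefl _)
    by_cases hex : ∃ p : Fin (h - 1) × Bool, X p.1 p.2 < y ∧ D p.1 p.2 = k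
    · obtain ⟨⟨i, s⟩, ⟨hi1, hi2⟩, hmax⟩ := (Set.toFinite
        {p : Fin (h - 1) × Bool | X p.1 p.2 < y ∧ D p.1 p.2 = k}).exists_maximalFor
          (fun p => X p.1 p.2) _ hex
      replace hi2 : D i s = k := hi2
      refine ⟨Sum.inr (i, s), hi2, fun j hj t => ⟨fun h1 => lt_of_le_of_lt h1 hi1, fun h1 => ?_⟩⟩
      simp only [leftEnd]
      rcases A.cut_lt hk h1 with h2 | ⟨h2, h3⟩
      · exact (A.lt_of_digit (by omega)).le
      · by_cases hj' : j < h - 1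
        · by_contra hcon
          exact hcon (hmax (j := (⟨j, hj'⟩, t)) ⟨h1, h2⟩ (not_le.1 hcon).le)
        · have h4 := hhalf j hj hj' t h3
          rw [← not_lt, A.lt_iff_mul_lt, A.mul_eq, A.mul_eq, h2, hi2, h4, not_lt]
          linarith [A.ge (i + 1) s]
    · push Not at hex
      refine ⟨Sum.inl ⟨k, Nat.lt_succ_of_le hk.1⟩, rfl, fun j hj t => ?_⟩
      simp only [leftEnd]
      rw [le_div_iff₀ hq, mul_comm, A.mul_eq]
      constructor
      · intro h1
        rw [A.lt_iff_mul_lt, A.mul_eq]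
        rcases Nat.eq_zero_or_pos k with h2 | h2
        · have h3 := A.mul_eq j t
          have h4 := A.ge j t
          have h5 : X j t < q * X j t := by
            have := mul_lt_mul_of_pos_right A.one_lt (A.point_pos j t)
            linarith
          rw [h2] at h1
          push_cast at h1
          linarith
        · linarith [hk.2.2.2.2 h2]
      · intro h1
        rcases A.cut_lt hk h1 with h2 | ⟨h2, h3⟩
        · have : (D j t : ℝ) + 1 ≤ k := by exact_mod_cast h2
          linarith [A.le_one (j + 1) t]
        · by_cases hj' : j < h - 1
          · exact absurd h2 (hex (⟨j, hj'⟩, t) h1)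
          · rw [h2, hhalf j hj hj' t h3]
            linarith

end Level

/-! ### Comparison of consecutive graphs -/

/-- Two consecutive levels. The orbit digits of the upper level agree with those of the lower one
up to the end of the period `2 * h`, where the digit is raised by one (lowered for the
reflection). -/
structure LevelPair (M : ℕ) (q q' : ℝ) (h : ℕ) (X X' : ℕ → Bool → ℝ) (D D' : ℕ → Bool → ℕ) :
    Prop where
  low : Level M q h X D
  up : Level M q' (2 * h) X' D'
  digit : ∀ i < 2 * h - 1, ∀ s, D' i s = D i s
  last_true : D' (2 * h - 1) true = D (2 * h - 1) true + 1
  last_false : D' (2 * h - 1) false + 1 = D (2 * h - 1) false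

/-- `z` lies between the points `(i, s)` and `(i + h, !s)`, which coincide in the level below; such
points, and the vertices containing them, are called separating. -/
def Split (h : ℕ) (X : ℕ → Bool → ℝ) (i : ℕ) (s : Bool) (z : ℝ) : Prop :=
  ¬ (X i s < z ↔ X (i + h) (!s) < z)

/-- `z` and `z'` have the same digit and the same position relative to the orbits of the two
levels. -/
def Match (M : ℕ) (q q' : ℝ) (h : ℕ) (X X' : ℕ → Bool → ℝ) (z z' : ℝ) : Prop :=
  (∃ k, InPiece M q k z ∧ InPiece M q' k z') ∧ ∀ i < 2 * h, ∀ s, X i s < z ↔ X' i s < z'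

/-- The successor on the pairs `(i, s)` with `i < h`: the orbit is reflected after `h` steps. -/
def nextIdx (h : ℕ) (i : ℕ) (s : Bool) : ℕ × Bool := if i + 1 < h then (i + 1, s) else (0, !s)

theorem Split.bounds {M : ℕ} {q : ℝ} {h g : ℕ} {X : ℕ → Bool → ℝ} {D : ℕ → Bool → ℕ}
    (A : Level M q g X D) {z : ℝ} (hz : z ∈ graphRegion M q) {i : ℕ} {s : Bool}
    (hs : Split h X i s z) : theta M q - 1 < z ∧ z < 1 := by
  have a1 := A.ge i s
  have a2 := A.ge (i + h) (!s)
  have a3 := A.le_one i s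
  have a4 := A.le_one (i + h) (!s)
  unfold Split at hs
  by_cases h1 : X i s < z
  · have h2 : ¬ X (i + h) (!s) < z := fun h2 => hs ⟨fun _ => h2, fun _ => h1⟩
    exact ⟨by linarith, (A.lt_point hz h2).trans_le a4⟩
  · have h2 : X (i + h) (!s) < z := by
      by_contra h2
      exact hs ⟨fun h3 => absurd h3 h1, fun h3 => absurd h3 h2⟩
    exact ⟨by linarith, (A.lt_point hz h1).trans_le a3⟩

theorem Split.pull_mem {M : ℕ} {q : ℝ} {h g : ℕ} {X : ℕ → Bool → ℝ} {D : ℕ → Bool → ℕ}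
    (A : Level M q g X D) {z : ℝ} (hz : z ∈ graphRegion M q) {i : ℕ} {s : Bool}
    (hs : Split h X i s z) {k : ℕ} (hk : k ≤ M) : (z + k) / q ∈ graphRegion M q :=
  (A.pull_mem_iff hz hk).2 ⟨fun _ => (hs.bounds A hz).2, fun _ => (hs.bounds A hz).1⟩

namespace LevelPair

variable {M : ℕ} {q q' : ℝ} {h : ℕ} {X X' : ℕ → Bool → ℝ} {D D' : ℕ → Bool → ℕ}

theorem digit_cases (P : LevelPair M q q' h X X' D D') {i : ℕ} (hi : i < 2 * h) (s : Bool) :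
    (i + 1 < 2 * h ∧ D' i s = D i s) ∨ (i + 1 = 2 * h ∧ s = true ∧ D' i s = D i s + 1) ∨
      (i + 1 = 2 * h ∧ s = false ∧ D' i s + 1 = D i s) := by
  rcases Nat.lt_or_ge (i + 1) (2 * h) with h1 | h1
  · exact Or.inl ⟨h1, P.digit i (by omega) s⟩
  · obtain rfl : i = 2 * h - 1 := by omega
    cases s with
    | true => exact Or.inr (Or.inl ⟨by omega, rfl, P.last_true⟩)
    | false => exact Or.inr (Or.inr ⟨by omega, rfl, P.last_false⟩)

theorem low_half (P : LevelPair M q q' h X X' D D') (i : ℕ) (s : Bool) :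
    X (i + h) (!s) = X i s := by
  rw [P.low.add_half, Bool.not_not]

theorem digit_half (P : LevelPair M q q' h X X' D D') (i : ℕ) (s : Bool) :
    D (i + h) (!s) = D i s := by
  rw [P.low.digit_add_half, Bool.not_not]

theorem low_end (P : LevelPair M q q' h X X' D D') : X (2 * h) true = 1 ∧
    X (2 * h) false = theta M q - 1 := by
  have h1 := P.low.add_period 0 true
  have h2 := P.low.add_period 0 false
  rw [zero_add] at h1 h2
  exact ⟨h1.trans P.low.zero, h2.trans P.low.zero_false⟩

/-- The order of the points is preserved when passing to the upper level. The only exception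
concerns the two ends of the middle switch interval, which change their roles. -/
theorem mono (P : LevelPair M q q' h X X' D D') {i j : ℕ} (hi : i < 2 * h) (hj : j < 2 * h)
    {s t : Bool} (hX : X i s < X j t) : X' i s < X' j t ∨
      (i + 1 = 2 * h ∧ j + 1 = 2 * h ∧ s = true ∧ t = false ∧ D j t = D i s + 1) := by
  have key : ∀ n : ℕ, ∀ i < 2 * h, ∀ j < 2 * h, ∀ s t, 1 < q ^ n * (X j t - X i s) →
      X' i s < X' j t ∨
        (i + 1 = 2 * h ∧ j + 1 = 2 * h ∧ s = true ∧ t = false ∧ D j t = D i s + 1) := by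
    intro n
    induction n with
    | zero =>
      intro i _ j _ s t h1
      rw [pow_zero, one_mul] at h1
      linarith [P.low.le_one j t, P.low.ge i s, P.low.theta_lt, P.low.one_lt_theta]
    | succ n ih =>
      intro i hi j hj s t h1
      have hq : 0 < q := by linarith [P.low.one_lt]
      have hX : X i s < X j t := by
        by_contra hcon
        have : q ^ (n + 1) * (X j t - X i s) ≤ 0 :=
          mul_nonpos_of_nonneg_of_nonpos (by positivity) (by linarith)
        linarith
      have hend := P.low_end
      rcases P.low.lt_cases hX with hD | ⟨hD, hX1⟩
      · rcases P.digit_cases hi s with ⟨a1, a2⟩ | ⟨a1, rfl, a2⟩ | ⟨a1, rfl, a2⟩ <;>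
        rcases P.digit_cases hj t with ⟨b1, b2⟩ | ⟨b1, rfl, b2⟩ | ⟨b1, rfl, b2⟩
        · exact Or.inl (P.up.lt_of_digit (by omega))
        · exact Or.inl (P.up.lt_of_digit (by omega))
        · left
          rcases Nat.lt_or_ge (D' i s) (D' j false) with h2 | h2
          · exact P.up.lt_of_digit h2
          · refine P.up.lt_of_digit_eq (by omega) ?_
            rw [b1, P.up.half_false]
            exact P.up.lt_one a1 (by omega) s
        · left
          rcases Nat.lt_or_ge (D' i true) (D' j t) with h2 | h2
          · exact P.up.lt_of_digit h2
          · refine P.up.lt_of_digit_eq (by omega) ?_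
            rw [a1, P.up.half_true]
            exact P.up.gt_bot b1 (by omega) t
        · obtain rfl : i = j := by omega
          exact absurd hX (lt_irrefl _)
        · rcases Nat.lt_or_ge (D i true + 1) (D j false) with h3 | h3
          · left
            rcases Nat.lt_or_ge (D' i true) (D' j false) with h2 | h2
            · exact P.up.lt_of_digit h2
            · refine P.up.lt_of_digit_eq (by omega) ?_
              rw [a1, b1, P.up.half_true, P.up.half_false]
              linarith [P.up.theta_lt]
          · exact Or.inr ⟨a1, b1, rfl, rfl, by omega⟩
        · exact Or.inl (P.up.lt_of_digit (by omega))
        · exact Or.inl (P.up.lt_of_digit (by omega))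
        · obtain rfl : i = j := by omega
          exact absurd hX (lt_irrefl _)
      · rcases P.digit_cases hi s with ⟨a1, a2⟩ | ⟨a1, rfl, a2⟩ | ⟨a1, rfl, a2⟩
        · rcases P.digit_cases hj t with ⟨b1, b2⟩ | ⟨b1, rfl, b2⟩ | ⟨b1, rfl, b2⟩
          · have hstep : X (j + 1) t - X (i + 1) s = q * (X j t - X i s) := by
              rw [P.low.step, P.low.step, hD]; ring
            rcases ih (i + 1) a1 (j + 1) b1 s t (by rw [hstep, ← mul_assoc, ← pow_succ]; exact h1)
              with h2 | ⟨h2, h3, rfl, rfl, h4⟩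
            · exact Or.inl (P.up.lt_of_digit_eq (by omega) h2)
            · -- two consecutive digits in the middle would force `M` to be both even and odd
              exfalso
              obtain rfl : i = j := by omega
              have h5 := P.low.digit_flip i true
              have h6 := P.low.digit_flip (i + 1) true
              have h7 := P.low.digit_le i true
              have h8 := P.low.digit_le (i + 1) true
              simp only [Bool.not_true] at h5 h6
              omega
          · exact Or.inl (P.up.lt_of_digit (by omega))
          · rw [b1, hend.2] at hX1
            exact absurd hX1 (not_lt.2 (P.low.ge _ _))
        · rw [a1, hend.1] at hX1
          exact absurd hX1 (not_lt.2 (P.low.le_one _ _))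
        · rcases P.digit_cases hj t with ⟨b1, b2⟩ | ⟨b1, rfl, b2⟩ | ⟨b1, rfl, b2⟩
          · exact Or.inl (P.up.lt_of_digit (by omega))
          · exact Or.inl (P.up.lt_of_digit (by omega))
          · obtain rfl : i = j := by omega
            exact absurd hX (lt_irrefl _)
  obtain ⟨n, hn⟩ := pow_unbounded_of_one_lt (1 / (X j t - X i s)) P.low.one_lt
  have hpos : 0 < X j t - X i s := by linarith
  exact key n i hi j hj s t (by rwa [div_lt_iff₀ hpos] at hn)

/-- The points of the upper level with the last index are ends of pieces. -/
theorem last_cut (P : LevelPair M q q' h X X' D D') {z : ℝ} (hz : z ∈ graphRegion M q') {k : ℕ}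
    (hk : InPiece M q' k z) {i : ℕ} (hi : i + 1 = 2 * h) :
    (X' i true < z ↔ D i true < k) ∧ (X' i false < z ↔ D i false ≤ k) := by
  have ht : D' i true = D i true + 1 := by
    rw [show i = 2 * h - 1 by omega]; exact P.last_true
  have hf : D' i false + 1 = D i false := by
    rw [show i = 2 * h - 1 by omega]; exact P.last_false
  constructor
  · constructor
    · intro h1
      have := P.up.cut_lt hk h1
      omega
    · intro h1
      by_contra h2
      rcases P.up.cut_gt hk (P.up.lt_point hz h2) with h3 | ⟨-, h3⟩
      · omega
      · rw [hi, P.up.half_true] at h3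
        exact lt_irrefl _ h3
  · constructor
    · intro h1
      rcases P.up.cut_lt hk h1 with h3 | ⟨-, h3⟩
      · omega
      · rw [hi, P.up.half_false] at h3
        exact absurd h3 (lt_irrefl _)
    · intro h1
      by_contra h2
      have := P.up.cut_gt hk (P.up.lt_point hz h2)
      omega

/-- Every point of the lower region has a counterpart in the upper one. -/
theorem exists_match_up (P : LevelPair M q q' h X X' D D') {z : ℝ} (hz : z ∈ graphRegion M q) :
    ∃ z' ∈ graphRegion M q', Match M q q' h X X' z z' := by
  obtain ⟨⟨k, hk⟩, -⟩ := P.low.mem_region_iff.1 hz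
  have hend := P.low_end
  have cgt : ∀ j t, ¬ X j t < z → k < D j t ∨ (D j t = k ∧ theta M q - 1 < X (j + 1) t) :=
    fun j t h1 => P.low.cut_gt hk (P.low.lt_point hz h1)
  have hex := P.up.exists_point hk.1 (fun i s => X i s < z) ?_ ?_ ?_
  · obtain ⟨z', hz', hk', hcut⟩ := hex
    exact ⟨z', hz', ⟨k, hk, hk'⟩, fun i hi s => (hcut i hi s).symm⟩
  · intro i hi s j hj t h1 h2
    rcases P.mono hi hj (h1.trans (P.low.lt_point hz h2)) with h3 | ⟨h3, h4, rfl, rfl, h5⟩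
    · exact h3
    · -- no point of the region lies between the two ends of a switch interval
      exfalso
      have a1 := P.low.cut_lt hk h1
      have a2 := cgt _ _ h2
      rw [h3, hend.1] at a1
      rw [h4, hend.2] at a2
      have a3 : D i true < k := a1.resolve_right fun h => lt_irrefl _ h.2
      have a4 : k < D j false := a2.resolve_right fun h => lt_irrefl _ h.2
      omega
  · intro i hi s h1
    have h2 := P.low.cut_lt hk h1
    rcases P.digit_cases hi s with ⟨a1, a2⟩ | ⟨a1, rfl, a2⟩ | ⟨a1, rfl, a2⟩
    · exact h2.imp (fun h3 => by omega) fun h3 => ⟨by omega, P.up.lt_one a1 (by omega) s⟩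
    · rw [a1, hend.1] at h2
      have h3 : D i true < k := h2.resolve_right fun h => lt_irrefl _ h.2
      rw [a1, P.up.half_true]
      rcases Nat.lt_or_ge (D' i true) k with h4 | h4
      · exact Or.inl h4
      · exact Or.inr ⟨by omega, by linarith [P.up.theta_lt]⟩
    · exact Or.inl (by omega)
  · intro i hi s h1
    have h2 := cgt _ _ h1
    rcases P.digit_cases hi s with ⟨a1, a2⟩ | ⟨a1, rfl, a2⟩ | ⟨a1, rfl, a2⟩
    · exact h2.imp (fun h3 => by omega) fun h3 => ⟨by omega, P.up.gt_bot a1 (by omega) s⟩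
    · exact Or.inl (by omega)
    · rw [a1, hend.2] at h2
      have h3 : k < D i false := h2.resolve_right fun h => lt_irrefl _ h.2
      rw [a1, P.up.half_false]
      rcases Nat.lt_or_ge k (D' i false) with h4 | h4
      · exact Or.inl h4
      · exact Or.inr ⟨by omega, by linarith [P.up.theta_lt]⟩

/-- A point of the upper region has a counterpart in the lower one unless it separates two points
that coincide there. -/
theorem exists_match_low (P : LevelPair M q q' h X X' D D') {z' : ℝ}
    (hz' : z' ∈ graphRegion M q') (hns : ∀ i < h, ∀ s, ¬ Split h X' i s z') :
    ∃ z ∈ graphRegion M q, Match M q q' h X X' z z' := by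
  obtain ⟨⟨k, hk⟩, -⟩ := P.up.mem_region_iff.1 hz'
  have hpos := P.low.pos
  have hsat : ∀ i < h, ∀ s, X' i s < z' ↔ X' (i + h) (!s) < z' := fun i hi s =>
    not_not.1 (hns i hi s)
  have cgt : ∀ j t, ¬ X' j t < z' → k < D' j t ∨ (D' j t = k ∧ theta M q' - 1 < X' (j + 1) t) :=
    fun j t h1 => P.up.cut_gt hk (P.up.lt_point hz' h1)
  have hex := P.low.exists_point hk.1 (fun i s => X' i s < z') ?_ ?_ ?_
  · obtain ⟨z, hz, hkz, hcut⟩ := hex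
    refine ⟨z, hz, ⟨k, hkz, hk⟩, fun i hi s => ?_⟩
    rcases Nat.lt_or_ge i h with h1 | h1
    · exact hcut i h1 s
    · obtain ⟨j, rfl⟩ := Nat.exists_eq_add_of_le' h1
      rw [P.low.add_half, hcut j (by omega), hsat j (by omega), Bool.not_not]
  · intro i hi s j hj t h1 h2
    by_contra hcon
    rcases (not_lt.1 hcon).lt_or_eq with h3 | h3
    · rcases P.mono (by omega) (by omega) h3 with h4 | ⟨h4, -⟩
      · exact h2 (h4.trans h1)
      · omega
    · obtain ⟨rfl, rfl⟩ := P.low.inj hj hi h3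
      exact h2 h1
  · intro i hi s h1
    have hD := P.digit i (by omega) s
    have h2 := P.up.cut_lt hk h1
    rcases Nat.lt_or_ge (i + 1) h with h3 | h3
    · exact h2.imp (fun h4 => by omega) fun h4 => ⟨by omega, P.low.lt_one h3 (by omega) s⟩
    · have h4 := (hsat i hi s).1 h1
      have h5 := P.digit_half i s
      rw [show i + 1 = h by omega]
      cases s with
      | true =>
        rw [P.low.half_true]
        exact h2.imp (fun h4 => by omega) fun h4 => ⟨by omega, by linarith [P.low.theta_lt]⟩
      | false =>
        simp only [Bool.not_false] at h4 h5
        have := (P.last_cut hz' hk (i := i + h) (by omega)).1.1 h4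
        exact Or.inl (by omega)
  · intro i hi s h1
    have hD := P.digit i (by omega) s
    have h2 := cgt i s h1
    rcases Nat.lt_or_ge (i + 1) h with h3 | h3
    · exact h2.imp (fun h4 => by omega) fun h4 => ⟨by omega, P.low.gt_bot h3 (by omega) s⟩
    · have h4 : ¬ X' (i + h) (!s) < z' := fun h4 => h1 ((hsat i hi s).2 h4)
      have h5 := P.digit_half i s
      rw [show i + 1 = h by omega]
      cases s with
      | true =>
        simp only [Bool.not_true] at h4 h5
        have h6 : ¬ D (i + h) false ≤ k := fun h6 =>
          h4 ((P.last_cut hz' hk (i := i + h) (by omega)).2.2 h6)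
        exact Or.inl (by omega)
      | false =>
        rw [P.low.half_false]
        exact h2.imp (fun h4 => by omega) fun h4 => ⟨by omega, by linarith [P.low.theta_lt]⟩

theorem not_split_of_match (P : LevelPair M q q' h X X' D D') {z z' : ℝ}
    (hm : Match M q q' h X X' z z') {i : ℕ} (hi : i < h) (s : Bool) : ¬ Split h X' i s z' := by
  unfold Split
  rw [not_not, ← hm.2 i (by omega), ← hm.2 (i + h) (by omega), P.low_half]

/-- Matching is compatible with the inverse branches, hence with the edges. -/
theorem match_pull (P : LevelPair M q q' h X X' D D') {z z' : ℝ} (hz : z ∈ graphRegion M q)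
    (hz' : z' ∈ graphRegion M q') (hm : Match M q q' h X X' z z') {k : ℕ} (hk : k ≤ M) :
    ((z + k) / q ∈ graphRegion M q ↔ (z' + k) / q' ∈ graphRegion M q') ∧
      ((z + k) / q ∈ graphRegion M q → Match M q q' h X X' ((z + k) / q) ((z' + k) / q')) := by
  have hpos := P.low.pos
  have hend := P.low_end
  have htop := hm.2 0 (by omega) true
  have hbot := hm.2 0 (by omega) false
  rw [P.low.zero, P.up.zero] at htop
  rw [P.low.zero_false, P.up.zero_false] at hbot
  have htop' : z < 1 ↔ z' < 1 := by
    have a1 := P.low.ne_point hz 0 true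
    have a2 := P.up.ne_point hz' 0 true
    rw [P.low.zero] at a1
    rw [P.up.zero] at a2
    rw [lt_iff_le_and_ne, and_iff_left a1, lt_iff_le_and_ne, and_iff_left a2, ← not_lt, ← not_lt,
      htop]
  have hiff : (z + k) / q ∈ graphRegion M q ↔ (z' + k) / q' ∈ graphRegion M q' := by
    rw [P.low.pull_mem_iff hz hk, P.up.pull_mem_iff hz' hk, htop', hbot]
  refine ⟨hiff, fun hw => ?_⟩
  have hw' := hiff.1 hw
  obtain ⟨c1, c2⟩ := (P.up.pull_mem_iff hz' hk).1 hw'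
  obtain ⟨c3, c4⟩ := (P.low.pull_mem_iff hz hk).1 hw
  refine ⟨⟨k, P.low.piece_pull hz hk hw, P.up.piece_pull hz' hk hw'⟩, fun i hi s => ?_⟩
  rw [P.low.pull_cut hz, P.up.pull_cut hz']
  have hdM := P.up.digit_le i s
  have hdM' := P.low.digit_le i s
  rcases P.digit_cases hi s with ⟨a1, a2⟩ | ⟨a1, rfl, a2⟩ | ⟨a1, rfl, a2⟩
  · rw [a2, hm.2 (i + 1) a1]
  · rw [a1, hend.1, P.up.half_true]
    constructor
    · rintro (h1 | ⟨h1, h2⟩)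
      · by_cases h3 : D' i true < k
        · exact Or.inl h3
        · exact Or.inr ⟨by omega, c2 (by omega)⟩
      · exact absurd (c3 (by omega)) h2.not_gt
    · rintro (h1 | ⟨h1, h2⟩) <;> exact Or.inl (by omega)
  · rw [a1, hend.2, P.up.half_false]
    constructor
    · rintro (h1 | ⟨h1, h2⟩) <;> exact Or.inl (by omega)
    · rintro (h1 | ⟨h1, h2⟩)
      · by_cases h3 : D i false < k
        · exact Or.inl h3
        · exact Or.inr ⟨by omega, c4 (by omega)⟩
      · exact absurd (c1 (by omega)) h2.not_gt

theorem match_code_low (P : LevelPair M q q' h X X' D D') {z w z' : ℝ}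
    (hm : Match M q q' h X X' z z') (hn : Match M q q' h X X' w z') : Level.Code M q h X z w := by
  obtain ⟨⟨k, hk, hk'⟩, hc⟩ := hm
  obtain ⟨⟨l, hl, hl'⟩, hd⟩ := hn
  obtain rfl := P.up.piece_unique hk' hl'
  exact ⟨⟨k, hk, hl⟩, fun i hi s => (hc i (by omega) s).trans (hd i (by omega) s).symm⟩

theorem match_code_up (P : LevelPair M q q' h X X' D D') {z z' w' : ℝ}
    (hm : Match M q q' h X X' z z') (hn : Match M q q' h X X' z w') :
    Level.Code M q' (2 * h) X' z' w' := by
  obtain ⟨⟨k, hk, hk'⟩, hc⟩ := hm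
  obtain ⟨⟨l, hl, hl'⟩, hd⟩ := hn
  obtain rfl := P.low.piece_unique hk hl
  exact ⟨⟨k, hk', hl'⟩, fun i hi s => (hc i hi s).symm.trans (hd i hi s)⟩

theorem match_of_code (P : LevelPair M q q' h X X' D D') {z w z' w' : ℝ}
    (hm : Match M q q' h X X' z z') (hz : Level.Code M q h X z w)
    (hz' : Level.Code M q' (2 * h) X' z' w') : Match M q q' h X X' w w' := by
  obtain ⟨⟨k, hk, hk'⟩, hc⟩ := hm
  obtain ⟨⟨l, hl, hl'⟩, hd⟩ := hz
  obtain ⟨⟨m, hm, hm'⟩, he⟩ := hz'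
  obtain rfl := P.low.piece_unique hk hl
  obtain rfl := P.up.piece_unique hk' hm
  refine ⟨⟨k, hl', hm'⟩, fun i hi s => ?_⟩
  rw [← he i hi s, ← hc i hi s]
  rcases Nat.lt_or_ge i h with h1 | h1
  · exact (hd i h1 s).symm
  · obtain ⟨j, rfl⟩ := Nat.exists_eq_add_of_le' h1
    rw [P.low.add_half]
    exact (hd j (by omega) _).symm

end LevelPair

/-! ### The new vertices form a cycle -/

theorem nextIdx_fst_lt {h i : ℕ} (hi : i < h) (s : Bool) : (nextIdx h i s).1 < h := by
  unfold nextIdx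
  split_ifs <;> simp <;> omega

theorem Split.between {h : ℕ} {X : ℕ → Bool → ℝ} {i : ℕ} {s : Bool} {z : ℝ}
    (hs : Split h X i s z) : (X i s < z ∧ ¬ X (i + h) (!s) < z) ∨
      (¬ X i s < z ∧ X (i + h) (!s) < z) := by
  unfold Split at hs
  tauto

theorem split_of_code {M : ℕ} {q : ℝ} {h : ℕ} {X : ℕ → Bool → ℝ} {z w : ℝ}
    (hc : Level.Code M q (2 * h) X z w) {i : ℕ} (hi : i < h) {s : Bool} (hs : Split h X i s z) :
    Split h X i s w := by
  unfold Split at hs ⊢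
  rwa [← hc.2 i (by omega), ← hc.2 (i + h) (by omega)]

/-- A prefix of length `2 * h` of the digits is the reflected double of its first half, with the
last digit raised by one. -/
def Doubled (h : ℕ) (D : ℕ → Bool → ℕ) : Prop :=
  ∀ i < h, (i + 1 < h → ∀ s, D (i + h) (!s) = D i s) ∧
    (i + 1 = h → D (i + h) true = D i false + 1 ∧ D (i + h) false + 1 = D i true)

/-- Being separating propagates along the edges that read the orbit digits. -/
theorem split_pull_iff {M : ℕ} {q : ℝ} {h g : ℕ} {X : ℕ → Bool → ℝ} {D : ℕ → Bool → ℕ}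
    (A : Level M q g X D) (hD : Doubled h D) {i : ℕ} (hi : i < h) {s : Bool} {z : ℝ}
    (hz : z ∈ graphRegion M q) (hw : (z + D i s) / q ∈ graphRegion M q) :
    Split h X i s ((z + D i s) / q) ↔ Split h X (nextIdx h i s).1 (nextIdx h i s).2 z := by
  unfold nextIdx Split
  rw [A.pull_cut hz, A.pull_cut hz]
  rcases Nat.lt_or_ge (i + 1) h with h1 | h1
  · rw [if_pos h1, (hD i hi).1 h1, show i + h + 1 = i + 1 + h by omega]
    simp
  · have h2 : i + 1 = h := by omega
    obtain ⟨d1, d2⟩ := (hD i hi).2 h2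
    obtain ⟨b1, b2⟩ := (A.pull_mem_iff hz (A.digit_le i s)).1 hw
    have hM := A.digit_le (i + h) true
    rw [if_neg (by omega), zero_add, h2]
    cases s with
    | true =>
      have h3 := b2 (by omega)
      have h4 : D (i + h) false < D i true := by omega
      simp only [Bool.not_true, A.zero_false, Bool.not_false, h3, h4, lt_irrefl, true_or,
        true_and, false_or, iff_true, true_iff]
    | false =>
      have h3 := b1 (by omega)
      have h4 : ¬ D (i + h) true < D i false := by omega
      have h5 : D (i + h) true ≠ D i false := by omega
      simp only [Bool.not_false, A.zero, Bool.not_true, h3.not_gt, h4, h5, lt_irrefl, false_or,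
        true_and, false_and, iff_false, false_iff]

namespace LevelPair

variable {M : ℕ} {q q' : ℝ} {h : ℕ} {X X' : ℕ → Bool → ℝ} {D D' : ℕ → Bool → ℕ}

theorem doubled (P : LevelPair M q q' h X X' D D') : Doubled h D' := by
  intro i hi
  have hd := P.digit i (by omega)
  refine ⟨fun h1 s => ?_, fun h1 => ?_⟩
  · rw [P.digit _ (by omega), P.digit_half, hd]
  · have h2 := P.last_true
    have h3 := P.last_false
    have h4 := P.digit_half i true
    have h5 := P.digit_half i false
    simp only [Bool.not_true, Bool.not_false] at h4 h5
    rw [show 2 * h - 1 = i + h by omega] at h2 h3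
    rw [hd, hd]
    omega

/-- A separating point has the digit of the pair it separates. -/
theorem split_piece (P : LevelPair M q q' h X X' D D') {z : ℝ} (hz : z ∈ graphRegion M q')
    {k : ℕ} (hk : InPiece M q' k z) {i : ℕ} (hi : i < h) {s : Bool} (hs : Split h X' i s z) :
    k = D i s := by
  have cgt : ∀ j t, ¬ X' j t < z → k ≤ D' j t := fun j t h1 => by
    have := P.up.cut_gt hk (P.up.lt_point hz h1)
    omega
  have clt : ∀ j t, X' j t < z → D' j t ≤ k := fun j t h1 => by
    have := P.up.cut_lt hk h1
    omega
  have hd := P.digit i (by omega) s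
  have hh := P.digit_half i s
  rcases Nat.lt_or_ge (i + 1) h with h1 | h1
  · have hd' := P.digit (i + h) (by omega) (!s)
    rcases hs.between with ⟨h2, h3⟩ | ⟨h2, h3⟩
    · have := cgt _ _ h3
      have := clt _ _ h2
      omega
    · have := cgt _ _ h2
      have := clt _ _ h3
      omega
  · obtain ⟨c1, c2⟩ := P.last_cut hz hk (i := i + h) (by omega)
    rcases hs.between with ⟨h2, h3⟩ | ⟨h2, h3⟩
    · have := clt _ _ h2
      cases s <;> simp only [Bool.not_true, Bool.not_false] at h3 hh
      · rw [c1] at h3; omega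
      · rw [c2] at h3; omega
    · have := cgt _ _ h2
      cases s <;> simp only [Bool.not_true, Bool.not_false] at h3 hh
      · rw [c1] at h3; omega
      · rw [c2] at h3; omega

/-- The points separating a given pair lie in a single vertex. -/
theorem split_code (P : LevelPair M q q' h X X' D D') {z w : ℝ} (hz : z ∈ graphRegion M q')
    (hw : w ∈ graphRegion M q') {i : ℕ} (hi : i < h) {s : Bool} (hsz : Split h X' i s z)
    (hsw : Split h X' i s w) : Level.Code M q' (2 * h) X' z w := by
  obtain ⟨⟨k, hk⟩, -⟩ := P.up.mem_region_iff.1 hz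
  obtain ⟨⟨l, hl⟩, -⟩ := P.up.mem_region_iff.1 hw
  obtain rfl := P.split_piece hz hk hi hsz
  obtain rfl := P.split_piece hw hl hi hsw
  refine ⟨⟨_, hk, hl⟩, fun j hj t => ?_⟩
  rcases Nat.lt_or_ge (j + 1) (2 * h) with hj1 | hj1
  swap
  · obtain ⟨c1, c2⟩ := P.last_cut hz hk (i := j) (by omega)
    obtain ⟨c3, c4⟩ := P.last_cut hw hl (i := j) (by omega)
    cases t
    · rw [c2, c4]
    · rw [c1, c3]
  have hlt : ∀ v ∈ graphRegion M q', Split h X' i s v → X j t < X i s → X' j t < v := by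
    intro v hv hs h1
    have h2 := P.mono hj (by omega) h1
    have h3 := P.mono hj (j := i + h) (t := !s) (by omega) (by rwa [P.low_half])
    rcases hs.between with ⟨h4, -⟩ | ⟨-, h4⟩
    · exact (h2.resolve_right (by omega)).trans h4
    · exact (h3.resolve_right (by omega)).trans h4
  have hgt : ∀ v ∈ graphRegion M q', Split h X' i s v → X i s < X j t → ¬ X' j t < v := by
    intro v hv hs h1
    have h2 := P.mono (by omega) hj h1
    have h3 := P.mono (i := i + h) (s := !s) (by omega) hj (by rwa [P.low_half])
    rcases hs.between with ⟨-, h4⟩ | ⟨h4, -⟩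
    · exact ((P.up.lt_point hv h4).trans (h3.resolve_right (by omega))).not_gt
    · exact ((P.up.lt_point hv h4).trans (h2.resolve_right (by omega))).not_gt
  rcases lt_trichotomy (X j t) (X i s) with h1 | h1 | h1
  · exact iff_of_true (hlt z hz hsz h1) (hlt w hw hsw h1)
  · have key : (X' i s < z ↔ X' i s < w) ∧ (X' (i + h) (!s) < z ↔ X' (i + h) (!s) < w) := by
      rcases hsz.between with ⟨a1, a2⟩ | ⟨a1, a2⟩ <;> rcases hsw.between with ⟨b1, b2⟩ | ⟨b1, b2⟩
      · exact ⟨iff_of_true a1 b1, iff_of_false a2 b2⟩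
      · have := P.up.lt_point hz a2
        have := P.up.lt_point hw b1
        linarith
      · have := P.up.lt_point hz a1
        have := P.up.lt_point hw b2
        linarith
      · exact ⟨iff_of_false a1 b1, iff_of_true a2 b2⟩
    rcases Nat.lt_or_ge j h with h2 | h2
    · obtain ⟨rfl, rfl⟩ := P.low.inj h2 hi h1
      exact key.1
    · obtain ⟨j, rfl⟩ := Nat.exists_eq_add_of_le' h2
      rw [P.low.add_half] at h1
      obtain ⟨rfl, rfl⟩ := P.low.inj (by omega) hi h1
      rw [Bool.not_not] at key
      exact key.2
  · exact iff_of_false (hgt z hz hsz h1) (hgt w hw hsw h1)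

/-- A point separates at most one pair, because the order of distinct pairs is inherited from the
lower level. -/
theorem split_unique (P : LevelPair M q q' h X X' D D') {z : ℝ} (hz : z ∈ graphRegion M q')
    {i j : ℕ} (hi : i < h) (hj : j < h) {s t : Bool} (hs : Split h X' i s z)
    (ht : Split h X' j t z) : i = j ∧ s = t := by
  obtain ⟨⟨k, hk⟩, -⟩ := P.up.mem_region_iff.1 hz
  have main : ∀ {i j : ℕ}, i < h → j < h → ∀ {s t : Bool}, Split h X' i s z → Split h X' j t z →
      ¬ X i s < X j t := by
    intro i j hi hj s t hs ht h1
    have e1 := P.split_piece hz hk hi hs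
    have e2 := P.split_piece hz hk hj ht
    have e3 := P.digit_half i s
    have e4 := P.digit_half j t
    have m1 := P.mono (i := i) (j := j) (by omega) (by omega) h1
    have m2 := P.mono (i := i) (j := j + h) (s := s) (t := !t) (by omega) (by omega)
      (by rwa [P.low_half])
    have m3 := P.mono (i := i + h) (j := j) (s := !s) (t := t) (by omega) (by omega)
      (by rwa [P.low_half])
    have m4 := P.mono (i := i + h) (j := j + h) (s := !s) (t := !t) (by omega) (by omega)
      (by rwa [P.low_half, P.low_half])
    have n1 := m1.resolve_right (by omega)
    have n2 := m2.resolve_right (by omega)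
    have n3 := m3.resolve_right (by omega)
    have n4 := m4.resolve_right (by omega)
    rcases hs.between with ⟨-, a⟩ | ⟨a, -⟩ <;> rcases ht.between with ⟨b, -⟩ | ⟨-, b⟩ <;>
      have := P.up.lt_point hz a <;> linarith
  exact P.low.inj hi hj (le_antisymm (not_lt.1 (main hj hi ht hs)) (not_lt.1 (main hi hj hs ht)))

/-- Every pair of points that coincide in the lower level is separated in the upper one. -/
theorem exists_split (P : LevelPair M q q' h X X' D D') {i : ℕ} (hi : i < h) (s : Bool) :
    ∃ z ∈ graphRegion M q', Split h X' i s z := by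
  have hq : 0 < q' := by linarith [P.up.one_lt]
  have hθ := P.up.one_lt_theta
  have hqθ := P.up.theta_eq
  have hd := P.digit i (by omega) s
  have hh := P.digit_half i s
  have mem_piece : ∀ lo hi d : ℝ, ∀ z ∈ Ioo lo hi, (d - 1 + theta M q' ≤ q' * lo) →
      (q' * hi ≤ d + 1) → d - 1 + theta M q' < q' * z ∧ q' * z < d + 1 := by
    intro lo hi d z hz h1 h2
    exact ⟨h1.trans_lt (mul_lt_mul_of_pos_left hz.1 hq),
      (mul_lt_mul_of_pos_left hz.2 hq).trans_le h2⟩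
  rcases Nat.lt_or_ge (i + 1) h with h1 | h1
  · have hd' := P.digit (i + h) (by omega) (!s)
    have key : ∀ a b u v, D' a u = D i s → D' b v = D i s → X' a u < X' b v →
        ∃ z ∈ graphRegion M q', X' a u < z ∧ z < X' b v := by
      intro a b u v ha hb hlt
      refine P.up.exists_mem_Ioo hlt (k := D i s) fun z hz => ?_
      have m1 := P.up.mul_eq a u
      have m2 := P.up.mul_eq b v
      rw [ha] at m1
      rw [hb] at m2
      obtain ⟨p1, p2⟩ := mem_piece _ _ (D i s) z hz (by linarith [P.up.ge (a + 1) u])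
        (by linarith [P.up.le_one (b + 1) v])
      exact ⟨P.low.digit_le i s, (P.up.point_pos a u).trans hz.1,
        by linarith [hz.2, P.up.le_one b v], fun _ => p2, fun _ => p1⟩
    rcases lt_trichotomy (X' i s) (X' (i + h) (!s)) with h2 | h2 | h2
    · obtain ⟨z, hz, a, b⟩ := key _ _ _ _ hd (by omega) h2
      exact ⟨z, hz, fun hc => b.not_gt (hc.1 a)⟩
    · have := P.up.inj (by omega) (by omega) h2
      omega
    · obtain ⟨z, hz, a, b⟩ := key _ _ _ _ (by omega) hd h2
      exact ⟨z, hz, fun hc => b.not_gt (hc.2 a)⟩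
  · -- one end of the interval is now an end of the piece
    have hl := P.last_true
    have hl' := P.last_false
    have hM := P.up.digit_le (2 * h - 1) true
    have hh' : i + h = 2 * h - 1 := by omega
    rw [← hh'] at hl hl' hM
    have m1 := P.up.mul_eq i s
    rw [hd] at m1
    have ge1 := P.up.ge (i + 1) s
    have le1 := P.up.le_one (i + 1) s
    have hpos := P.up.point_pos i s
    have hone := P.up.le_one i s
    cases s with
    | false =>
      simp only [Bool.not_false] at hh
      have hlt := P.up.lt_one (i := i + 1) (by omega) (by omega) false
      have hdM : (D i false : ℝ) + 1 ≤ M := by exact_mod_cast (by omega : D i false + 1 ≤ M)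
      have heq : q' * ((D i false + 1) / q') = D i false + 1 := by field_simp
      have hp : ∀ z ∈ Ioo (X' i false) ((D i false + 1) / q'), InPiece M q' (D i false) z := by
        intro z hz
        obtain ⟨p1, p2⟩ := mem_piece _ _ (D i false) z hz (by linarith) heq.le
        refine ⟨P.low.digit_le _ _, hpos.trans hz.1, ?_, fun _ => p2, fun _ => p1⟩
        rw [P.up.lt_iff_mul_lt]
        linarith
      obtain ⟨z, hz, a, b⟩ := P.up.exists_mem_Ioo (k := D i false)
        (by rw [P.up.lt_iff_mul_lt]; linarith) hp
      refine ⟨z, hz, fun hc => ?_⟩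
      have := (P.last_cut hz (hp z ⟨a, b⟩) (i := i + h) (by omega)).1.1 (hc.1 a)
      omega
    | true =>
      simp only [Bool.not_true] at hh
      have hlt := P.up.gt_bot (i := i + 1) (by omega) (by omega) true
      have hd1 : (1 : ℝ) ≤ D i true := by exact_mod_cast (by omega : 1 ≤ D i true)
      have heq : q' * (((D i true : ℝ) - 1 + theta M q') / q') = D i true - 1 + theta M q' := by
        field_simp
      have hlo : 0 < ((D i true : ℝ) - 1 + theta M q') / q' := div_pos (by linarith) hq
      have hp : ∀ z ∈ Ioo (((D i true : ℝ) - 1 + theta M q') / q') (X' i true),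
          InPiece M q' (D i true) z := by
        intro z hz
        obtain ⟨p1, p2⟩ := mem_piece _ _ (D i true) z hz heq.ge (by linarith)
        exact ⟨P.low.digit_le _ _, hlo.trans hz.1, by linarith [hz.2], fun _ => p2, fun _ => p1⟩
      obtain ⟨z, hz, a, b⟩ := P.up.exists_mem_Ioo (k := D i true)
        (by rw [P.up.lt_iff_mul_lt]; linarith) hp
      refine ⟨z, hz, fun hc => b.not_gt (hc.2 ?_)⟩
      exact (P.last_cut hz (hp z ⟨a, b⟩) (i := i + h) (by omega)).2.2 (by omega)

/-- The only edge leaving a separating vertex reads the orbit digit and leads to the next one. -/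
theorem split_next (P : LevelPair M q q' h X X' D D') {z : ℝ} (hz : z ∈ graphRegion M q') {k : ℕ}
    (hk : k ≤ M) (hw : (z + k) / q' ∈ graphRegion M q') {i : ℕ} (hi : i < h) {s : Bool}
    (hs : Split h X' i s ((z + k) / q')) :
    k = D i s ∧ Split h X' (nextIdx h i s).1 (nextIdx h i s).2 z := by
  obtain rfl := P.split_piece hw (P.up.piece_pull hz hk hw) hi hs
  refine ⟨rfl, ?_⟩
  rw [← P.digit i (by omega) s] at hw hs
  exact (split_pull_iff P.up P.doubled hi hz hw).1 hs

theorem split_prev (P : LevelPair M q q' h X X' D D') {z : ℝ} (hz : z ∈ graphRegion M q')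
    {i : ℕ} (hi : i < h) {s : Bool} (hs : Split h X' (nextIdx h i s).1 (nextIdx h i s).2 z) :
    (z + D i s) / q' ∈ graphRegion M q' ∧ Split h X' i s ((z + D i s) / q') := by
  have hw := hs.pull_mem P.up hz (P.low.digit_le i s)
  refine ⟨hw, ?_⟩
  rw [← P.digit i (by omega) s] at hw ⊢
  exact (split_pull_iff P.up P.doubled hi hz hw).2 hs

end LevelPair

/-- The vertices of the upper graph that have no counterpart in the lower one. -/
def splitSet (M : ℕ) (q' : ℝ) (h : ℕ) (X' : ℕ → Bool → ℝ) : Set (GraphVertex M q') :=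
  {J | ∃ z ∈ J.1, ∃ i < h, ∃ s, Split h X' i s z}

/-- The `x`th pair on the cycle, starting with `(0, true)`: the orbit of `1` is followed for `h`
steps and then its reflection. -/
def cycleIdx (h x : ℕ) : ℕ × Bool := if x < h then (x, true) else (x - h, false)

theorem cycleIdx_fst_lt {h x : ℕ} (hx : x < 2 * h) : (cycleIdx h x).1 < h := by
  unfold cycleIdx
  split_ifs <;> simp <;> omega

theorem cycleIdx_inj {h x y : ℕ} (hxy : cycleIdx h x = cycleIdx h y) : x = y := by
  unfold cycleIdx at hxy
  split_ifs at hxy <;> simp at hxy <;> omega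

theorem nextIdx_cycleIdx {h x : ℕ} (hx : x < 2 * h) :
    nextIdx h (cycleIdx h x).1 (cycleIdx h x).2 = cycleIdx h ((x + 1) % (2 * h)) := by
  rcases Nat.lt_or_ge (x + 1) (2 * h) with h1 | h1
  · rw [Nat.mod_eq_of_lt h1]
    unfold nextIdx cycleIdx
    split_ifs <;> simp <;> (try simp_all) <;> omega
  · obtain rfl : x = 2 * h - 1 := by omega
    rw [show 2 * h - 1 + 1 = 2 * h by omega, Nat.mod_self]
    unfold nextIdx cycleIdx
    split_ifs <;> simp <;> omega

namespace LevelPair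

variable {M : ℕ} {q q' : ℝ} {h : ℕ} {X X' : ℕ → Bool → ℝ} {D D' : ℕ → Bool → ℕ}

/-- The separating vertices form a directed cycle of length `2 * h`, labeled by the orbit digits. -/
theorem exists_cycle (P : LevelPair M q q' h X X' D D') :
    ∃ (v : ZMod (2 * h) ≃ splitSet M q' h X') (l : ZMod (2 * h) → Fin (M + 1)),
      ∀ i k j, ((univoqueGraph M q').induce (splitSet M q' h X')).Edge (v i) k (v j) ↔
        j = i + 1 ∧ k = l i := by
  have hpos := P.low.pos
  have : NeZero (2 * h) := ⟨by omega⟩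
  have hlt : ∀ x : ZMod (2 * h), x.val < 2 * h := fun x => ZMod.val_lt x
  have hsucc : ∀ x : ZMod (2 * h), (x + 1).val = (x.val + 1) % (2 * h) := fun x => by
    rw [ZMod.val_add, ZMod.val_one_eq_one_mod, Nat.add_mod_mod]
  choose z hz hzs using fun x : ZMod (2 * h) =>
    P.exists_split (cycleIdx_fst_lt (hlt x)) (cycleIdx h x.val).2
  have hidx : ∀ x y : ZMod (2 * h), ∀ w ∈ graphRegion M q',
      Split h X' (cycleIdx h x.val).1 (cycleIdx h x.val).2 w →
      Split h X' (cycleIdx h y.val).1 (cycleIdx h y.val).2 w → x = y := by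
    intro x y w hw h1 h2
    obtain ⟨e1, e2⟩ := P.split_unique hw (cycleIdx_fst_lt (hlt x)) (cycleIdx_fst_lt (hlt y)) h1 h2
    exact ZMod.val_injective _ (cycleIdx_inj (Prod.ext e1 e2))
  let f : ZMod (2 * h) → splitSet M q' h X' := fun x =>
    ⟨vtx (hz x), z x, mem_vtx _, _, cycleIdx_fst_lt (hlt x), _, hzs x⟩
  have hmem : ∀ x, z x ∈ (f x).1.1 := fun x => mem_vtx (hz x)
  have hf : Function.Bijective f := by
    constructor
    · intro x y hxy
      have hc := (P.up.vertex_eq_iff (hmem x) (hmem y)).1 (congrArg Subtype.val hxy)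
      exact hidx x y _ (hz y) (split_of_code hc (cycleIdx_fst_lt (hlt x)) (hzs x)) (hzs y)
    · rintro ⟨J, w, hw, i, hi, s, hs⟩
      have hx : ∃ x < 2 * h, cycleIdx h x = (i, s) := by
        cases s with
        | true => exact ⟨i, by omega, by rw [cycleIdx, if_pos hi]⟩
        | false => exact ⟨i + h, by omega, by rw [cycleIdx, if_neg (by omega)]; simp⟩
      obtain ⟨x, hx, hxi⟩ := hx
      refine ⟨(x : ZMod (2 * h)), Subtype.ext ?_⟩
      have h1 := hzs (x : ZMod (2 * h))
      rw [ZMod.val_natCast_of_lt hx, hxi] at h1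
      exact (P.up.vertex_eq_iff (hmem _) hw).2 (P.split_code (hz _) (J.subset hw) hi h1 hs)
  refine ⟨Equiv.ofBijective f hf, fun x => ⟨D (cycleIdx h x.val).1 (cycleIdx h x.val).2,
    Nat.lt_succ_of_le (P.low.digit_le _ _)⟩, fun x k y => ?_⟩
  change (univoqueGraph M q').Edge (f x).1 k (f y).1 ↔ _
  have hxlt := cycleIdx_fst_lt (hlt x)
  rw [P.up.edge_iff (hmem y)]
  constructor
  · intro he
    have hs := split_of_code ((P.up.mem_vertex_iff (hmem x) ((f x).1.subset he)).1 he) hxlt (hzs x)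
    obtain ⟨e1, e2⟩ := P.split_next (hz y) (Nat.lt_succ_iff.1 k.2) ((f x).1.subset he) hxlt hs
    rw [nextIdx_cycleIdx (hlt x), ← hsucc] at e2
    exact ⟨hidx _ _ _ (hz y) (hzs y) e2, Fin.ext e1⟩
  · rintro ⟨rfl, rfl⟩
    have hs := hzs (x + 1)
    rw [hsucc, ← nextIdx_cycleIdx (hlt x)] at hs
    obtain ⟨e1, e2⟩ := P.split_prev (hz _) hxlt hs
    exact (P.up.mem_vertex_iff (hmem x) e1).2 (P.split_code (hz x) e1 hxlt (hzs x) e2)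

/-- The lower graph is embedded in the upper one as the full subgraph on the vertices that are not
separating; the embedding sends each vertex to the one formed by the matching points. -/
theorem exists_embedding (P : LevelPair M q q' h X X' D D') :
    ∃ e : GraphVertex M q → GraphVertex M q', Function.Injective e ∧
      (∀ I k J, (univoqueGraph M q).Edge I k J ↔ (univoqueGraph M q').Edge (e I) k (e J)) ∧
      (∀ J, J ∈ range e ↔ J ∉ splitSet M q' h X') ∧
      (∀ I J, ∀ z ∈ I.1, ∀ z' ∈ J.1, e I = J ↔ Match M q q' h X X' z z') := by
  have hex : ∀ I : GraphVertex M q, ∃ J : GraphVertex M q', ∀ z ∈ I.1, ∀ z' ∈ J.1,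
      Match M q q' h X X' z z' := by
    intro I
    obtain ⟨z, hz⟩ := I.exists_mem
    obtain ⟨z', hz', hm⟩ := P.exists_match_up (I.subset hz)
    refine ⟨vtx hz', fun w hw w' hw' => ?_⟩
    exact P.match_of_code hm ((P.low.mem_vertex_iff hz (I.subset hw)).1 hw)
      ((P.up.mem_vertex_iff (mem_vtx hz') ((vtx hz').subset hw')).1 hw')
  choose e he using hex
  have heq : ∀ I J, ∀ z ∈ I.1, ∀ z' ∈ J.1, e I = J ↔ Match M q q' h X X' z z' := by
    intro I J z hz z' hz'
    constructor
    · rintro rfl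
      exact he I z hz z' hz'
    · intro hm
      obtain ⟨w, hw⟩ := (e I).exists_mem
      exact (P.up.vertex_eq_iff hw hz').2 (P.match_code_up (he I z hz w hw) hm)
  refine ⟨e, fun I J hIJ => ?_, fun I k J => ?_, fun J => ?_, heq⟩
  · obtain ⟨z, hz⟩ := I.exists_mem
    obtain ⟨w, hw⟩ := J.exists_mem
    obtain ⟨z', hz'⟩ := (e I).exists_mem
    exact (P.low.vertex_eq_iff hz hw).2
      (P.match_code_low (he I z hz z' hz') (he J w hw z' (hIJ ▸ hz')))
  · obtain ⟨z, hz⟩ := J.exists_mem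
    obtain ⟨z', hz'⟩ := (e J).exists_mem
    obtain ⟨w, hw⟩ := I.exists_mem
    obtain ⟨w', hw'⟩ := (e I).exists_mem
    have hk := Nat.lt_succ_iff.1 k.2
    obtain ⟨h1, h2⟩ := P.match_pull (J.subset hz) ((e J).subset hz') (he J z hz z' hz') hk
    rw [P.low.edge_iff hz, P.up.edge_iff hz']
    constructor
    · intro hv
      have hv0 := I.subset hv
      exact (P.up.mem_vertex_iff hw' (h1.1 hv0)).2
        (P.match_code_up (he I _ hv w' hw') (h2 hv0))
    · intro hv
      have hv0 := h1.2 ((e I).subset hv)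
      exact (P.low.mem_vertex_iff hw hv0).2 (P.match_code_low (he I w hw _ hv) (h2 hv0))
  · obtain ⟨z', hz'⟩ := J.exists_mem
    constructor
    · rintro ⟨I, rfl⟩ ⟨w', hw', i, hi, s, hs⟩
      obtain ⟨z, hz⟩ := I.exists_mem
      exact P.not_split_of_match (he I z hz w' hw') hi s hs
    · intro hJ
      obtain ⟨z, hz, hm⟩ := P.exists_match_low (J.subset hz') fun i hi s hs =>
        hJ ⟨z', hz', i, hi, s, hs⟩
      exact ⟨vtx hz, (heq _ _ z (mem_vtx hz) z' hz').2 hm⟩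

theorem splitSet_closed (P : LevelPair M q q' h X X' D D') {I J : GraphVertex M q'}
    {k : Fin (M + 1)} (he : (univoqueGraph M q').Edge I k J) (hI : I ∈ splitSet M q' h X') :
    J ∈ splitSet M q' h X' := by
  obtain ⟨w, hw, i, hi, s, hs⟩ := hI
  obtain ⟨z, hz⟩ := J.exists_mem
  rw [P.up.edge_iff hz] at he
  have hs' := split_of_code ((P.up.mem_vertex_iff hw (I.subset he)).1 he) hi hs
  exact ⟨z, hz, _, nextIdx_fst_lt hi s, _,
    (P.split_next (J.subset hz) (Nat.lt_succ_iff.1 k.2) (I.subset he) hi hs').2⟩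

theorem mem_splitSet_iff (P : LevelPair M q q' h X X' D D') {z : ℝ} (hz : z ∈ graphRegion M q') :
    vtx hz ∈ splitSet M q' h X' ↔ ∃ i < h, ∃ s, Split h X' i s z := by
  constructor
  · rintro ⟨w, hw, i, hi, s, hs⟩
    exact ⟨i, hi, s,
      split_of_code ((P.up.mem_vertex_iff hw hz).1 (mem_vtx hz)) hi hs⟩
  · rintro ⟨i, hi, s, hs⟩
    exact ⟨z, mem_vtx hz, i, hi, s, hs⟩

end LevelPair

/-! ### Edges between consecutive blocks -/

theorem nextIdx_eq {h i : ℕ} {s : Bool} (hi : i < h) (h0 : (nextIdx h i s).1 = 0)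
    (ht : (nextIdx h i s).2 = true) : i + 1 = h ∧ s = false := by
  unfold nextIdx at h0 ht
  split_ifs at h0 ht with h1
  exact ⟨by omega, by simpa using ht⟩

namespace Level

variable {M : ℕ} {q : ℝ} {h : ℕ} {X : ℕ → Bool → ℝ} {D : ℕ → Bool → ℕ}

/-- The vertex next to `0` carries a loop. -/
theorem exists_loop (A : Level M q h X D) :
    ∃ (I : GraphVertex M q) (k : Fin (M + 1)), (univoqueGraph M q).Edge I k I := by
  have hq := A.one_lt
  have hθ := A.one_lt_theta
  have hq0 : 0 < q := by linarith
  set c := min (theta M q - 1) (1 / q) with hc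
  have hc0 : 0 < c := lt_min (by linarith) (by positivity)
  have hp : ∀ z ∈ Ioo 0 c, InPiece M q 0 z := by
    intro z hz
    have h1 : z < theta M q - 1 := hz.2.trans_le (min_le_left _ _)
    have h2 : z < 1 / q := hz.2.trans_le (min_le_right _ _)
    rw [lt_div_iff₀ hq0] at h2
    exact ⟨Nat.zero_le _, hz.1, by linarith, fun _ => by push_cast; linarith,
      fun h3 => absurd h3 (lt_irrefl _)⟩
  have hlt : ∀ z ∈ Ioo 0 c, ∀ i s, z < X i s := fun z hz i s =>
    (hz.2.trans_le (min_le_left _ _)).trans_le (A.ge i s)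
  have hmem : ∀ z ∈ Ioo 0 c, z ∈ graphRegion M q := fun z hz =>
    A.mem_region_iff.2 ⟨⟨0, hp z hz⟩, fun i _ s => (hlt z hz i s).ne⟩
  have hz : c / 2 ∈ Ioo 0 c := ⟨by linarith, by linarith⟩
  have hw : (c / 2 + ((0 : Fin (M + 1)) : ℕ)) / q ∈ Ioo 0 c := by
    simp only [Fin.val_zero, Nat.cast_zero, add_zero]
    refine ⟨by positivity, ?_⟩
    rw [div_lt_iff₀ hq0]
    nlinarith
  refine ⟨vtx (hmem _ hz), 0, ?_⟩
  rw [A.edge_iff (mem_vtx _), A.mem_vertex_iff (mem_vtx _) (hmem _ hw)]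
  exact ⟨⟨0, hp _ hz, hp _ hw⟩, fun i _ s =>
    iff_of_false (hlt _ hz i s).not_gt (hlt _ hw i s).not_gt⟩

end Level

namespace LevelPair

variable {M : ℕ} {q q' : ℝ} {h : ℕ} {X X' : ℕ → Bool → ℝ} {D D' : ℕ → Bool → ℕ}

/-- The cycle is entered from outside: the vertex separating the pair `(0, true)` has an incoming
edge for each of the labels `0` and `1`, and only one edge into it belongs to the cycle. -/
theorem exists_edge_into (P : LevelPair M q q' h X X' D D') :
    ∃ I ∉ splitSet M q' h X', ∃ k, ∃ J ∈ splitSet M q' h X', (univoqueGraph M q').Edge I k J := by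
  obtain ⟨z, hz, hs⟩ := P.exists_split P.low.pos true
  have hM : 1 ≤ M := by
    by_contra hM
    obtain rfl : M = 0 := by omega
    have := P.low.one_lt
    have := P.low.lt
    norm_num at this
    linarith
  obtain ⟨k, hk, hkD⟩ : ∃ k ≤ M, k ≠ D (h - 1) false := by
    by_cases h0 : D (h - 1) false = 0
    · exact ⟨1, hM, by omega⟩
    · exact ⟨0, by omega, by omega⟩
  have hw := hs.pull_mem P.up hz hk
  refine ⟨vtx hw, fun hI => ?_, ⟨k, Nat.lt_succ_of_le hk⟩, vtx hz,
    (P.mem_splitSet_iff hz).2 ⟨0, P.low.pos, true, hs⟩, (P.up.edge_iff (mem_vtx hz) _).2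
      (mem_vtx hw)⟩
  obtain ⟨i, hi, s, hs'⟩ := (P.mem_splitSet_iff hw).1 hI
  obtain ⟨e1, e2⟩ := P.split_next hz hk hw hi hs'
  obtain ⟨e3, e4⟩ := P.split_unique hz (nextIdx_fst_lt hi s) P.low.pos e2 hs
  obtain ⟨e5, rfl⟩ := nextIdx_eq hi e3 e4
  exact hkD (by rw [e1, show i = h - 1 by omega])

/-- Among three consecutive levels, some edge leads from the cycle of the middle level to the cycle
of the upper one. Starting from the vertex of the upper cycle at `(0, true)`, read the digits of
the lower orbit backwards; the two cycles cannot read the same digits twice in a row, since that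
would force `M` to be both odd and even. -/
theorem exists_edge_between {q₁ q₂ : ℝ} {X₁ X₂ : ℕ → Bool → ℝ} {D₁ D₂ : ℕ → Bool → ℕ}
    (P : LevelPair M q q₁ h X X₁ D D₁) (Q : LevelPair M q₁ q₂ (2 * h) X₁ X₂ D₁ D₂) :
    ∃ I₁ ∈ splitSet M q₁ h X₁, ∃ I : GraphVertex M q₂,
      (∃ z₁ ∈ I₁.1, ∃ z ∈ I.1, Match M q₁ q₂ (2 * h) X₁ X₂ z₁ z) ∧
      ∃ k, ∃ J ∈ splitSet M q₂ (2 * h) X₂, (univoqueGraph M q₂).Edge I k J := by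
  have hpos := P.low.pos
  have hdbl : Doubled h D₂ := by
    intro i hi
    have h1 := P.doubled i hi
    have e1 := Q.digit i (by omega)
    have e2 := Q.digit (i + h) (by omega)
    simp only [e1, e2]
    exact h1
  -- a vertex outside the upper cycle that splits the lower pairs has a counterpart in the middle
  have finish : ∀ w (hw : w ∈ graphRegion M q₂) (z) (hz : z ∈ graphRegion M q₂) (k : Fin (M + 1)),
      w = (z + ((k : ℕ) : ℝ)) / q₂ → (∀ i < 2 * h, ∀ s, ¬ Split (2 * h) X₂ i s w) →
      (∃ i < h, ∃ s, Split h X₂ i s w) → (∃ i < 2 * h, ∃ s, Split (2 * h) X₂ i s z) →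
      ∃ I₁ ∈ splitSet M q₁ h X₁, ∃ I : GraphVertex M q₂,
        (∃ z₁ ∈ I₁.1, ∃ z ∈ I.1, Match M q₁ q₂ (2 * h) X₁ X₂ z₁ z) ∧
        ∃ k, ∃ J ∈ splitSet M q₂ (2 * h) X₂, (univoqueGraph M q₂).Edge I k J := by
    rintro w hw z hz k hwz hns ⟨i, hi, s, hs⟩ hzs
    obtain ⟨w₁, hw₁, hm⟩ := Q.exists_match_low hw hns
    refine ⟨vtx hw₁, (P.mem_splitSet_iff hw₁).2 ⟨i, hi, s, ?_⟩, vtx hw,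
      ⟨w₁, mem_vtx _, w, mem_vtx _, hm⟩, k, vtx hz, (Q.mem_splitSet_iff hz).2 hzs, ?_⟩
    · unfold Split at hs ⊢
      rwa [hm.2 i (by omega), hm.2 (i + h) (by omega)]
    · rw [Q.up.edge_iff (mem_vtx hz), ← hwz]
      exact mem_vtx hw
  obtain ⟨z, hz, hs⟩ := Q.exists_split (i := 0) (by omega) true
  have hb := hs.bounds Q.up hz
  have hs0 : Split h X₂ 0 true z := by
    unfold Split at hs ⊢
    rw [zero_add, Q.up.zero, Bool.not_true] at hs ⊢
    have h1 : X₂ (2 * h) false < z := by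
      by_contra h1
      exact hs (iff_of_false hb.2.not_gt h1)
    have h2 : X₁ h false < X₁ (2 * h) false := by
      rw [P.up.half_false]
      exact P.up.lt_one (by omega) (by omega) _
    have h3 := (Q.mono (by omega) (by omega) h2).resolve_right (by omega)
    exact fun hc => hb.2.not_gt (hc.2 (h3.trans h1))
  have hk : D₂ (h - 1) false ≤ M := Q.up.digit_le _ _
  have hw := hs.pull_mem Q.up hz hk
  have hidx : (nextIdx h (h - 1) false) = (0, true) := by
    rw [nextIdx, if_neg (by omega)]
    rfl
  have hws : Split h X₂ (h - 1) false ((z + D₂ (h - 1) false) / q₂) := by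
    rw [split_pull_iff Q.up hdbl (by omega) hz hw, hidx]
    exact hs0
  by_cases hc : ∀ i < 2 * h, ∀ s, ¬ Split (2 * h) X₂ i s ((z + D₂ (h - 1) false) / q₂)
  · exact finish _ hw z hz ⟨_, Nat.lt_succ_of_le hk⟩ rfl hc ⟨h - 1, by omega, false, hws⟩
      ⟨0, by omega, true, hs⟩
  push Not at hc
  obtain ⟨i, hi, s, hcs⟩ := hc
  obtain ⟨e1, e2⟩ := Q.split_next hz hk hw hi hcs
  obtain ⟨e3, e4⟩ := Q.split_unique hz (nextIdx_fst_lt hi s) (by omega) e2 hs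
  obtain ⟨e5, rfl⟩ := nextIdx_eq hi e3 e4
  obtain ⟨i₂, s₂, hi₂, hnext, hi₂'⟩ : ∃ i₂ s₂, i₂ < h ∧ nextIdx h i₂ s₂ = (h - 1, false) ∧
      ((i₂ + 2 = h ∧ s₂ = false) ∨ (h = 1 ∧ i₂ = 0 ∧ s₂ = true)) := by
    rcases Nat.lt_or_ge 1 h with h1 | h1
    · refine ⟨h - 2, false, by omega, ?_, Or.inl ⟨by omega, rfl⟩⟩
      rw [nextIdx, if_pos (by omega), show h - 2 + 1 = h - 1 by omega]
    · obtain rfl : h = 1 := by omega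
      exact ⟨0, true, by omega, rfl, Or.inr ⟨rfl, rfl, rfl⟩⟩
  set w := (z + D₂ (h - 1) false) / q₂ with hwdef
  have hk₂ : D₂ i₂ s₂ ≤ M := Q.up.digit_le _ _
  have hv := hcs.pull_mem Q.up hw hk₂
  have hvs : Split h X₂ i₂ s₂ ((w + D₂ i₂ s₂) / q₂) := by
    rw [split_pull_iff Q.up hdbl hi₂ hw hv, hnext]
    exact hws
  refine finish _ hv w hw ⟨_, Nat.lt_succ_of_le hk₂⟩ rfl (fun j hj t hjt => ?_) ⟨i₂, hi₂, s₂, hvs⟩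
    ⟨i, hi, false, hcs⟩
  obtain ⟨f1, f2⟩ := Q.split_next hw hk₂ hv hj hjt
  obtain ⟨f3, f4⟩ := Q.split_unique hw (nextIdx_fst_lt hj t) hi f2 hcs
  have f5 : j + 2 = 2 * h ∧ t = false := by
    unfold nextIdx at f3 f4
    split_ifs at f3 f4 with h1
    · exact ⟨by simp only at f3; omega, f4⟩
    · simp only at f3; omega
  obtain ⟨f6, rfl⟩ := f5
  -- the digits read by both cycles are self-reflected, up to one unit in the last place
  have g1 : D₂ (h - 1) false = D (h - 1) false := by
    rw [Q.digit _ (by omega), P.digit _ (by omega)]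
  have g2 : D₁ i false + 1 = M - D (h - 1) false := by
    have a1 := P.last_false
    have a2 := P.low.digit_add_half (h - 1) false
    rw [show h - 1 + h = 2 * h - 1 by omega, P.low.digit_flip] at a2
    rw [show i = 2 * h - 1 by omega]
    omega
  have g3 : D₂ i₂ s₂ = M - D₁ j false := by
    rw [Q.digit _ (by omega), P.digit _ (by omega), P.digit _ (by omega)]
    rcases hi₂' with ⟨h1, rfl⟩ | ⟨h1, h2, rfl⟩
    · rw [show j = i₂ + h by omega, P.low.digit_add_half, P.low.digit_flip]
      have := P.low.digit_le i₂ false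
      omega
    · rw [show j = i₂ by omega]
      exact P.low.digit_flip i₂ false
  have g4 := P.up.digit_le j false
  have g5 := P.low.digit_le (h - 1) false
  omega

end LevelPair

/-! ### Unions of increasing sequences of labeled graphs -/

namespace LabeledDigraph

variable {V W L : Type}

theorem IsPureCycle.nonempty {G : LabeledDigraph V L} (hG : G.IsPureCycle) : Nonempty V := by
  obtain ⟨p, -, v, -⟩ := hG
  exact ⟨v 0⟩

theorem IsPureCycle.hasPath {G : LabeledDigraph V L} (hG : G.IsPureCycle) (u w : V) :
    G.HasPath u w := by
  obtain ⟨p, hp, v, l, hv⟩ := hG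
  have : NeZero p := ⟨hp.ne'⟩
  have hedge : ∀ i, ∃ k, G.Edge (v i) k (v (i + 1)) := fun i => ⟨l i, (hv _ _ _).2 ⟨rfl, rfl⟩⟩
  have key : ∀ (i : ZMod p) (n : ℕ), G.HasPath (v i) (v (i + (n + 1 : ℕ))) := by
    intro i n
    induction n with
    | zero => exact .single (by simpa using hedge i)
    | succ n ih =>
      refine ih.tail ?_
      have := hedge (i + (n + 1 : ℕ))
      rwa [add_assoc, ← Nat.cast_succ] at this
  obtain ⟨i, rfl⟩ := v.surjective u
  obtain ⟨j, rfl⟩ := v.surjective w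
  have h := key i ((j - i - 1).val)
  rwa [Nat.cast_succ, ZMod.natCast_zmod_val, sub_add_cancel, add_sub_cancel] at h

theorem HasPath.of_induce {G : LabeledDigraph V L} {s : Set V} {u w : s}
    (h : (G.induce s).HasPath u w) : G.HasPath u w :=
  Relation.TransGen.lift (fun x : s => (x : V)) (fun _ _ h => h) _ _ h

end LabeledDigraph

/-- A sequence of labeled graphs, each embedded as a full subgraph in the next, such that no edge
leads from a new vertex to an old one. -/
structure GraphTower (L : Type) where
  T : ℕ → Type
  G : ∀ m, LabeledDigraph (T m) L
  e : ∀ m, T m → T (m + 1)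
  inj : ∀ m, Function.Injective (e m)
  edge : ∀ m u k v, (G m).Edge u k v ↔ (G (m + 1)).Edge (e m u) k (e m v)
  closed : ∀ m u k v, (G (m + 1)).Edge u k v → u ∉ range (e m) → v ∉ range (e m)

namespace GraphTower

variable {L : Type} (A : GraphTower L)

/-- The vertices of stage `m` that are not in the image of the stage before. -/
def new : ∀ m, Set (A.T m)
  | 0 => univ
  | m + 1 => (range (A.e m))ᶜ

/-- The vertices of the union, each represented at the stage where it appears. -/
abbrev Limit : Type := Σ m, A.new m

/-- The embedding of a stage in a later one. -/
def lift {i j : ℕ} (h : i ≤ j) : A.T i → A.T j := Nat.leRecOn (C := A.T) h fun {k} => A.e k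

theorem lift_self {i : ℕ} (x : A.T i) : A.lift le_rfl x = x := Nat.leRecOn_self x

theorem lift_succ {i j : ℕ} (h : i ≤ j) (x : A.T i) :
    A.lift (Nat.le_succ_of_le h) x = A.e j (A.lift h x) := Nat.leRecOn_succ h x

theorem lift_trans {i j k : ℕ} (h : i ≤ j) (h' : j ≤ k) (x : A.T i) :
    A.lift (h.trans h') x = A.lift h' (A.lift h x) := Nat.leRecOn_trans h h' x

theorem lift_injective {i j : ℕ} (h : i ≤ j) : Function.Injective (A.lift h) :=
  Nat.leRecOn_injective h _ fun k => A.inj k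

theorem edge_lift {i j : ℕ} (h : i ≤ j) (u : A.T i) (k : L) (v : A.T i) :
    (A.G i).Edge u k v ↔ (A.G j).Edge (A.lift h u) k (A.lift h v) := by
  induction j, h using Nat.le_induction with
  | base => rw [lift_self, lift_self]
  | succ j h ih => rw [ih, lift_succ _ h, lift_succ _ h, A.edge]

/-- A vertex that comes from an earlier stage is not new. -/
theorem lift_notMem_new {i j : ℕ} (h : i < j) (x : A.T i) : A.lift h.le x ∉ A.new j := by
  obtain ⟨j, rfl⟩ : ∃ l, j = l + 1 := ⟨j - 1, by omega⟩
  rw [A.lift_succ (Nat.lt_succ_iff.1 h)]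
  exact fun hc => hc ⟨_, rfl⟩

/-- The union of the tower. -/
def limit : LabeledDigraph A.Limit L where
  Edge u k v := (A.G (max u.1 v.1)).Edge (A.lift (le_max_left _ _) u.2.1) k
    (A.lift (le_max_right _ _) v.2.1)

theorem limit_edge_iff {u v : A.Limit} {k : L} {N : ℕ} (hu : u.1 ≤ N) (hv : v.1 ≤ N) :
    A.limit.Edge u k v ↔ (A.G N).Edge (A.lift hu u.2.1) k (A.lift hv v.2.1) := by
  have h : max u.1 v.1 ≤ N := max_le hu hv
  change (A.G (max u.1 v.1)).Edge _ k _ ↔ _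
  rw [A.edge_lift h, ← A.lift_trans, ← A.lift_trans]

theorem le_of_edge {u v : A.Limit} {k : L} (h : A.limit.Edge u k v) : u.1 ≤ v.1 := by
  by_contra hlt
  rw [not_le] at hlt
  obtain ⟨i, x, hx⟩ := u
  rw [A.limit_edge_iff (N := i) le_rfl hlt.le, A.lift_self] at h
  obtain ⟨i, rfl⟩ : ∃ l, i = l + 1 := ⟨i - 1, by simp only at hlt; omega⟩
  exact A.closed _ _ _ _ h hx (not_not.1 (A.lift_notMem_new hlt v.2.1))

theorem le_of_hasPath {u v : A.Limit} (h : A.limit.HasPath u v) : u.1 ≤ v.1 := by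
  induction h with
  | single h => exact A.le_of_edge h.choose_spec
  | tail _ h ih => exact ih.trans (A.le_of_edge h.choose_spec)

theorem lift_limit_injective (N : ℕ) :
    Function.Injective fun w : {w : A.Limit | w.1 ≤ N} => A.lift w.2 w.1.2.1 := by
  have key : ∀ u v : A.Limit, ∀ (hu : u.1 ≤ N) (hv : v.1 ≤ N),
      A.lift hu u.2.1 = A.lift hv v.2.1 → ¬ u.1 < v.1 := by
    intro u v hu hv h hlt
    rw [A.lift_trans hlt.le hv] at h
    exact A.lift_notMem_new hlt u.2.1 (A.lift_injective hv h ▸ v.2.2)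
  rintro ⟨⟨i, x⟩, hi⟩ ⟨⟨j, y⟩, hj⟩ h
  obtain rfl : i = j := le_antisymm (not_lt.1 (key ⟨j, y⟩ ⟨i, x⟩ hj hi h.symm))
    (not_lt.1 (key ⟨i, x⟩ ⟨j, y⟩ hi hj h))
  obtain rfl : x = y := Subtype.ext (A.lift_injective hi h)
  rfl

theorem lift_limit_surjective (N : ℕ) :
    Function.Surjective fun w : {w : A.Limit | w.1 ≤ N} => A.lift w.2 w.1.2.1 := by
  induction N with
  | zero => exact fun x => ⟨⟨⟨0, x, mem_univ _⟩, le_refl 0⟩, A.lift_self x⟩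
  | succ N ih =>
    intro x
    by_cases hx : x ∈ range (A.e N)
    · obtain ⟨y, rfl⟩ := hx
      obtain ⟨⟨w, hw⟩, rfl⟩ := ih y
      exact ⟨⟨w, Nat.le_succ_of_le hw⟩, A.lift_succ hw _⟩
    · exact ⟨⟨⟨N + 1, x, hx⟩, le_refl (N + 1)⟩, A.lift_self x⟩

theorem induce_isomorphic (N : ℕ) :
    (A.limit.induce {w | w.1 ≤ N}).Isomorphic (A.G N) :=
  ⟨Equiv.ofBijective _ ⟨A.lift_limit_injective N, A.lift_limit_surjective N⟩,
    fun u _ v => A.limit_edge_iff u.2 v.2⟩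

/-- The new vertices of stage `m`, as vertices of the union. -/
def blockEquiv (m : ℕ) : A.new m ≃ {w : A.Limit | w.1 = m} where
  toFun x := ⟨⟨m, x⟩, rfl⟩
  invFun w := w.2 ▸ w.1.2
  left_inv _ := rfl
  right_inv := by
    rintro ⟨⟨i, x⟩, rfl⟩
    rfl

theorem induce_block_isPureCycle {m : ℕ} (h : ((A.G m).induce (A.new m)).IsPureCycle) :
    (A.limit.induce {w | w.1 = m}).IsPureCycle := by
  obtain ⟨p, hp, v, l, hv⟩ := h
  refine ⟨p, hp, v.trans (A.blockEquiv m), l, fun i k j => ?_⟩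
  rw [← hv]
  change A.limit.Edge ⟨m, v i⟩ k ⟨m, v j⟩ ↔ (A.G m).Edge (v i) k (v j)
  rw [A.limit_edge_iff (N := m) le_rfl le_rfl, A.lift_self, A.lift_self]

/-- If the blocks after the first are cycles and every block has an edge into the next one, then
the reachable blocks are the later ones. -/
theorem exists_hasPath_iff (hloop : ∃ u k, (A.G 0).Edge u k u)
    (hcyc : ∀ m, ((A.G (m + 1)).induce (A.new (m + 1))).IsPureCycle)
    (hleak : ∀ m, ∃ u ∈ A.new m, ∃ k, ∃ v ∈ A.new (m + 1), (A.G (m + 1)).Edge (A.e m u) k v)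
    (i j : ℕ) : (∃ u ∈ {w : A.Limit | w.1 = i}, ∃ v ∈ {w : A.Limit | w.1 = j},
      A.limit.HasPath u v) ↔ i ≤ j := by
  have hconn : ∀ m, ∀ u v : A.Limit, u.1 = m + 1 → v.1 = m + 1 → A.limit.HasPath u v := by
    intro m u v hu hv
    exact ((A.induce_block_isPureCycle (hcyc m)).hasPath ⟨u, hu⟩ ⟨v, hv⟩).of_induce
  have hedge : ∀ m, ∃ u v : A.Limit, u.1 = m ∧ v.1 = m + 1 ∧ A.limit.HasPath u v := by
    intro m
    obtain ⟨u, hu, k, v, hv, h⟩ := hleak m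
    refine ⟨⟨m, u, hu⟩, ⟨m + 1, v, hv⟩, rfl, rfl, .single ⟨k, ?_⟩⟩
    rw [A.limit_edge_iff (N := m + 1) (Nat.le_succ m) le_rfl, A.lift_succ le_rfl, A.lift_self,
      A.lift_self]
    exact h
  constructor
  · rintro ⟨u, rfl, v, rfl, h⟩
    exact A.le_of_hasPath h
  · intro h
    induction j, h using Nat.le_induction with
    | base =>
      cases i with
      | zero =>
        obtain ⟨u, k, h⟩ := hloop
        refine ⟨⟨0, u, mem_univ _⟩, rfl, ⟨0, u, mem_univ _⟩, rfl, .single ⟨k, ?_⟩⟩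
        rw [A.limit_edge_iff (N := 0) le_rfl le_rfl, A.lift_self]
        exact h
      | succ i =>
        obtain ⟨w, hw⟩ := (A.induce_block_isPureCycle (hcyc i)).nonempty
        exact ⟨w, hw, w, hw, hconn i w w hw hw⟩
    | succ j hij ih =>
      obtain ⟨a, b, ha, hb, hab⟩ := hedge j
      cases j with
      | zero =>
        obtain rfl : i = 0 := by omega
        exact ⟨a, ha, b, hb, hab⟩
      | succ j =>
        obtain ⟨u, hu, v, hv, huv⟩ := ih
        exact ⟨u, hu, b, hb, (huv.trans (hconn j v a hv ha)).trans hab⟩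

end GraphTower

/-! ### The levels attached to a gap -/

/-- The orbit of `1` under the digits `α`, and its reflection. -/
noncomputable def orbitPt (M : ℕ) (q : ℝ) (α : ℕ → ℕ) (i : ℕ) (s : Bool) : ℝ :=
  if s then val q (shift i α) else theta M q - val q (shift i α)

/-- The digits of the orbit of `1`, and their reflections. -/
def orbitDigit (M : ℕ) (α : ℕ → ℕ) (i : ℕ) (s : Bool) : ℕ := if s then α i else M - α i

theorem pointsA_eq {M : ℕ} {q : ℝ} {b : DigitSeq M} {N : ℕ} (hb : IsFiniteBeta M q b N) :
    pointsA M q = {x | ∃ i < N, IsExpansion M q x fun k => b (i + k)} := by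
  ext x
  constructor
  · rintro ⟨b', N', hb', i, hi, hx⟩
    have hbb : b' = b :=
      toLex.injective (le_antisymm (hb.1.2 _ hb'.1.1) (hb'.1.2 _ hb.1.1))
    subst hbb
    have hN : ∀ {N N'}, IsFiniteBeta M q b' N → IsFiniteBeta M q b' N' → N ≤ N' := by
      intro N N' h1 h2
      by_contra h3
      exact h1.2.2.1 (h2.2.2.2 _ (by omega))
    exact ⟨i, hi.trans_le (hN hb' hb), hx⟩
  · rintro ⟨i, hi, hx⟩
    exact ⟨b, N, hb, i, hi, hx⟩

/-- In the base for which the lowered periodic continuation of a doubled word is the quasi-greedy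
expansion of `1`, the orbit of `1` is a level: the continuation is reflected by the shift through
half its period. -/
theorem level_of_good {M : ℕ} {c : ℕ → ℕ} {n : ℕ} (h : Good M c n) {q : ℝ} (hq : 1 < q)
    (hqM : q < M + 1) (h1 : val q (per (dbl M c n) (2 * n)) = 1) :
    Level M q n (orbitPt M q (per (dbl M c n) (2 * n)))
      (orbitDigit M (per (dbl M c n) (2 * n))) := by
  have hn := h.pos
  have hp := h.parry_per_dbl
  have hlt : ∀ j, 0 < j → j < 2 * n → val q (shift j (per (dbl M c n) (2 * n))) < 1 := by
    intro j hj0 hj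
    refine hp.val_shift_lt hq h1 (h.dbl.shift_per_lt ?_)
    rw [Nat.mod_eq_of_lt hj]
    omega
  have hbeta := h.dbl.isFiniteBeta hq hp.first_ne h1
  have hcut : ∀ i < 2 * n, val q (shift i (cut (dbl M c n) (2 * n))) =
      val q (shift i (per (dbl M c n) (2 * n))) := fun i hi => h.dbl.val_shift_cut hq h1 hi
  have hA : pointsA M q = {x | ∃ i < 2 * n, x = val q (shift i (per (dbl M c n) (2 * n)))} := by
    rw [pointsA_eq hbeta]
    ext x
    refine exists_congr fun i => and_congr_right fun hi => ?_
    rw [isExpansion_iff hq, ← hcut i hi, eq_comm]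
    rfl
  have hrefl := h.reflect_per_dbl
  generalize hα : per (dbl M c n) (2 * n) = α at *
  have hd := hp.digits
  have hhalf : ∀ i, val q (shift (i + n) α) = theta M q - val q (shift i α) := by
    intro i
    rw [theta, ← val_reflect hq (hd.shift i), reflect_shift, hrefl, shift_shift, Nat.add_comm]
  have hθ : q * theta M q = theta M q + M := by
    have : q - 1 ≠ 0 := by linarith
    rw [theta]
    field_simp
    ring
  have hflip : ∀ i s, orbitPt M q α i (!s) = theta M q - orbitPt M q α i s := by
    intro i s
    cases s <;> simp [orbitPt]
  have hadd : ∀ i s, orbitPt M q α (i + n) s = orbitPt M q α i (!s) := by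
    intro i s
    cases s <;> simp [orbitPt, hhalf]
  exact
  { one_lt := hq
    lt := hqM
    theta_lt := by
      have h2 := hhalf 0
      rw [zero_add] at h2
      have h3 := hlt n hn (by omega)
      have h4 : val q (shift 0 α) ≤ 1 := hp.val_shift_le hq h1 0
      linarith
    pos := hn
    step := by
      intro i s
      cases s with
      | true => simpa [orbitPt, orbitDigit] using val_shift_succ hq hd i
      | false =>
        have h2 := val_shift_succ hq hd i
        have h3 := hd i
        simp only [orbitPt, orbitDigit, Bool.false_eq_true, if_false]
        push_cast [h3]
        rw [h2]
        linarith
    le_one := by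
      intro i s
      cases s with
      | true => simpa [orbitPt] using hp.val_shift_le hq h1 i
      | false =>
        have h2 : theta M q - 1 ≤ _ := hp.le_val_shift hq h1 (hα ▸ h.reflect_per_dbl_le) i
        simp only [orbitPt, Bool.false_eq_true, if_false]
        linarith
    flip := hflip
    digit_flip := by
      intro i s
      have h3 := hd i
      cases s
      · simp only [orbitDigit, Bool.not_false, if_true, Bool.false_eq_true, if_false]
        omega
      · simp [orbitDigit]
    digit_le := by
      intro i s
      have h3 := hd i
      cases s <;> simp [orbitDigit, h3]
    add_half := hadd
    digit_add_half := by
      intro i s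
      have h2 : M - α i = α (n + i) := congrFun hrefl i
      have h3 := hd i
      rw [Nat.add_comm]
      cases s <;> simp only [orbitDigit, Bool.not_false, Bool.not_true, if_true,
        Bool.false_eq_true, if_false] <;> omega
    zero := by simpa [orbitPt] using h1
    top := by
      intro i hi s hX
      cases s with
      | true =>
        refine ⟨?_, rfl⟩
        by_contra h0
        exact (hlt i (by omega) (by omega)).ne (by simpa [orbitPt] using hX)
      | false =>
        rw [← Bool.not_true, ← hadd] at hX
        exact absurd (by simpa [orbitPt] using hX) (hlt (i + n) (by omega) (by omega)).ne
    pts := by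
      rw [pointsB, hA]
      have hT : ∀ i, val q (shift i α) = orbitPt M q α i true := fun i => by simp [orbitPt]
      have hred : ∀ i < 2 * n, ∀ s, ∃ j < n, ∃ t, orbitPt M q α i s = orbitPt M q α j t := by
        intro i hi s
        rcases Nat.lt_or_ge i n with h2 | h2
        · exact ⟨i, h2, s, rfl⟩
        · obtain ⟨j, rfl⟩ := Nat.exists_eq_add_of_le' h2
          exact ⟨j, by omega, !s, hadd j s⟩
      ext x
      constructor
      · rintro (⟨i, hi, rfl⟩ | ⟨-, ⟨i, hi, rfl⟩, rfl⟩)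
        · rw [hT]
          exact hred i hi true
        · rw [hT, ← theta, ← hflip]
          exact hred i hi _
      · rintro ⟨i, hi, s, rfl⟩
        cases s with
        | true => exact Or.inl ⟨i, by omega, (hT i).symm⟩
        | false =>
          refine Or.inl ⟨i + n, by omega, ?_⟩
          rw [hT, hadd]
          rfl }

theorem levelPair_of_good {M : ℕ} {c : ℕ → ℕ} {n : ℕ} (h : Good M c n) {q q' : ℝ} (hq : 1 < q)
    (hqM : q < M + 1) (h1 : val q (per (dbl M c n) (2 * n)) = 1) (hq' : 1 < q')
    (hqM' : q' < M + 1)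
    (h1' : val q' (per (dbl M (dbl M c n) (2 * n)) (2 * (2 * n))) = 1) :
    LevelPair M q q' n (orbitPt M q (per (dbl M c n) (2 * n)))
      (orbitPt M q' (per (dbl M (dbl M c n) (2 * n)) (2 * (2 * n))))
      (orbitDigit M (per (dbl M c n) (2 * n)))
      (orbitDigit M (per (dbl M (dbl M c n) (2 * n)) (2 * (2 * n)))) := by
  have hn := h.pos
  have hagree : ∀ i < 2 * n, per (dbl M (dbl M c n) (2 * n)) (2 * (2 * n)) i = dbl M c n i := by
    intro i hi
    rw [h.dbl.dbl.per_eq (by omega), dbl, if_pos hi]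
  have hlast := h.dbl.per_last
  have hpos := h.dbl.last
  have hle := h.dbl.digits (2 * n - 1)
  refine ⟨level_of_good h hq hqM h1, level_of_good h.dbl hq' hqM' h1', fun i hi s => ?_, ?_, ?_⟩
  · have h2 : per (dbl M (dbl M c n) (2 * n)) (2 * (2 * n)) i = per (dbl M c n) (2 * n) i := by
      rw [hagree i (by omega), h.dbl.per_eq hi]
    simp only [orbitDigit, h2]
  · simp only [orbitDigit, if_true, hagree _ (by omega : 2 * n - 1 < 2 * n), hlast]
    omega
  · simp only [orbitDigit, Bool.false_eq_true, if_false,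
      hagree _ (by omega : 2 * n - 1 < 2 * n), hlast]
    omega

/-! ### The tower of graphs of a gap -/

theorem levelPair_words {M : ℕ} {c : ℕ → ℕ} {n : ℕ} (hg : Good M c n) {q : ℕ → ℝ}
    (hq : ∀ m, 1 ≤ m → 1 < q m ∧ q m < M + 1 ∧ val (q m) (per (words M c n m) (2 ^ m * n)) = 1)
    (m : ℕ) : LevelPair M (q (m + 1)) (q (m + 2)) (2 ^ m * n)
      (orbitPt M (q (m + 1)) (per (words M c n (m + 1)) (2 ^ (m + 1) * n)))
      (orbitPt M (q (m + 2)) (per (words M c n (m + 2)) (2 ^ (m + 2) * n)))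
      (orbitDigit M (per (words M c n (m + 1)) (2 ^ (m + 1) * n)))
      (orbitDigit M (per (words M c n (m + 2)) (2 ^ (m + 2) * n))) := by
  obtain ⟨a1, a2, a3⟩ := hq (m + 1) (by omega)
  obtain ⟨b1, b2, b3⟩ := hq (m + 2) (by omega)
  have h1 : 2 ^ (m + 1) * n = 2 * (2 ^ m * n) := by rw [pow_succ]; ring
  have h2 : 2 ^ (m + 2) * n = 2 * (2 * (2 ^ m * n)) := by rw [pow_succ, pow_succ]; ring
  have e1 : per (words M c n (m + 1)) (2 ^ (m + 1) * n) =
      per (dbl M (words M c n m) (2 ^ m * n)) (2 * (2 ^ m * n)) := by rw [words_succ, h1]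
  have e2 : per (words M c n (m + 2)) (2 ^ (m + 2) * n) =
      per (dbl M (dbl M (words M c n m) (2 ^ m * n)) (2 * (2 ^ m * n)))
        (2 * (2 * (2 ^ m * n))) := by rw [words_succ, words_succ, h1, h2]
  rw [e1] at a3 ⊢
  rw [e2] at b3 ⊢
  exact levelPair_of_good (hg.words m) a1 a2 a3 b1 b2 b3

/-- The graphs `𝒢(q_1), 𝒢(q_2), …` form a tower whose blocks have the required properties. -/
theorem exists_tower {M : ℕ} {c : ℕ → ℕ} {n : ℕ} (hg : Good M c n) {q : ℕ → ℝ}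
    (hq : ∀ m, 1 ≤ m → 1 < q m ∧ q m < M + 1 ∧
      val (q m) (per (words M c n m) (2 ^ m * n)) = 1) :
    ∃ A : GraphTower (Fin (M + 1)),
      (∀ m, (A.G m).Isomorphic (univoqueGraph M (q (m + 1)))) ∧
      (A.new 0).encard = (2 * n + M - 1 : ℕ) ∧
      (∀ m, (A.new (m + 1)).encard = (2 ^ (m + 1) * n : ℕ)) ∧
      (∃ u k, (A.G 0).Edge u k u) ∧
      (∀ m, ((A.G (m + 1)).induce (A.new (m + 1))).IsPureCycle) ∧
      ∀ m, ∃ u ∈ A.new m, ∃ k, ∃ v ∈ A.new (m + 1), (A.G (m + 1)).Edge (A.e m u) k v := by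
  have P := levelPair_words hg hq
  have h2 : ∀ m, 2 ^ (m + 1) * n = 2 * (2 ^ m * n) := fun m => by rw [pow_succ]; ring
  choose e hinj hedge hrange hmatch using fun m => (P m).exists_embedding
  let S : ∀ m, Set (GraphVertex M (q (m + 2))) := fun m => splitSet M (q (m + 2)) (2 ^ m * n)
    (orbitPt M (q (m + 2)) (per (words M c n (m + 2)) (2 ^ (m + 2) * n)))
  have hS : ∀ m, (range (e m))ᶜ = S m := fun m => by
    ext J
    rw [mem_compl_iff, hrange, not_not]
  let A : GraphTower (Fin (M + 1)) :=
    { T := fun m => GraphVertex M (q (m + 1))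
      G := fun m => univoqueGraph M (q (m + 1))
      e := e
      inj := hinj
      edge := hedge
      closed := fun m u k v h hu => by
        rw [hrange, not_not] at hu ⊢
        exact (P m).splitSet_closed h hu }
  have hnew : ∀ m, A.new (m + 1) = S m := hS
  have hcycle := fun m => (P m).exists_cycle
  refine ⟨A, fun m => ⟨Equiv.refl _, fun _ _ _ => Iff.rfl⟩, ?_, fun m => ?_,
    (P 0).low.exists_loop, fun m => ?_, fun m => ?_⟩
  · obtain ⟨f⟩ := (P 0).low.card_vertices
    have hn := hg.pos
    rw [show A.new 0 = univ from rfl, encard_univ]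
    change ENat.card (GraphVertex M (q (0 + 1))) = _
    rw [← ENat.card_congr f, ENat.card_eq_coe_fintype_card]
    simp only [Fintype.card_sum, Fintype.card_prod, Fintype.card_fin, Fintype.card_bool]
    congr 1
    rw [pow_zero, one_mul]
    omega
  · obtain ⟨v, -⟩ := hcycle m
    have : NeZero (2 * (2 ^ m * n)) := ⟨by have := (P m).low.pos; omega⟩
    rw [hnew]
    change ENat.card (S m) = _
    rw [← ENat.card_congr v, ENat.card_eq_coe_fintype_card, ZMod.card, h2]
  · rw [hnew]
    obtain ⟨v, l, hv⟩ := hcycle m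
    exact ⟨_, by have := (P m).low.pos; omega, v, l, hv⟩
  · cases m with
    | zero =>
      obtain ⟨I, hI, k, J, hJ, h⟩ := (P 0).exists_edge_into
      obtain ⟨u, rfl⟩ := (hrange 0 I).2 hI
      exact ⟨u, mem_univ _, k, J, (hnew 0).symm ▸ hJ, h⟩
    | succ m =>
      have Q := P (m + 1)
      rw [h2 m] at Q
      have hm := hmatch (m + 1)
      obtain ⟨u, hu, I, ⟨z, hz, z', hz', hzz⟩, k, J, hJ, h⟩ :=
        (P m).exists_edge_between ((h2 m) ▸ P (m + 1))
      rw [← h2 m] at hJ hzz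
      obtain rfl := (hm u I z hz z' hz').2 hzz
      exact ⟨u, (hnew m).symm ▸ hu, k, J, (hnew (m + 1)).symm ▸ hJ, h⟩

end Univoque

theorem theorem1p4 (M : ℕ) (hM : 1 ≤ M) (q₀ q₀' : ℝ) (hgap : Univoque.IsGap M q₀ q₀')
    (hodd : q₀ = 1 → Odd M) :
    ∃ (β : Univoque.DigitSeq M) (n : ℕ) (q : ℕ → ℝ),
      Univoque.IsFiniteBeta M q₀ β n ∧
      StrictMonoOn q (Set.Ici 1) ∧
      q '' Set.Ici 1 = Univoque.basesV M ∩ Set.Ioo q₀ q₀' ∧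
      ∃ (W : Type) (G : Univoque.LabeledDigraph W (Fin (M + 1))) (V : ℕ → Set W),
        Infinite W ∧
        (∀ w : W, ∃! m : ℕ, 1 ≤ m ∧ w ∈ V m) ∧
        (V 1).encard = ((2 * n + M - 1 : ℕ) : ℕ∞) ∧
        (∀ m : ℕ, 2 ≤ m → (V m).encard = ((2 ^ (m - 1) * n : ℕ) : ℕ∞)) ∧
        (∀ m : ℕ, 2 ≤ m → (G.induce (V m)).IsPureCycle) ∧
        (∀ m : ℕ, 1 ≤ m →
          (G.induce {w | ∃ k : ℕ, 1 ≤ k ∧ k ≤ m ∧ w ∈ V k}).Isomorphic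
            (Univoque.univoqueGraph M (q m))) ∧
        (∀ j k : ℕ, 1 ≤ j → 1 ≤ k →
          ((∃ u ∈ V j, ∃ w ∈ V k, G.HasPath u w) ↔ j ≤ k)) := by
  obtain ⟨c, n, hg, ⟨b, hb⟩, q, hmono, himg, hq⟩ := Univoque.gap_structure hM hgap hodd
  obtain ⟨A, hiso, hcard₁, hcard, hloop, hcyc, hleak⟩ := Univoque.exists_tower hg hq
  have hpath := A.exists_hasPath_iff hloop hcyc hleak
  obtain ⟨V, hVmem⟩ : ∃ V : ℕ → Set A.Limit, ∀ m w, w ∈ V m ↔ w.1 + 1 = m :=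
    ⟨fun m => {w | w.1 + 1 = m}, fun _ _ => Iff.rfl⟩
  have hV : ∀ m, V (m + 1) = {w | w.1 = m} := fun m => by
    ext w
    rw [hVmem]
    exact Nat.add_right_cancel_iff
  have hencard : ∀ m, {w : A.Limit | w.1 = m}.encard = (A.new m).encard := fun m =>
    (ENat.card_congr (A.blockEquiv m)).symm
  refine ⟨b, n, q, hb, hmono, himg, A.Limit, A.limit, V, ?_, fun w => ?_, ?_,
    fun m hm => ?_, fun m hm => ?_, fun m hm => ?_, fun j k hj hk => ?_⟩
  · refine Infinite.of_surjective (fun w : A.Limit => w.1) fun m => ?_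
    obtain ⟨u, hu, -⟩ := (hpath m m).2 le_rfl
    exact ⟨u, hu⟩
  · exact ⟨w.1 + 1, ⟨by omega, (hVmem _ _).2 rfl⟩, fun m hm => ((hVmem _ _).1 hm.2).symm⟩
  · exact (congrArg encard (hV 0)).trans ((hencard 0).trans hcard₁)
  · obtain ⟨m, rfl⟩ : ∃ l, m = l + 2 := ⟨m - 2, by omega⟩
    rw [show m + 2 = (m + 1) + 1 from rfl, hV, hencard, hcard]
    rfl
  · obtain ⟨m, rfl⟩ : ∃ l, m = l + 2 := ⟨m - 2, by omega⟩
    rw [show m + 2 = (m + 1) + 1 from rfl, hV]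
    exact A.induce_block_isPureCycle (hcyc m)
  · obtain ⟨m, rfl⟩ : ∃ l, m = l + 1 := ⟨m - 1, by omega⟩
    have hset : {w : A.Limit | ∃ k : ℕ, 1 ≤ k ∧ k ≤ m + 1 ∧ w ∈ V k} = {w | w.1 ≤ m} := by
      ext w
      constructor
      · rintro ⟨k, -, hk, hw⟩
        rw [← (hVmem _ _).1 hw] at hk
        exact Nat.le_of_succ_le_succ hk
      · exact fun hw => ⟨w.1 + 1, by omega, Nat.succ_le_succ hw, (hVmem _ _).2 rfl⟩
    rw [hset]
    obtain ⟨e, he⟩ := A.induce_isomorphic m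
    obtain ⟨f, hf⟩ := hiso m
    exact ⟨e.trans f, fun u k v => (he u k v).trans (hf _ _ _)⟩
  · obtain ⟨j, rfl⟩ : ∃ l, j = l + 1 := ⟨j - 1, by omega⟩
    obtain ⟨k, rfl⟩ : ∃ l, k = l + 1 := ⟨k - 1, by omega⟩
    rw [hV, hV, hpath]
    omega
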